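/- Fix hyperparameters $a_1,a_2,b_1,b_2>0$. For each $q\in\mathbb N$ let a data set be given, consisting of a number of covariates $p=p(q)$, group sizes $r_1,\dots,r_q\ge 1$ (depending on $q$), covariate vectors $x_{ij}\in\mathbb R^p$ and responses $y_{ij}\in\mathbb R$ ($1\le i\le q$, $1\le j\le r_i$). Consider the Bayesian linear mixed model $$y_{ij}\mid\beta,u,\tau\sim N(x_{ij}^\top\beta+u_i,\tau^{-1}),\qquad u_i\mid\mu,\lambda\sim N(\mu,\lambda^{-1}),\qquad \lambda\sim\mathrm{Gamma}(a_1,b_1),\quad \tau\sim\mathrm{Gamma}(a_2,b_2)$$ (shape and rate; everything conditionally independent), with flat priors on $\beta\in\mathbb R^p$ and $\mu\in\mathbb R$. Put $\eta_{00}=\sqrt q\,\beta$, $\eta_0=\sqrt q\,\mu$, $\eta_i=u_i$ for $1\le i\le q$, $\eta=(\eta_{00}^\top,\eta_0,\eta_1,\dots,\eta_q)^\top\in\mathbb R^{p+q+1}$, and let $\pi(\eta,\lambda,\tau\mid y)$ be the posterior density, with conditional densities $\pi_1(\eta\mid\lambda,\tau,y)$ and $\pi_2(\lambda,\tau\mid\eta,y)$.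 Let $\Pi$ be the marginal posterior distribution of $\eta$, and let $K$ be the transition kernel of the $\eta$-marginal Gibbs chain, with density $$k(\eta,\tilde\eta)=\int_0^\infty\!\!\int_0^\infty \pi_1(\tilde\eta\mid\lambda,\tau,y)\,\pi_2(\lambda,\tau\mid\eta,y)\,d\lambda\,d\tau ;$$ $K^n_\eta$ is the law of the chain after $n$ steps started at $\eta$. Let $r_{\max},r_{\min}$ be the largest and smallest of the $r_i$, $\bar r=q^{-1}\sum_i r_i$, $\bar x_i=r_i^{-1}\sum_j x_{ij}$, $\bar y_i=r_i^{-1}\sum_j y_{ij}$, $\bar y=q^{-1}\sum_i\bar y_i$; let $X$ be the matrix with rows $x_{ij}^\top$ and $\bar X$ the matrix of the same size whose row $(i,j)$ is $\bar x_i^\top$. Define $$V(\eta)=\frac1{\bar r q}\sum_{i=1}^q\sum_{j=1}^{r_i}\Big(\bar y-\frac{x_{ij}^\top\eta_{00}}{\sqrt q}\Big)^2+\frac{\eta_0^2}{q}+\frac1{\bar r q}\sum_{i=1}^q r_i(\eta_i+\bar y-\bar y_i)^2 .$$ Let $d_{TV}(\nu,\phi)=\sup_A[\nu(A)-\phi(A)]$,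 and let $d_W(\nu,\phi)=\inf_\xi\int\|x-x'\|\,\xi(dx,dx')$ be the Wasserstein distance (infimum over couplings, Euclidean norm). Assume: - (B1) there is $m>0$ with $r_{\max}/r_{\min}\le m$ for all $q\ge1$; - (B2) there are $k_1,k_2>0$ such that, for all large $q$, $k_1\le\lambda_{\min}\big[\frac1{\bar rq}(X^\top X-\bar X^\top\bar X)\big]$ and $\lambda_{\max}\big[\frac1{\bar rq}X^\top X\big]\le k_2$; - (B3) there is $\ell>0$ with $\frac1{\bar rq}\sum_{i,j}y_{ij}^2\le\ell$ for all $q\ge1$; - (B4) $p=O(q)$ as $q\to\infty$; - (B5) there is $\delta>0$ with $\bar r/q^{2+\delta}\to\infty$ as $q\to\infty$. Then there are positive constants $C,C',L_0$ not depending on $q$, a rate $\rho=\rho(q)\in[0,1)$ with $\rho(q)\to0$ as $q\to\infty$, and a positive integer $q_0$, such that for all $q\ge q_0$ the kernel $K$ is Markov, the posterior is proper (so $\Pi$ is a probability measure), $\Pi$ is invariant for $K$, and for all $\eta\in\mathbb R^{p+q+1}$ and all $n\in\{2,3,\dots\}$ $$d_{TV}(K^n_\eta,\Pi)\le C\,q\,\bar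 r^{3/2}\,d_W(K^{n-1}_\eta,\Pi)\le C'\,q^2\,\bar r^{3/2}\,\big(V(\eta)+L_0\big)\,\rho^{\,n-1}.$$ Consequently the geometric convergence rate $$\rho_*=\inf\{\rho\in[0,1]:\ \exists M:\mathbb R^{p+q+1}\to[0,\infty),\ d_{TV}(K^n_\eta,\Pi)\le M(\eta)\rho^n\ \text{for all }\eta\text{ and all }n\ge1\}$$ tends to $0$ as $q\to\infty$. -/

import Mathlib

open MeasureTheory ProbabilityTheory Filter Topology
open scoped ENNReal NNReal Matrix

noncomputable section

/-- Smallest eigenvalue of a real symmetric matrix (of positive size). -/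
def lambdaMin {n : Type*} [Fintype n] [DecidableEq n] (A : Matrix n n ℝ) : ℝ :=
  sInf (spectrum ℝ A)

/-- Largest eigenvalue of a real symmetric matrix (of positive size). -/
def lambdaMax {n : Type*} [Fintype n] [DecidableEq n] (A : Matrix n n ℝ) : ℝ :=
  sSup (spectrum ℝ A)

/-- Total variation distance `sup_A [ν(A) - φ(A)]` over measurable sets. For probability measures
the supremum is nonnegative (take `A = ∅`), so the truncated subtraction changes nothing. -/
def tvDist {α : Type*} [MeasurableSpace α] (ν φ : Measure α) : ℝ≥0∞ :=
  ⨆ (A : Set α) (_ : MeasurableSet A), ν A - φ A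

/-- `ξ` is a coupling of `ν` and `φ`: a probability measure on the product with these marginals. -/
def IsCouplingOf {α : Type*} [MeasurableSpace α] (ξ : Measure (α × α)) (ν φ : Measure α) : Prop :=
  IsProbabilityMeasure ξ ∧ ξ.map Prod.fst = ν ∧ ξ.map Prod.snd = φ

/-- Wasserstein distance of order 1 for the metric of the space, with values in `[0, ∞]`. -/
def wassersteinDist {α : Type*} [MeasurableSpace α] [PseudoEMetricSpace α]
    (ν φ : Measure α) : ℝ≥0∞ :=
  ⨅ (ξ : Measure (α × α)) (_ : IsCouplingOf ξ ν φ), ∫⁻ z, edist z.1 z.2 ∂ξ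

/-- Geometric convergence rate: the infimum of the `ρ ∈ [0,1]` such that, for some function `M`,
`d_TV(K^n_x, π) ≤ M(x) ρ^n` for all `x` and all `n ≥ 1`. -/
def geometricRate {α : Type*} [MeasurableSpace α] (K : Kernel α α) (π : Measure α) : ℝ :=
  sInf {ρ : ℝ | 0 ≤ ρ ∧ ρ ≤ 1 ∧ ∃ M : α → ℝ, (∀ x, 0 ≤ M x) ∧
    ∀ x : α, ∀ n : ℕ, 1 ≤ n → tvDist ((K ^ n) x) π ≤ ENNReal.ofReal (M x * ρ ^ n)}

theorem measurable_lintegral_Ioi_Ioi {α : Type*} [MeasurableSpace α] (f : α → ℝ → ℝ → ℝ≥0∞)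
    (hf : Measurable fun z : α × ℝ × ℝ => f z.1 z.2.1 z.2.2) :
    Measurable fun a => ∫⁻ s in Set.Ioi (0 : ℝ), ∫⁻ t in Set.Ioi (0 : ℝ), f a s t := by
  have h : Measurable fun w : (α × ℝ) × ℝ => f w.1.1 w.1.2 w.2 :=
    hf.comp (measurable_fst.fst.prodMk (measurable_fst.snd.prodMk measurable_snd))
  exact (h.lintegral_prod_right').lintegral_prod_right'

theorem measurable_lintegral_mix {α : Type*} [MeasurableSpace α] (ν : Measure α) [SFinite ν]
    (f : α → ℝ → ℝ → ℝ≥0∞) (g : α → ℝ≥0∞)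
    (hf : Measurable fun z : α × ℝ × ℝ => f z.1 z.2.1 z.2.2) (hg : Measurable g) :
    Measurable fun z : α × α => ∫⁻ s in Set.Ioi (0 : ℝ), ∫⁻ t in Set.Ioi (0 : ℝ),
      f z.2 s t / (∫⁻ a, f a s t ∂ν) * (f z.1 s t / g z.1) := by
  have hz : Measurable fun w : ℝ × ℝ => ∫⁻ a, f a w.1 w.2 ∂ν := by
    have h : Measurable fun v : (ℝ × ℝ) × α => f v.2 v.1.1 v.1.2 :=
      hf.comp (measurable_snd.prodMk measurable_fst)
    exact h.lintegral_prod_right'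
  refine measurable_lintegral_Ioi_Ioi
    (fun (z : α × α) s t => f z.2 s t / (∫⁻ a, f a s t ∂ν) * (f z.1 s t / g z.1)) ?_
  refine Measurable.mul (Measurable.div ?_ ?_) (Measurable.div ?_ ?_)
  · exact hf.comp (measurable_fst.snd.prodMk measurable_snd)
  · exact hz.comp measurable_snd
  · exact hf.comp (measurable_fst.fst.prodMk measurable_snd)
  · exact hg.comp measurable_fst.fst

/-- A data set with `q` groups: `p` covariates, group sizes `r i ≥ 1`, covariate vectors `x i j`
and observed responses `y i j`, for `i = 1, …, q` and `j = 1, …, r i`. -/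
structure MixedModelData (q : ℕ) where
  p : ℕ
  r : Fin q → ℕ
  r_pos : ∀ i, 0 < r i
  x : (i : Fin q) → Fin (r i) → Fin p → ℝ
  y : (i : Fin q) → Fin (r i) → ℝ

namespace MixedModelData

variable {q : ℕ} (D : MixedModelData q)

/-- Largest group size. -/
def rMax : ℕ := ⨆ i, D.r i

/-- Smallest group size. -/
def rMin : ℕ := ⨅ i, D.r i

/-- Average group size. -/
def rBar : ℝ := (q : ℝ)⁻¹ * ∑ i, (D.r i : ℝ)

/-- Covariate mean of group `i`. -/
def xBar (i : Fin q) : Fin D.p → ℝ := (D.r i : ℝ)⁻¹ • ∑ j, D.x i j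

/-- Response mean of group `i`. -/
def yBar (i : Fin q) : ℝ := (D.r i : ℝ)⁻¹ * ∑ j, D.y i j

/-- Average of the group means of the responses. -/
def yBarBar : ℝ := (q : ℝ)⁻¹ * ∑ i, D.yBar i

/-- The design matrix `X`, with one row `x i j` for each observation. -/
def designX : Matrix (Σ i : Fin q, Fin (D.r i)) (Fin D.p) ℝ :=
  Matrix.of fun o => D.x o.1 o.2

/-- The matrix of group means: the row of observation `(i, j)` is `xBar i`. -/
def designXBar : Matrix (Σ i : Fin q, Fin (D.r i)) (Fin D.p) ℝ :=
  Matrix.of fun o => D.xBar o.1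

/-- The state space `ℝ^(p+q+1)` with its Euclidean norm; a point is
`η = (η₀₀, η₀, η₁, …, η_q)` with `η₀₀ ∈ ℝ^p`. -/
abbrev State : Type := EuclideanSpace ℝ (Fin D.p ⊕ Unit ⊕ Fin q)

variable {D}

/-- The block `η₀₀ ∈ ℝ^p`. -/
def State.fixedPart (η : D.State) : Fin D.p → ℝ := fun k => η (Sum.inl k)

/-- The coordinate `η₀`. -/
def State.meanPart (η : D.State) : ℝ := η (Sum.inr (Sum.inl ()))

/-- The coordinates `η₁, …, η_q`. -/
def State.effect (η : D.State) (i : Fin q) : ℝ := η (Sum.inr (Sum.inr i))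

variable (D)

/-- Joint density of the responses `y`, the random effects `u`, and the precisions `lam`, `tau`
under flat priors on `β` and `μ`: `y i j ~ N(x i jᵀ β + u i, 1/tau)`, `u i ~ N(μ, 1/lam)`,
`lam ~ Gamma(a₁, b₁)`, `tau ~ Gamma(a₂, b₂)` (shape and rate). As a function of everything but `y`
it is the posterior density up to a constant. -/
def jointDensity (a₁ a₂ b₁ b₂ : ℝ) (β : Fin D.p → ℝ) (μ : ℝ) (u : Fin q → ℝ) (lam tau : ℝ) :
    ℝ≥0∞ :=
  (∏ i, ∏ j, gaussianPDF (D.x i j ⬝ᵥ β + u i) (Real.toNNReal tau⁻¹) (D.y i j)) *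
    (∏ i, gaussianPDF μ (Real.toNNReal lam⁻¹) (u i)) *
    gammaPDF a₁ b₁ lam * gammaPDF a₂ b₂ tau

/-- Unnormalised posterior density of `(η, lam, tau)`, where `η₀₀ = √q β` and `η₀ = √q μ`. -/
def postDensity (a₁ a₂ b₁ b₂ : ℝ) (η : D.State) (lam tau : ℝ) : ℝ≥0∞ :=
  D.jointDensity a₁ a₂ b₁ b₂ ((√(q : ℝ))⁻¹ • η.fixedPart) (η.meanPart / √(q : ℝ)) η.effect lam tau

/-- The unnormalised marginal posterior density of `η`. -/
def margDensity (a₁ a₂ b₁ b₂ : ℝ) (η : D.State) : ℝ≥0∞ :=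
  ∫⁻ lam in Set.Ioi (0 : ℝ), ∫⁻ tau in Set.Ioi (0 : ℝ), D.postDensity a₁ a₂ b₁ b₂ η lam tau

/-- Conditional density `π₁(η | lam, tau, y)`. -/
def condEta (a₁ a₂ b₁ b₂ : ℝ) (η : D.State) (lam tau : ℝ) : ℝ≥0∞ :=
  D.postDensity a₁ a₂ b₁ b₂ η lam tau / ∫⁻ η' : D.State, D.postDensity a₁ a₂ b₁ b₂ η' lam tau

/-- Conditional density `π₂(lam, tau | η, y)`. -/
def condPrec (a₁ a₂ b₁ b₂ : ℝ) (lam tau : ℝ) (η : D.State) : ℝ≥0∞ :=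
  D.postDensity a₁ a₂ b₁ b₂ η lam tau / D.margDensity a₁ a₂ b₁ b₂ η

/-- Markov transition density `k(η, η')` of the `η`-marginal Gibbs chain. -/
def transDensity (a₁ a₂ b₁ b₂ : ℝ) (η η' : D.State) : ℝ≥0∞ :=
  ∫⁻ lam in Set.Ioi (0 : ℝ), ∫⁻ tau in Set.Ioi (0 : ℝ),
    D.condEta a₁ a₂ b₁ b₂ η' lam tau * D.condPrec a₁ a₂ b₁ b₂ lam tau η

theorem measurable_postDensity (a₁ a₂ b₁ b₂ : ℝ) :
    Measurable fun z : D.State × ℝ × ℝ => D.postDensity a₁ a₂ b₁ b₂ z.1 z.2.1 z.2.2 := by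
  have hg : ∀ f g h : D.State × ℝ × ℝ → ℝ, Measurable f → Measurable g → Measurable h →
      Measurable fun z => gaussianPDF (f z) (Real.toNNReal (g z)) (h z) := by
    intro f g h hf hg hh
    exact measurable_uncurry_gaussianPDF.comp
      (hf.prodMk ((measurable_real_toNNReal.comp hg).prodMk hh))
  have hγ : ∀ (a b : ℝ) (f : D.State × ℝ × ℝ → ℝ), Measurable f →
      Measurable fun z => gammaPDF a b (f z) := by
    intro a b f hf
    exact ENNReal.measurable_ofReal.comp ((measurable_gammaPDFReal a b).comp hf)
  have hc : ∀ k, Measurable fun z : D.State × ℝ × ℝ => z.1 k := by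
    intro k
    fun_prop
  unfold postDensity jointDensity State.fixedPart State.meanPart State.effect
  refine ((Measurable.mul ?_ ?_).mul (hγ _ _ _ (by fun_prop))).mul (hγ _ _ _ (by fun_prop))
  · refine Finset.measurable_fun_prod _ fun i _ => Finset.measurable_fun_prod _ fun j _ => ?_
    refine hg _ _ _ ?_ (by fun_prop) (by fun_prop)
    refine Measurable.add ?_ (hc _)
    simp only [dotProduct, Pi.smul_apply, smul_eq_mul]
    exact Finset.measurable_fun_sum _ fun k _ => ((hc _).const_mul _).const_mul _
  · refine Finset.measurable_fun_prod _ fun i _ => ?_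
    exact hg _ _ _ ((hc _).div_const _) (by fun_prop) (hc _)

theorem measurable_margDensity (a₁ a₂ b₁ b₂ : ℝ) : Measurable (D.margDensity a₁ a₂ b₁ b₂) :=
  measurable_lintegral_Ioi_Ioi (D.postDensity a₁ a₂ b₁ b₂) (D.measurable_postDensity a₁ a₂ b₁ b₂)

theorem measurable_transDensity (a₁ a₂ b₁ b₂ : ℝ) :
    Measurable (Function.uncurry (D.transDensity a₁ a₂ b₁ b₂)) :=
  measurable_lintegral_mix volume (D.postDensity a₁ a₂ b₁ b₂) (D.margDensity a₁ a₂ b₁ b₂)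
    (D.measurable_postDensity a₁ a₂ b₁ b₂) (D.measurable_margDensity a₁ a₂ b₁ b₂)

/-- Transition kernel of the `η`-marginal Gibbs chain: `K(η, B) = ∫_B k(η, η') dη'`. -/
def gibbsKernel (a₁ a₂ b₁ b₂ : ℝ) : Kernel D.State D.State :=
  Kernel.withDensity (Kernel.const D.State volume) (D.transDensity a₁ a₂ b₁ b₂)

theorem gibbsKernel_apply (a₁ a₂ b₁ b₂ : ℝ) (η : D.State) :
    D.gibbsKernel a₁ a₂ b₁ b₂ η = volume.withDensity (D.transDensity a₁ a₂ b₁ b₂ η) := by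
  rw [gibbsKernel, Kernel.withDensity_apply _ (D.measurable_transDensity a₁ a₂ b₁ b₂),
    Kernel.const_apply]

/-- The marginal posterior distribution of `η`. -/
def posterior (a₁ a₂ b₁ b₂ : ℝ) : Measure D.State :=
  volume.withDensity fun η =>
    D.margDensity a₁ a₂ b₁ b₂ η / ∫⁻ η' : D.State, D.margDensity a₁ a₂ b₁ b₂ η'

/-- The drift function `V`. -/
def driftV (η : D.State) : ℝ :=
  (D.rBar * q)⁻¹ * ∑ i, ∑ j, (D.yBarBar - (D.x i j ⬝ᵥ η.fixedPart) / √(q : ℝ)) ^ 2 +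
    η.meanPart ^ 2 / q +
    (D.rBar * q)⁻¹ * ∑ i, (D.r i : ℝ) * (η.effect i + D.yBarBar - D.yBar i) ^ 2

end MixedModelData

end

/-!
Given `η`, the precisions `λ`, `τ` are independent Gamma variables whose rates `rateLam`, `rateTau`
are half the sums of squares of effects and residuals, shifted by `b₁`, `b₂`; given the precisions,
`η` is Gaussian. Hence one step of the chain depends on the current state through the two rates
only, and the chain is reversible with respect to the posterior. The proof shows that the rates
hardly depend on the current state once `q` is large.

In the coordinates `(η₀₀, u)` and `v = η₀ - √q ū` the conditional law of `η` is the weight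
`pairWeight`. By Pythagoras, `rateTau` is its minimum `optTau` plus half the squared distance
`fitSq` from the least squares estimate `lsq`, measured by the linear predictor; one step makes
`fitSq` of the order `q / r̄` times the previous `rateTau` (`Bounds.lintegral_fitSq_le`) and makes
`v ^ 2` of the order of the previous `rateLam / q`. Both follow from a general bound for the mean
energy of log-concave weights, `lintegral_energy_le`. With `optLam`, the value that `rateLam` has
at the least squares estimate when `v = 0`, this has two consequences.

* The function `lyap = rateLam / optLam + optLam / rateLam + rateTau / optTau` has a drift
  `K W ≤ 5 + γ W` with `γ` of the order `q ^ 2 / r̄ + 1 / q`, which tends to zero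
  (`Bounds.drift_lyap`).
* Gamma laws with relatively close rates are close in total variation
  (`lintegral_gammaMeasure_le`). One step from a sublevel set `W ≤ R ^ 2` brings the rates so near
  to `optLam`, `optTau` that the two-step laws of any two states of this set differ by
  `O(R ^ 4 (q / √r̄ + 1 / √q))` (`Bounds.excessMass_le`).

Coupling two copies of the two-step chain so that they agree as often as possible, the cost that
charges `√W` at both points when the copies differ is contracted by a factor that tends to zero:
inside the sublevel set the copies rarely separate, and outside it the drift is enough
(`excess_twoStep_contraction`). The distance of two states is at most a multiple of `√q` times this
cost, so the Wasserstein distance decays geometrically (`wassersteinDist_pow_le`). The initial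
value of `W` need not be bounded by `V + 1`, but it is after three steps
(`Bounds.lintegral_lyap_pow_le`); these steps are paid for by a rate `ρ` that tends to zero no
faster than `q ^ (-1 / 8)`. Since the rates are Lipschitz functions of the state in the relevant
sense, one more step turns Wasserstein distance into total variation
(`Bounds.tvDist_pow_succ_le`).

All constants depend on the data through the structure `Bounds` alone. Its fields follow from the
assumptions on the design by Rayleigh quotients (`bounds_of_assumptions`), and the growth of `r̄`
makes the error terms vanish.
-/

/-! ### Couplings and contraction for Markov chains with densities -/

noncomputable section Chain

variable {α : Type*} [MeasurableSpace α]

/-- If the one-step laws of `K` are Lipschitz in total variation, one step of `K` turns a bound in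
Wasserstein distance into a bound in total variation. -/
theorem tvDist_bind_le_mul_wassersteinDist [PseudoEMetricSpace α] (K : Kernel α α)
    {c : ℝ≥0∞} (h0 : c ≠ 0) (hc : c ≠ ∞)
    (hK : ∀ x y : α, ∀ S, MeasurableSet S → K x S ≤ K y S + c * edist x y)
    (μ π : Measure α) :
    tvDist (μ.bind K) (π.bind K) ≤ c * wassersteinDist μ π := by
  unfold wassersteinDist
  rw [ENNReal.mul_iInf_of_ne h0 hc]
  refine le_iInf fun ξ => ?_
  by_cases hξ : IsCouplingOf ξ μ π
  swap
  · simp [hξ, ENNReal.mul_top h0]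
  simp only [hξ, iInf_pos]
  obtain ⟨_, h1, h2⟩ := hξ
  refine iSup₂_le fun S hS => ?_
  rw [tsub_le_iff_left, Measure.bind_apply hS K.aemeasurable, Measure.bind_apply hS K.aemeasurable,
    ← h1, ← h2, lintegral_map (K.measurable_coe hS) measurable_fst,
    lintegral_map (K.measurable_coe hS) measurable_snd, ← lintegral_const_mul' _ _ hc,
    ← lintegral_add_left (f := fun z : α × α => K z.2 S)
      ((K.measurable_coe hS).comp measurable_snd)]
  exact lintegral_mono fun z => hK z.1 z.2 S hS

/-- Joint density of the part that the laws with densities `k x` and `k y` have in common. -/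
def overlap (k : α → α → ℝ≥0∞) (x y z : α) : ℝ≥0∞ := min (k x z) (k y z)

/-- Density of the part of the law with density `k x` exceeding the law with density `k y`. -/
def excess (k : α → α → ℝ≥0∞) (x y z : α) : ℝ≥0∞ := k x z - k y z

omit [MeasurableSpace α] in
theorem overlap_add_excess (k : α → α → ℝ≥0∞) (x y z : α) :
    overlap k x y z + excess k x y z = k x z := by
  unfold overlap excess
  rcases le_total (k x z) (k y z) with h | h
  · rw [min_eq_left h, tsub_eq_zero_of_le h, add_zero]
  · rw [min_eq_right h, add_tsub_cancel_of_le h]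

omit [MeasurableSpace α] in
theorem overlap_comm (k : α → α → ℝ≥0∞) (x y z : α) : overlap k x y z = overlap k y x z :=
  min_comm _ _

theorem measurable_overlap {k : α → α → ℝ≥0∞} (hk : Measurable (Function.uncurry k)) :
    Measurable (Function.uncurry fun (p : α × α) z => overlap k p.1 p.2 z) :=
  (hk.comp (measurable_fst.fst.prodMk measurable_snd)).min
    (hk.comp (measurable_fst.snd.prodMk measurable_snd))

theorem measurable_excess {k : α → α → ℝ≥0∞} (hk : Measurable (Function.uncurry k)) :
    Measurable (Function.uncurry fun (p : α × α) z => excess k p.1 p.2 z) :=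
  (hk.comp (measurable_fst.fst.prodMk measurable_snd)).sub
    (hk.comp (measurable_fst.snd.prodMk measurable_snd))

theorem measurable_excess_swap {k : α → α → ℝ≥0∞} (hk : Measurable (Function.uncurry k)) :
    Measurable (Function.uncurry fun (p : α × α) z => excess k p.2 p.1 z) :=
  (hk.comp (measurable_fst.snd.prodMk measurable_snd)).sub
    (hk.comp (measurable_fst.fst.prodMk measurable_snd))

/-- Mass of the excess. -/
def excessMass (ν : Measure α) (k : α → α → ℝ≥0∞) (x y : α) : ℝ≥0∞ := ∫⁻ z, excess k x y z ∂ν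

theorem lintegral_overlap_add_excessMass (ν : Measure α) {k : α → α → ℝ≥0∞}
    (hk : Measurable (Function.uncurry k)) (h1 : ∀ x, ∫⁻ z, k x z ∂ν = 1) (x y : α) :
    ∫⁻ z, overlap k x y z ∂ν + excessMass ν k x y = 1 := by
  have hm : Measurable fun z => overlap k x y z :=
    (measurable_overlap hk).comp (measurable_prodMk_left (x := (x, y)))
  rw [excessMass, ← lintegral_add_left hm]
  simp [overlap_add_excess, h1]

theorem excessMass_le_one (ν : Measure α) {k : α → α → ℝ≥0∞}
    (hk : Measurable (Function.uncurry k)) (h1 : ∀ x, ∫⁻ z, k x z ∂ν = 1) (x y : α) :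
    excessMass ν k x y ≤ 1 := by
  rw [← lintegral_overlap_add_excessMass ν hk h1 x y]
  exact le_add_self

theorem excessMass_comm (ν : Measure α) {k : α → α → ℝ≥0∞}
    (hk : Measurable (Function.uncurry k)) (h1 : ∀ x, ∫⁻ z, k x z ∂ν = 1) (x y : α) :
    excessMass ν k x y = excessMass ν k y x := by
  have h := lintegral_overlap_add_excessMass ν hk h1 x y
  have h' := lintegral_overlap_add_excessMass ν hk h1 y x
  simp only [overlap_comm k y x] at h'
  have hne : ∫⁻ z, overlap k x y z ∂ν ≠ ∞ := fun h0 => by simp [h0] at h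
  rw [← h'] at h
  exact (ENNReal.add_right_inj hne).mp h

/-- The mass of the excess is attained as the difference of the two laws on a measurable set. -/
theorem excessMass_le_of_forall_set (ν : Measure α) {k : α → α → ℝ≥0∞}
    (hk : Measurable (Function.uncurry k)) (h1 : ∀ x, ∫⁻ z, k x z ∂ν = 1) (x y : α) {c : ℝ≥0∞}
    (h : ∀ S, MeasurableSet S → ν.withDensity (k x) S ≤ ν.withDensity (k y) S + c) :
    excessMass ν k x y ≤ c := by
  have hx : Measurable (k x) := hk.of_uncurry_left
  have hy : Measurable (k y) := hk.of_uncurry_left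
  set S := {z | k y z ≤ k x z} with hS
  have hSm : MeasurableSet S := measurableSet_le hy hx
  have hfin : ∫⁻ z in S, k y z ∂ν ≠ ∞ :=
    ((setLIntegral_le_lintegral _ _).trans_lt (by rw [h1]; exact ENNReal.one_lt_top)).ne
  have h2 : excessMass ν k x y = ∫⁻ z in S, (k x z - k y z) ∂ν := by
    rw [excessMass, ← lintegral_indicator hSm]
    refine lintegral_congr fun z => ?_
    by_cases hz : z ∈ S
    · simp [hz, excess]
    · simp only [hz, not_false_eq_true, Set.indicator_of_notMem, excess]
      exact tsub_eq_zero_of_le (le_of_not_ge hz)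
  rw [h2, lintegral_sub hy hfin ((ae_restrict_iff' hSm).2 (ae_of_all _ fun z hz => hz)),
    tsub_le_iff_left]
  have := h S hSm
  rwa [withDensity_apply _ hSm, withDensity_apply _ hSm] at this

/-- Joint one-step move of two copies of the chain with transition density `k`: with the common
part of the two laws both copies move to the same point, and with the excess parts they move
independently. If the two laws agree, the second summand vanishes, whatever the value of
`0⁻¹`. -/
def couplingKernel (ν : Measure α) [SFinite ν] (k : α → α → ℝ≥0∞) : Kernel (α × α) (α × α) :=
  (Kernel.withDensity (Kernel.const (α × α) ν) fun p z => overlap k p.1 p.2 z).map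
      (fun z => (z, z)) +
    (Kernel.withDensity (Kernel.const (α × α) ν)
        fun p z => (excessMass ν k p.1 p.2)⁻¹ * excess k p.1 p.2 z) ×ₖ
      (Kernel.withDensity (Kernel.const (α × α) ν) fun p z => excess k p.2 p.1 z)

theorem measurable_excessMass (ν : Measure α) [SFinite ν] {k : α → α → ℝ≥0∞}
    (hk : Measurable (Function.uncurry k)) :
    Measurable fun p : α × α => excessMass ν k p.1 p.2 :=
  (measurable_excess hk).lintegral_prod_right'

/-- Integration of a function against the joint move. -/
theorem lintegral_couplingKernel (ν : Measure α) [SFinite ν] {k : α → α → ℝ≥0∞}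
    (hk : Measurable (Function.uncurry k)) (h1 : ∀ x, ∫⁻ z, k x z ∂ν = 1) (x y : α)
    {f : α × α → ℝ≥0∞} (hf : Measurable f) :
    ∫⁻ w, f w ∂(couplingKernel ν k (x, y)) =
      ∫⁻ z, overlap k x y z * f (z, z) ∂ν +
        (excessMass ν k x y)⁻¹ *
          ∫⁻ z, excess k x y z * ∫⁻ z', excess k y x z' * f (z, z') ∂ν ∂ν := by
  have hdiag : Measurable fun z : α => (z, z) := measurable_id.prodMk measurable_id
  have ho := measurable_overlap hk
  have he := measurable_excess hk
  have he' := measurable_excess_swap hk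
  have hem : Measurable (Function.uncurry fun (p : α × α) z =>
      (excessMass ν k p.1 p.2)⁻¹ * excess k p.1 p.2 z) :=
    ((measurable_excessMass ν hk).comp measurable_fst).inv.mul he
  have hme : Measurable (excess k x y) := he.comp (measurable_prodMk_left (x := (x, y)))
  have hme' : Measurable (excess k y x) := he'.comp (measurable_prodMk_left (x := (x, y)))
  have hmo : Measurable (overlap k x y) := ho.comp (measurable_prodMk_left (x := (x, y)))
  rw [couplingKernel, add_apply, lintegral_add_measure, Kernel.map_apply _ hdiag,
    lintegral_map hf hdiag, Kernel.withDensity_apply _ ho, Kernel.const_apply,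
    show (fun z => overlap k (x, y).1 (x, y).2 z) = overlap k x y from rfl,
    lintegral_withDensity_eq_lintegral_mul (g := fun z => f (z, z)) _ hmo (hf.comp hdiag)]
  congr 1
  have hF1 : IsFiniteKernel (Kernel.withDensity (Kernel.const (α × α) ν)
      fun p z => (excessMass ν k p.1 p.2)⁻¹ * excess k p.1 p.2 z) := by
    refine ⟨1, ENNReal.one_lt_top, fun p => ?_⟩
    rw [Kernel.withDensity_apply _ hem, Kernel.const_apply, withDensity_apply _ MeasurableSet.univ,
      Measure.restrict_univ, lintegral_const_mul (f := fun z => excess k p.1 p.2 z) _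
        (he.comp (measurable_prodMk_left (x := p)))]
    exact ENNReal.inv_mul_le_one _
  have hF2 : IsFiniteKernel (Kernel.withDensity (Kernel.const (α × α) ν)
      fun p z => excess k p.2 p.1 z) := by
    refine ⟨1, ENNReal.one_lt_top, fun p => ?_⟩
    rw [Kernel.withDensity_apply _ he', Kernel.const_apply, withDensity_apply _ MeasurableSet.univ,
      Measure.restrict_univ]
    exact excessMass_le_one ν hk h1 p.2 p.1
  rw [Kernel.lintegral_prod _ _ _ hf, Kernel.withDensity_apply _ hem, Kernel.withDensity_apply _ he',
    Kernel.const_apply]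
  have hin : Measurable fun z => ∫⁻ z', f (z, z') ∂(ν.withDensity (excess k y x)) :=
    hf.lintegral_prod_right'
  have e : (fun z => (excessMass ν k x y)⁻¹ * excess k x y z) =
    (excessMass ν k x y)⁻¹ • excess k x y := rfl
  change ∫⁻ z, ∫⁻ z', f (z, z') ∂(ν.withDensity (excess k y x))
    ∂(ν.withDensity (fun z => (excessMass ν k x y)⁻¹ * excess k x y z)) = _
  rw [e, withDensity_smul _ hme, lintegral_smul_measure, smul_eq_mul,
    lintegral_withDensity_eq_lintegral_mul _ hme hin]
  congr 1
  refine lintegral_congr fun z => ?_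
  simp only [Pi.mul_apply]
  rw [lintegral_withDensity_eq_lintegral_mul (g := fun z' => f (z, z')) _ hme'
    (hf.comp measurable_prodMk_left)]
  rfl

theorem couplingKernel_map_fst (ν : Measure α) [SFinite ν] {k : α → α → ℝ≥0∞}
    (hk : Measurable (Function.uncurry k)) (h1 : ∀ x, ∫⁻ z, k x z ∂ν = 1) (p : α × α) :
    (couplingKernel ν k p).map Prod.fst = ν.withDensity (k p.1) := by
  obtain ⟨x, y⟩ := p
  have hme : Measurable (excess k x y) :=
    (measurable_excess hk).comp (measurable_prodMk_left (x := (x, y)))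
  have hmo : Measurable (overlap k x y) :=
    (measurable_overlap hk).comp (measurable_prodMk_left (x := (x, y)))
  refine Measure.ext_of_lintegral _ fun f hf => ?_
  rw [lintegral_map hf measurable_fst,
    lintegral_couplingKernel (f := fun w => f w.1) ν hk h1 x y (hf.comp measurable_fst),
    lintegral_withDensity_eq_lintegral_mul _ hk.of_uncurry_left hf]
  have hfin : excessMass ν k x y ≠ ∞ :=
    ((excessMass_le_one ν hk h1 x y).trans_lt ENNReal.one_lt_top).ne
  have hin : ∀ z, ∫⁻ z', excess k y x z' * f z ∂ν = excessMass ν k x y * f z := fun z => by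
    rw [excessMass_comm ν hk h1 x y, excessMass, lintegral_mul_const]
    exact (measurable_excess hk).comp (measurable_prodMk_left (x := (y, x)))
  have h2 : ∫⁻ z, overlap k x y z * f z ∂ν + ∫⁻ z, excess k x y z * f z ∂ν =
      ∫⁻ z, (k x * f) z ∂ν := by
    rw [← lintegral_add_left (f := fun z => overlap k x y z * f z) (hmo.mul hf)]
    refine lintegral_congr fun z => ?_
    rw [← add_mul, overlap_add_excess, Pi.mul_apply]
  rw [← h2]
  simp only [hin]
  congr 1
  by_cases h0 : excessMass ν k x y = 0
  · have hz : ∀ᵐ z ∂ν, excess k x y z = 0 := (lintegral_eq_zero_iff hme).1 h0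
    have e0 : ∀ g : α → ℝ≥0∞, ∫⁻ z, excess k x y z * g z ∂ν = 0 := fun g => by
      rw [lintegral_congr_ae (g := fun _ => 0)]
      · simp
      · filter_upwards [hz] with z hz
        simp [hz]
    rw [e0, e0, mul_zero]
  · have : ∀ z, excess k x y z * (excessMass ν k x y * f z) =
        excessMass ν k x y * (excess k x y z * f z) := fun z => by ring
    simp only [this]
    rw [lintegral_const_mul (f := fun z => excess k x y z * f z) _ (hme.mul hf), ← mul_assoc,
      ENNReal.inv_mul_cancel h0 hfin, one_mul]

theorem couplingKernel_map_snd (ν : Measure α) [SFinite ν] {k : α → α → ℝ≥0∞}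
    (hk : Measurable (Function.uncurry k)) (h1 : ∀ x, ∫⁻ z, k x z ∂ν = 1) (p : α × α) :
    (couplingKernel ν k p).map Prod.snd = ν.withDensity (k p.2) := by
  obtain ⟨x, y⟩ := p
  have hme : Measurable (excess k x y) :=
    (measurable_excess hk).comp (measurable_prodMk_left (x := (x, y)))
  have hme' : Measurable (excess k y x) :=
    (measurable_excess hk).comp (measurable_prodMk_left (x := (y, x)))
  have hmo : Measurable (overlap k x y) :=
    (measurable_overlap hk).comp (measurable_prodMk_left (x := (x, y)))
  refine Measure.ext_of_lintegral _ fun f hf => ?_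
  rw [lintegral_map hf measurable_snd,
    lintegral_couplingKernel (f := fun w => f w.2) ν hk h1 x y (hf.comp measurable_snd),
    lintegral_withDensity_eq_lintegral_mul _ hk.of_uncurry_left hf]
  have hfin : excessMass ν k x y ≠ ∞ :=
    ((excessMass_le_one ν hk h1 x y).trans_lt ENNReal.one_lt_top).ne
  have h2 : ∫⁻ z, overlap k x y z * f z ∂ν + ∫⁻ z, excess k y x z * f z ∂ν =
      ∫⁻ z, (k y * f) z ∂ν := by
    rw [← lintegral_add_left (f := fun z => overlap k x y z * f z) (hmo.mul hf)]
    refine lintegral_congr fun z => ?_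
    rw [← add_mul, overlap_comm, overlap_add_excess, Pi.mul_apply]
  rw [← h2]
  simp only []
  rw [lintegral_mul_const _ hme]
  congr 1
  change (excessMass ν k x y)⁻¹ * (excessMass ν k x y * _) = _
  by_cases h0 : excessMass ν k x y = 0
  · have hz : ∀ᵐ z ∂ν, excess k y x z = 0 :=
      (lintegral_eq_zero_iff hme').1 ((excessMass_comm ν hk h1 y x).trans h0)
    have e0 : ∫⁻ z, excess k y x z * f z ∂ν = 0 := by
      rw [lintegral_congr_ae (g := fun _ => 0)]
      · simp
      · filter_upwards [hz] with z hz
        simp [hz]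
    rw [e0, mul_zero, mul_zero]
  · rw [← mul_assoc, ENNReal.inv_mul_cancel h0 hfin, one_mul]

/-- Cost of a pair of points: zero on the diagonal, and the sum of the weights off it. -/
def pairCost [DecidableEq α] (w : α → ℝ≥0∞) (p : α × α) : ℝ≥0∞ :=
  if p.1 = p.2 then 0 else w p.1 + w p.2

theorem measurable_pairCost [DecidableEq α] [MeasurableEq α] {w : α → ℝ≥0∞} (hw : Measurable w) :
    Measurable (pairCost w) :=
  Measurable.ite (measurableSet_eq_fun measurable_fst measurable_snd) measurable_const
    ((hw.comp measurable_fst).add (hw.comp measurable_snd))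

/-- The expected cost after one joint move is at most the weighted mass of the two excesses. -/
theorem lintegral_pairCost_couplingKernel_le [DecidableEq α] [MeasurableEq α] (ν : Measure α)
    [SFinite ν] {k : α → α → ℝ≥0∞} (hk : Measurable (Function.uncurry k))
    (h1 : ∀ x, ∫⁻ z, k x z ∂ν = 1) {w : α → ℝ≥0∞} (hw : Measurable w) (x y : α) :
    ∫⁻ p, pairCost w p ∂(couplingKernel ν k (x, y)) ≤
      ∫⁻ z, excess k x y z * w z ∂ν + ∫⁻ z, excess k y x z * w z ∂ν := by
  have hme : Measurable (excess k x y) :=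
    (measurable_excess hk).comp (measurable_prodMk_left (x := (x, y)))
  have hme' : Measurable (excess k y x) :=
    (measurable_excess hk).comp (measurable_prodMk_left (x := (y, x)))
  rw [lintegral_couplingKernel ν hk h1 x y (measurable_pairCost hw)]
  have hdiag : ∀ z, overlap k x y z * pairCost w (z, z) = 0 := fun z => by simp [pairCost]
  simp only [hdiag, lintegral_zero, zero_add]
  have hb : ∀ z, ∫⁻ z', excess k y x z' * pairCost w (z, z') ∂ν ≤
      excessMass ν k x y * w z + ∫⁻ z', excess k y x z' * w z' ∂ν := fun z => by
    rw [excessMass_comm ν hk h1 x y, excessMass, ← lintegral_mul_const _ hme',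
      ← lintegral_add_left (hme'.mul_const _)]
    refine lintegral_mono fun z' => ?_
    rw [← mul_add]
    gcongr
    unfold pairCost
    split_ifs
    · exact zero_le
    · exact le_rfl
  set m := excessMass ν k x y with hm
  set J := ∫⁻ z', excess k y x z' * w z' ∂ν
  calc m⁻¹ * ∫⁻ z, excess k x y z * ∫⁻ z', excess k y x z' * pairCost w (z, z') ∂ν ∂ν
      ≤ m⁻¹ * ∫⁻ z, (m * (excess k x y z * w z) + excess k x y z * J) ∂ν := by
        gcongr with z
        calc _ ≤ excess k x y z * (m * w z + J) := by gcongr; exact hb z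
          _ = _ := by ring
    _ = m⁻¹ * (m * ∫⁻ z, excess k x y z * w z ∂ν + m * J) := by
        rw [lintegral_add_left (f := fun z => m * (excess k x y z * w z))
            ((hme.mul hw).const_mul _),
          lintegral_const_mul (f := fun z => excess k x y z * w z) _ (hme.mul hw),
          lintegral_mul_const _ hme]
        rfl
    _ = m⁻¹ * m * (∫⁻ z, excess k x y z * w z ∂ν + J) := by ring
    _ ≤ 1 * (∫⁻ z, excess k x y z * w z ∂ν + J) := by
        gcongr
        exact ENNReal.inv_mul_le_one m
    _ = _ := one_mul _

/-- Contraction of the weighted coupling cost along the chain. -/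
theorem exists_coupling_pow_pairCost_le [DecidableEq α] [MeasurableEq α] (ν : Measure α)
    [SFinite ν] {k : α → α → ℝ≥0∞} (hk : Measurable (Function.uncurry k))
    (K : Kernel α α) [IsMarkovKernel K] (hK : ∀ x, K x = ν.withDensity (k x))
    {w : α → ℝ≥0∞} (hw : Measurable w) {ρ : ℝ≥0∞}
    (hρ : ∀ x y, x ≠ y → ∫⁻ z, excess k x y z * w z ∂ν + ∫⁻ z, excess k y x z * w z ∂ν ≤
      ρ * (w x + w y))
    {π : Measure α} (hπ : K.Invariant π) {μ : Measure α} {ξ : Measure (α × α)}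
    (hξ : IsCouplingOf ξ μ π) (j : ℕ) :
    ∃ ξ' : Measure (α × α), IsCouplingOf ξ' (μ.bind ⇑(K ^ j)) π ∧
      ∫⁻ p, pairCost w p ∂ξ' ≤ ρ ^ j * ∫⁻ p, pairCost w p ∂ξ := by
  have h1 : ∀ x, ∫⁻ z, k x z ∂ν = 1 := fun x => by
    have := measure_univ (μ := K x)
    rwa [hK, withDensity_apply _ MeasurableSet.univ, Measure.restrict_univ] at this
  induction j with
  | zero =>
    exact ⟨ξ, by simpa [pow_zero, show (1 : Kernel α α) = Kernel.id from rfl] using hξ, by simp⟩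
  | succ j ih =>
    obtain ⟨ξ', ⟨hp, hf, hs⟩, hc⟩ := ih
    have hmarg1 : ∀ p, (couplingKernel ν k p).map Prod.fst = K p.1 := fun p => by
      rw [couplingKernel_map_fst ν hk h1, hK]
    have hmarg2 : ∀ p, (couplingKernel ν k p).map Prod.snd = K p.2 := fun p => by
      rw [couplingKernel_map_snd ν hk h1, hK]
    have hmk : IsMarkovKernel (couplingKernel ν k) := ⟨fun p => ⟨by
      have := congrArg (fun m : Measure α => m Set.univ) (hmarg1 p)
      simpa [Measure.map_apply measurable_fst] using this⟩⟩
    refine ⟨ξ'.bind (couplingKernel ν k), ⟨inferInstance, ?_, ?_⟩, ?_⟩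
    · ext S hS
      rw [Measure.map_apply measurable_fst hS,
        Measure.bind_apply (measurable_fst hS) (Kernel.aemeasurable _)]
      have e : ∀ p, couplingKernel ν k p (Prod.fst ⁻¹' S) = K p.1 S := fun p => by
        rw [← hmarg1, Measure.map_apply measurable_fst hS]
      simp only [e]
      rw [← lintegral_map (f := fun x => K x S) (K.measurable_coe hS) measurable_fst, hf,
        ← Measure.bind_apply hS K.aemeasurable, pow_succ', Measure.comp_assoc]
      rfl
    · ext S hS
      rw [Measure.map_apply measurable_snd hS,
        Measure.bind_apply (measurable_snd hS) (Kernel.aemeasurable _)]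
      have e : ∀ p, couplingKernel ν k p (Prod.snd ⁻¹' S) = K p.2 S := fun p => by
        rw [← hmarg2, Measure.map_apply measurable_snd hS]
      simp only [e]
      rw [← lintegral_map (f := fun x => K x S) (K.measurable_coe hS) measurable_snd, hs,
        ← Measure.bind_apply hS K.aemeasurable, hπ.def]
    · rw [Measure.lintegral_bind (Kernel.aemeasurable _) (measurable_pairCost hw).aemeasurable]
      calc ∫⁻ p, ∫⁻ p', pairCost w p' ∂(couplingKernel ν k p) ∂ξ'
          ≤ ∫⁻ p, ρ * pairCost w p ∂ξ' := by
            refine lintegral_mono fun p => ?_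
            obtain ⟨x, y⟩ := p
            refine (lintegral_pairCost_couplingKernel_le ν hk h1 hw x y).trans ?_
            by_cases hxy : x = y
            · subst hxy
              simp [excess]
            · simpa [pairCost, hxy] using hρ x y hxy
        _ = ρ * ∫⁻ p, pairCost w p ∂ξ' := lintegral_const_mul _ (measurable_pairCost hw)
        _ ≤ ρ * (ρ ^ j * ∫⁻ p, pairCost w p ∂ξ) := by gcongr
        _ = _ := by rw [pow_succ', mul_assoc]

/-- Wasserstein convergence of a chain whose joint moves contract the weighted cost, when the
weight dominates the distance. -/
theorem wassersteinDist_pow_le [MeasurableEq α] [PseudoEMetricSpace α] (ν : Measure α)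
    [SFinite ν] {k : α → α → ℝ≥0∞} (hk : Measurable (Function.uncurry k))
    (K : Kernel α α) [IsMarkovKernel K] (hK : ∀ x, K x = ν.withDensity (k x))
    {w : α → ℝ≥0∞} (hw : Measurable w) {ρ c : ℝ≥0∞} (hc : c ≠ ∞)
    (hρ : ∀ x y, x ≠ y → ∫⁻ z, excess k x y z * w z ∂ν + ∫⁻ z, excess k y x z * w z ∂ν ≤
      ρ * (w x + w y))
    (hd : ∀ x y, edist x y ≤ c * (w x + w y))
    {π : Measure α} [IsProbabilityMeasure π] (hπ : K.Invariant π)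
    (μ : Measure α) [IsProbabilityMeasure μ] (j : ℕ) :
    wassersteinDist (μ.bind ⇑(K ^ j)) π ≤
      c * (ρ ^ j * (∫⁻ x, w x ∂μ + ∫⁻ x, w x ∂π)) := by
  classical
  have hξ : IsCouplingOf (μ.prod π) μ π :=
    ⟨inferInstance, by rw [← Measure.fst]; exact Measure.fst_prod,
      by rw [← Measure.snd]; exact Measure.snd_prod⟩
  obtain ⟨ξ', hξ', hcost⟩ := exists_coupling_pow_pairCost_le ν hk K hK hw hρ hπ hξ j
  refine (iInf₂_le ξ' hξ').trans ?_
  calc ∫⁻ p, edist p.1 p.2 ∂ξ' ≤ ∫⁻ p, c * pairCost w p ∂ξ' := by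
        refine lintegral_mono fun p => ?_
        by_cases hp : p.1 = p.2
        · simp [hp]
        · simpa [pairCost, hp] using hd p.1 p.2
    _ = c * ∫⁻ p, pairCost w p ∂ξ' := lintegral_const_mul' _ _ hc
    _ ≤ c * (ρ ^ j * ∫⁻ p, pairCost w p ∂(μ.prod π)) := by gcongr
    _ ≤ _ := by
        gcongr
        calc ∫⁻ p, pairCost w p ∂(μ.prod π) ≤ ∫⁻ p, (w p.1 + w p.2) ∂(μ.prod π) := by
              refine lintegral_mono fun p => ?_
              unfold pairCost
              split_ifs
              · exact zero_le
              · exact le_rfl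
          _ = _ := by
              rw [lintegral_add_left (f := fun p : α × α => w p.1) (hw.comp measurable_fst)]
              congr 1
              · rw [← lintegral_map hw measurable_fst, hξ.2.1]
              · rw [← lintegral_map hw measurable_snd, hξ.2.2]

/-- Distance of two laws through the independent coupling. -/
theorem wassersteinDist_le_of_weight [PseudoEMetricSpace α] {w : α → ℝ≥0∞} (hw : Measurable w)
    {c : ℝ≥0∞} (hc : c ≠ ∞) (hd : ∀ x y, edist x y ≤ c * (w x + w y))
    (μ π : Measure α) [IsProbabilityMeasure μ] [IsProbabilityMeasure π] :
    wassersteinDist μ π ≤ c * (∫⁻ x, w x ∂μ + ∫⁻ x, w x ∂π) := by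
  have hξ : IsCouplingOf (μ.prod π) μ π :=
    ⟨inferInstance, by rw [← Measure.fst]; exact Measure.fst_prod,
      by rw [← Measure.snd]; exact Measure.snd_prod⟩
  refine (iInf₂_le (μ.prod π) hξ).trans ?_
  calc ∫⁻ p, edist p.1 p.2 ∂(μ.prod π) ≤ ∫⁻ p, c * (w p.1 + w p.2) ∂(μ.prod π) :=
        lintegral_mono fun p => hd p.1 p.2
    _ = _ := by
        rw [lintegral_const_mul' _ _ hc,
          lintegral_add_left (f := fun p : α × α => w p.1) (hw.comp measurable_fst),
          ← lintegral_map hw measurable_fst, ← lintegral_map hw measurable_snd, hξ.2.1, hξ.2.2]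

end Chain

/-! ### Drift conditions and contraction of the two-step chain -/

noncomputable section Drift

variable {α : Type*} [MeasurableSpace α]

/-- Two-step transition density. -/
def twoStep (ν : Measure α) (k : α → α → ℝ≥0∞) (x z : α) : ℝ≥0∞ := ∫⁻ y, k x y * k y z ∂ν

theorem measurable_twoStep (ν : Measure α) [SFinite ν] {k : α → α → ℝ≥0∞}
    (hk : Measurable (Function.uncurry k)) : Measurable (Function.uncurry (twoStep ν k)) := by
  have h : Measurable fun v : (α × α) × α => k v.1.1 v.2 * k v.2 v.1.2 :=
    (hk.comp (measurable_fst.fst.prodMk measurable_snd)).mul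
      (hk.comp (measurable_snd.prodMk measurable_fst.snd))
  exact h.lintegral_prod_right'

theorem pow_two_eq_withDensity (ν : Measure α) [SFinite ν] {k : α → α → ℝ≥0∞}
    (hk : Measurable (Function.uncurry k)) {K : Kernel α α} (hK : ∀ x, K x = ν.withDensity (k x))
    (x : α) : (K ^ 2) x = ν.withDensity (twoStep ν k x) := by
  have hx : ∀ x, Measurable (k x) := fun x => hk.of_uncurry_left
  ext S hS
  have hKS : ∀ y, K y S = ∫⁻ z in S, k y z ∂ν := fun y => by rw [hK, withDensity_apply _ hS]
  have hm : Measurable fun y => K y S := K.measurable_coe hS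
  rw [pow_two]
  change (K ∘ₖ K) x S = _
  rw [Kernel.comp_apply' _ _ _ hS, withDensity_apply _ hS, hK x,
    lintegral_withDensity_eq_lintegral_mul _ (hx x) hm]
  unfold twoStep
  rw [lintegral_lintegral_swap]
  · refine lintegral_congr fun y => ?_
    rw [Pi.mul_apply, hKS, lintegral_const_mul _ (hx y)]
  · exact ((hk.comp (measurable_const.prodMk measurable_snd)).mul
      (hk.comp (measurable_snd.prodMk measurable_fst))).aemeasurable

theorem lintegral_pow_succ (K : Kernel α α) (n : ℕ) (x : α) {f : α → ℝ≥0∞} (hf : Measurable f) :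
    ∫⁻ y, f y ∂((K ^ (n + 1)) x) = ∫⁻ y, ∫⁻ z, f z ∂(K y) ∂((K ^ n) x) := by
  rw [pow_succ']
  exact Kernel.lintegral_comp K (K ^ n) x hf

theorem isMarkovKernel_pow (K : Kernel α α) [IsMarkovKernel K] (n : ℕ) :
    IsMarkovKernel (K ^ n) := by
  induction n with
  | zero => exact (inferInstance : IsMarkovKernel (Kernel.id : Kernel α α))
  | succ n ih =>
    rw [pow_succ]
    exact (inferInstance : IsMarkovKernel ((K ^ n) ∘ₖ K))

theorem invariant_pow (K : Kernel α α) {π : Measure α} (hπ : K.Invariant π) (n : ℕ) :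
    (K ^ n).Invariant π := by
  induction n with
  | zero => exact Measure.id_comp
  | succ n ih =>
    rw [pow_succ]
    exact ih.comp hπ

/-- Integrating a function which is affinely dominated after one step. -/
theorem lintegral_le_affine {μ : Measure α} [IsProbabilityMeasure μ] {f g : α → ℝ≥0∞} {a b : ℝ≥0∞}
    (hg : Measurable g) (h : ∀ x, f x ≤ a * g x + b) :
    ∫⁻ x, f x ∂μ ≤ a * ∫⁻ x, g x ∂μ + b := by
  calc ∫⁻ x, f x ∂μ ≤ ∫⁻ x, (a * g x + b) ∂μ := lintegral_mono h
    _ = _ := by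
      rw [lintegral_add_right _ measurable_const, lintegral_const_mul _ hg]
      simp

/-- An invariant law integrates every finite Lyapunov function: comparing the truncations of `W`
and of its one-step mean shows `∫ W ≤ 2 b` without knowing beforehand that `W` is integrable. -/
theorem lintegral_invariant_le {K : Kernel α α} [IsMarkovKernel K] {π : Measure α}
    [IsProbabilityMeasure π] (hπ : K.Invariant π) {W : α → ℝ≥0∞} (hW : Measurable W)
    (hfin : ∀ x, W x ≠ ∞) {b : ℝ≥0∞} (h : ∀ x, ∫⁻ y, W y ∂(K x) ≤ 2⁻¹ * W x + b) :
    ∫⁻ x, W x ∂π ≤ 2 * b := by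
  have key : ∀ M : ℝ≥0, ∫⁻ x in {x | W x ≤ M}, W x ∂π ≤ 2 * b := fun M => by
    set S := {x | W x ≤ M} with hS
    have hSm : MeasurableSet S := measurableSet_le hW measurable_const
    have hI : ∫⁻ x in S, W x ∂π ≠ ∞ := by
      have hle : ∫⁻ x in S, W x ∂π ≤ M * π S := by
        rw [← setLIntegral_const]
        exact setLIntegral_mono measurable_const fun x hx => hx
      refine (hle.trans_lt ?_).ne
      exact ENNReal.mul_lt_top ENNReal.coe_lt_top (measure_lt_top _ _)
    have h1 : ∫⁻ x, min (W x) M ∂π = ∫⁻ x in S, W x ∂π + M * π Sᶜ := by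
      rw [← lintegral_add_compl _ hSm]
      congr 1
      · exact setLIntegral_congr_fun hSm fun x hx => min_eq_left hx
      · rw [← setLIntegral_const]
        exact setLIntegral_congr_fun hSm.compl fun x hx => min_eq_right (le_of_not_ge hx)
    have h2 : ∫⁻ x, min (W x) M ∂π ≤ 2⁻¹ * ∫⁻ x in S, W x ∂π + b + M * π Sᶜ := by
      calc ∫⁻ x, min (W x) M ∂π = ∫⁻ x, ∫⁻ y, min (W y) M ∂(K x) ∂π := by
            conv_lhs => rw [← hπ.def]
            rw [Measure.lintegral_bind K.aemeasurable (hW.min measurable_const).aemeasurable]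
        _ ≤ ∫⁻ x, min (2⁻¹ * W x + b) M ∂π := by
            refine lintegral_mono fun x => le_min ?_ ?_
            · exact (lintegral_mono fun y => min_le_left _ _).trans (h x)
            · calc ∫⁻ y, min (W y) M ∂(K x) ≤ ∫⁻ _, (M : ℝ≥0∞) ∂(K x) :=
                    lintegral_mono fun y => min_le_right _ _
                _ = M := by simp
        _ = ∫⁻ x in S, min (2⁻¹ * W x + b) M ∂π + ∫⁻ x in Sᶜ, min (2⁻¹ * W x + b) M ∂π :=
            (lintegral_add_compl _ hSm).symm
        _ ≤ ∫⁻ x in S, (2⁻¹ * W x + b) ∂π + ∫⁻ _ in Sᶜ, (M : ℝ≥0∞) ∂π :=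
            add_le_add (lintegral_mono fun x => min_le_left _ _)
              (lintegral_mono fun x => min_le_right _ _)
        _ ≤ _ := by
            rw [lintegral_add_right _ measurable_const, lintegral_const_mul _ hW, setLIntegral_const,
              setLIntegral_const]
            gcongr
            exact mul_le_of_le_one_right' prob_le_one
    rw [h1] at h2
    have hM : (M : ℝ≥0∞) * π Sᶜ ≠ ∞ := ENNReal.mul_ne_top ENNReal.coe_ne_top (measure_ne_top _ _)
    have h3 : ∫⁻ x in S, W x ∂π ≤ 2⁻¹ * ∫⁻ x in S, W x ∂π + b :=
      (ENNReal.add_le_add_iff_right hM).1 h2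
    set I := ∫⁻ x in S, W x ∂π
    have h4 : 2⁻¹ * I + 2⁻¹ * I ≤ 2⁻¹ * I + b := by
      rwa [← add_mul, ENNReal.inv_two_add_inv_two, one_mul]
    have h5 : 2⁻¹ * I ≤ b :=
      (ENNReal.add_le_add_iff_left (ENNReal.mul_ne_top (by simp) hI)).1 h4
    calc I = 2 * (2⁻¹ * I) := by
          rw [← mul_assoc, ENNReal.mul_inv_cancel (by simp) (by simp), one_mul]
      _ ≤ 2 * b := by gcongr
  have hmono : Monotone fun n : ℕ => {x | W x ≤ ((n : ℝ≥0) : ℝ≥0∞)} := fun m n hmn x hx => by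
    have h1 : W x ≤ ((m : ℝ≥0) : ℝ≥0∞) := hx
    have h2 : ((m : ℝ≥0) : ℝ≥0∞) ≤ ((n : ℝ≥0) : ℝ≥0∞) := by
      exact_mod_cast hmn
    exact h1.trans h2
  have hU : ⋃ n : ℕ, {x | W x ≤ ((n : ℝ≥0) : ℝ≥0∞)} = Set.univ := by
    refine Set.eq_univ_of_forall fun x => Set.mem_iUnion.2 ?_
    obtain ⟨n, hn⟩ := ENNReal.exists_nat_gt (hfin x)
    exact ⟨n, by simpa using hn.le⟩
  rw [← setLIntegral_univ, ← hU, setLIntegral_iUnion_of_directed _ hmono.directed_le]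
  exact iSup_le fun n => key n

/-- Kernels close to a common law after one step overlap after two steps. -/
theorem excessMass_twoStep_le (ν : Measure α) [SFinite ν] {k : α → α → ℝ≥0∞}
    (hk : Measurable (Function.uncurry k)) {K : Kernel α α} [IsMarkovKernel K]
    (hK : ∀ x, K x = ν.withDensity (k x)) {G : Set α → ℝ≥0∞} {φ : α → ℝ≥0∞} (hφ : Measurable φ)
    (h1 : ∀ x S, MeasurableSet S → K x S ≤ G S + φ x)
    (h2 : ∀ x S, MeasurableSet S → G S ≤ K x S + φ x) (x y : α) :
    excessMass ν (twoStep ν k) x y ≤ ∫⁻ z, φ z ∂(K x) + ∫⁻ z, φ z ∂(K y) := by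
  have hone : ∀ x, ∫⁻ z, twoStep ν k x z ∂ν = 1 := fun x => by
    have := isMarkovKernel_pow K 2
    have := measure_univ (μ := (K ^ 2) x)
    rwa [pow_two_eq_withDensity ν hk hK, withDensity_apply _ MeasurableSet.univ,
      Measure.restrict_univ] at this
  refine excessMass_le_of_forall_set ν (measurable_twoStep ν hk) hone x y fun S hS => ?_
  rw [← pow_two_eq_withDensity ν hk hK, ← pow_two_eq_withDensity ν hk hK, pow_two]
  change (K ∘ₖ K) x S ≤ (K ∘ₖ K) y S + _
  rw [Kernel.comp_apply' _ _ _ hS, Kernel.comp_apply' _ _ _ hS]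
  calc ∫⁻ z, K z S ∂(K x) ≤ ∫⁻ z, (G S + φ z) ∂(K x) := lintegral_mono fun z => h1 z S hS
    _ = G S + ∫⁻ z, φ z ∂(K x) := by rw [lintegral_add_left measurable_const]; simp
    _ = ∫⁻ _, G S ∂(K y) + ∫⁻ z, φ z ∂(K x) := by simp
    _ ≤ ∫⁻ z, (K z S + φ z) ∂(K y) + ∫⁻ z, φ z ∂(K x) := by
        gcongr with z
        exact h2 z S hS
    _ = _ := by
        rw [lintegral_add_right _ hφ]
        ring

theorem sqrt_le_add_div {t T : ℝ} (ht : 0 ≤ t) (hT : 0 < T) : √t ≤ T + t / T := by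
  rcases le_total (√t) T with h | h
  · have : 0 ≤ t / T := by positivity
    linarith
  · have : √t ≤ t / T := by
      rw [le_div_iff₀ hT]
      nlinarith [Real.sq_sqrt ht, Real.sqrt_nonneg t]
    linarith

/-- Jensen's inequality for the square root, with a bound on the mean. -/
theorem lintegral_sqrt_le {μ : Measure α} [IsProbabilityMeasure μ] {W : α → ℝ} (hW : Measurable W)
    (h0 : ∀ x, 0 ≤ W x) {s : ℝ} (hs : 0 < s)
    (h : ∫⁻ x, ENNReal.ofReal (W x) ∂μ ≤ ENNReal.ofReal (s ^ 2)) :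
    ∫⁻ x, ENNReal.ofReal (√(W x)) ∂μ ≤ ENNReal.ofReal s := by
  have hp : ∀ x, ENNReal.ofReal (√(W x)) ≤
      ENNReal.ofReal ((2 * s)⁻¹) * ENNReal.ofReal (W x) + ENNReal.ofReal (s / 2) := fun x => by
    rw [← ENNReal.ofReal_mul (by positivity), ← ENNReal.ofReal_add (mul_nonneg (by positivity) (h0 x))
      (by positivity)]
    refine ENNReal.ofReal_le_ofReal ?_
    have e : (2 * s)⁻¹ * W x + s / 2 - √(W x) = (√(W x) - s) ^ 2 / (2 * s) := by
      have := Real.sq_sqrt (h0 x)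
      field_simp
      nlinarith
    have : 0 ≤ (√(W x) - s) ^ 2 / (2 * s) := by positivity
    linarith
  refine (lintegral_le_affine hW.ennreal_ofReal hp).trans ?_
  calc _ ≤ ENNReal.ofReal ((2 * s)⁻¹) * ENNReal.ofReal (s ^ 2) + ENNReal.ofReal (s / 2) := by gcongr
    _ = ENNReal.ofReal s := by
      rw [← ENNReal.ofReal_mul (by positivity), ← ENNReal.ofReal_add (by positivity) (by positivity)]
      congr 1
      field_simp
      ring

theorem lintegral_excess_mul_le (ν : Measure α) {k : α → α → ℝ≥0∞} (x y : α) (w : α → ℝ≥0∞) :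
    ∫⁻ z, excess k x y z * w z ∂ν ≤ ∫⁻ z, k x z * w z ∂ν := by
  refine lintegral_mono fun z => ?_
  gcongr
  exact tsub_le_self

/-- Contraction of the two-step chain in the weighted coupling cost with weight `√W`, from a drift
condition on `W` and from the overlap of the two-step laws on the sublevel set `W ≤ R ^ 2`. -/
theorem excess_twoStep_contraction (ν : Measure α) [SFinite ν] {k : α → α → ℝ≥0∞}
    (hk : Measurable (Function.uncurry k)) {K : Kernel α α} [IsMarkovKernel K]
    (hK : ∀ x, K x = ν.withDensity (k x)) {W : α → ℝ} (hW : Measurable W) (hW1 : ∀ x, 1 ≤ W x)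
    {γ R δ : ℝ} (hγ0 : 0 ≤ γ) (hγ1 : γ ≤ 1) (hR : 0 < R) (hδ : 0 ≤ δ)
    (hdrift : ∀ x, ∫⁻ y, ENNReal.ofReal (W y) ∂(K x) ≤ ENNReal.ofReal (5 + γ * W x))
    (hover : ∀ x y, W x ≤ R ^ 2 → W y ≤ R ^ 2 →
      excessMass ν (twoStep ν k) x y ≤ ENNReal.ofReal δ) (x y : α) :
    ∫⁻ z, excess (twoStep ν k) x y z * ENNReal.ofReal (√(W z)) ∂ν +
      ∫⁻ z, excess (twoStep ν k) y x z * ENNReal.ofReal (√(W z)) ∂ν ≤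
    ENNReal.ofReal (δ * R + 10 / R + γ ^ 2 * R + γ) *
      (ENNReal.ofReal (√(W x)) + ENNReal.ofReal (√(W y))) := by
  have hW0 : ∀ x, 0 ≤ W x := fun x => zero_le_one.trans (hW1 x)
  have hone : ∀ x, 1 ≤ √(W x) := fun x => Real.one_le_sqrt.2 (hW1 x)
  have hsq : ∀ x, √(W x) ^ 2 = W x := fun x => Real.sq_sqrt (hW0 x)
  have hmk : IsMarkovKernel (K ^ 2) := isMarkovKernel_pow K 2
  have h2 := fun x => pow_two_eq_withDensity ν hk hK x
  have hmt := measurable_twoStep ν hk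
  have hI : ∀ x (f : α → ℝ≥0∞), Measurable f →
      ∫⁻ z, twoStep ν k x z * f z ∂ν = ∫⁻ z, f z ∂((K ^ 2) x) := fun x f hf => by
    rw [h2, lintegral_withDensity_eq_lintegral_mul _ hmt.of_uncurry_left hf]
    rfl
  have hWm : Measurable fun z => ENNReal.ofReal (W z) := hW.ennreal_ofReal
  have hwm : Measurable fun z => ENNReal.ofReal (√(W z)) := hW.sqrt.ennreal_ofReal
  have hd2 : ∀ x, ∫⁻ z, ENNReal.ofReal (W z) ∂((K ^ 2) x) ≤
      ENNReal.ofReal (10 + γ ^ 2 * W x) := fun x => by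
    rw [show K ^ 2 = K ^ (1 + 1) from rfl, lintegral_pow_succ K 1 x hWm, pow_one]
    have hp : ∀ y, ∫⁻ z, ENNReal.ofReal (W z) ∂(K y) ≤
        ENNReal.ofReal γ * ENNReal.ofReal (W y) + ENNReal.ofReal 5 := fun y => by
      refine (hdrift y).trans ?_
      rw [← ENNReal.ofReal_mul hγ0, ← ENNReal.ofReal_add (mul_nonneg hγ0 (hW0 y)) (by norm_num),
        add_comm]
    refine (lintegral_le_affine hWm hp).trans ?_
    calc _ ≤ ENNReal.ofReal γ * ENNReal.ofReal (5 + γ * W x) + ENNReal.ofReal 5 := by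
          gcongr
          exact hdrift x
      _ ≤ _ := by
          have := mul_nonneg hγ0 (hW0 x)
          rw [← ENNReal.ofReal_mul hγ0, ← ENNReal.ofReal_add (by positivity) (by norm_num)]
          refine ENNReal.ofReal_le_ofReal ?_
          nlinarith
  by_cases hcase : W x ≤ R ^ 2 ∧ W y ≤ R ^ 2
  · have hb : ∀ x y, W x ≤ R ^ 2 → W y ≤ R ^ 2 →
        ∫⁻ z, excess (twoStep ν k) x y z * ENNReal.ofReal (√(W z)) ∂ν ≤
          ENNReal.ofReal (δ * R + 10 / R + γ ^ 2 * R) := fun x y hx hy => by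
      have hme : Measurable (excess (twoStep ν k) x y) :=
        (measurable_excess hmt).comp (measurable_prodMk_left (x := (x, y)))
      calc ∫⁻ z, excess (twoStep ν k) x y z * ENNReal.ofReal (√(W z)) ∂ν
          ≤ ∫⁻ z, (excess (twoStep ν k) x y z * ENNReal.ofReal R +
              twoStep ν k x z * (ENNReal.ofReal R⁻¹ * ENNReal.ofReal (W z))) ∂ν := by
            refine lintegral_mono fun z => ?_
            calc _ ≤ excess (twoStep ν k) x y z *
                  (ENNReal.ofReal R + ENNReal.ofReal R⁻¹ * ENNReal.ofReal (W z)) := by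
                  gcongr
                  rw [← ENNReal.ofReal_mul (by positivity),
                    ← ENNReal.ofReal_add hR.le (mul_nonneg (by positivity) (hW0 z))]
                  refine ENNReal.ofReal_le_ofReal ((sqrt_le_add_div (hW0 z) hR).trans_eq ?_)
                  rw [div_eq_inv_mul]
              _ ≤ _ := by
                  rw [mul_add]
                  gcongr
                  exact tsub_le_self
        _ = excessMass ν (twoStep ν k) x y * ENNReal.ofReal R +
            ENNReal.ofReal R⁻¹ * ∫⁻ z, ENNReal.ofReal (W z) ∂((K ^ 2) x) := by
            rw [lintegral_add_left (hme.mul_const _), lintegral_mul_const _ hme,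
              hI x _ (hWm.const_mul _), lintegral_const_mul _ hWm]
            rfl
        _ ≤ ENNReal.ofReal δ * ENNReal.ofReal R +
            ENNReal.ofReal R⁻¹ * ENNReal.ofReal (10 + γ ^ 2 * R ^ 2) := by
            gcongr
            · exact hover x y hx hy
            · refine (hd2 x).trans (ENNReal.ofReal_le_ofReal ?_)
              gcongr
        _ = _ := by
            rw [← ENNReal.ofReal_mul hδ, ← ENNReal.ofReal_mul (by positivity),
              ← ENNReal.ofReal_add (by positivity) (by positivity)]
            congr 1
            field_simp
            ring
    have hbx := hb x y hcase.1 hcase.2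
    have hby := hb y x hcase.2 hcase.1
    refine (add_le_add hbx hby).trans ?_
    rw [← ENNReal.ofReal_add (by positivity) (by positivity), ← ENNReal.ofReal_add (by positivity)
      (by positivity), ← ENNReal.ofReal_mul (by positivity)]
    refine ENNReal.ofReal_le_ofReal ?_
    have := hone x
    have := hone y
    have h0 : 0 ≤ δ * R + 10 / R + γ ^ 2 * R := by positivity
    nlinarith [mul_nonneg hγ0 (by linarith : (0 : ℝ) ≤ √(W x) + √(W y))]
  · have hb : ∀ x y, ∫⁻ z, excess (twoStep ν k) x y z * ENNReal.ofReal (√(W z)) ∂ν ≤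
        ENNReal.ofReal (4 + γ * √(W x)) := fun x y => by
      refine (lintegral_excess_mul_le ν x y _).trans ?_
      rw [hI x _ hwm]
      have h4 : 0 < 4 + γ * √(W x) := by positivity
      refine lintegral_sqrt_le hW hW0 h4 ((hd2 x).trans (ENNReal.ofReal_le_ofReal ?_))
      have := mul_nonneg hγ0 (Real.sqrt_nonneg (W x))
      nlinarith [hsq x]
    refine (add_le_add (hb x y) (hb y x)).trans ?_
    rw [← ENNReal.ofReal_add (by positivity) (by positivity), ← ENNReal.ofReal_add (by positivity)
      (by positivity), ← ENNReal.ofReal_mul (by positivity)]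
    refine ENNReal.ofReal_le_ofReal ?_
    have hRw : R ≤ √(W x) + √(W y) := by
      by_contra hlt
      push Not at hlt
      refine hcase ⟨?_, ?_⟩
      · rw [← hsq x]
        have := hone x
        have := hone y
        nlinarith
      · rw [← hsq y]
        have := hone x
        have := hone y
        nlinarith
    have h8 : 8 ≤ 10 / R * (√(W x) + √(W y)) := by
      rw [div_mul_eq_mul_div, le_div_iff₀ hR]
      nlinarith
    have h0 : 0 ≤ (δ * R + γ ^ 2 * R) * (√(W x) + √(W y)) := by positivity
    nlinarith

end Drift

/-! ### Gamma distributions: moments and total variation -/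

section Gamma

theorem gammaPDFReal_of_pos {a r x : ℝ} (hx : 0 < x) :
    gammaPDFReal a r x = r ^ a / Real.Gamma a * x ^ (a - 1) * Real.exp (-(r * x)) :=
  if_pos hx.le

theorem measurable_gammaPDF (a r : ℝ) : Measurable (gammaPDF a r) :=
  (measurable_gammaPDFReal a r).ennreal_ofReal

theorem gammaMeasure_eq_restrict (a r : ℝ) :
    gammaMeasure a r = (volume.restrict (Set.Ioi (0 : ℝ))).withDensity (gammaPDF a r) := by
  rw [gammaMeasure, ← restrict_withDensity measurableSet_Ioi]
  symm
  refine Measure.restrict_eq_self_of_ae_mem ?_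
  rw [ae_withDensity_iff (measurable_gammaPDF a r)]
  have h0 : ∀ᵐ x : ℝ, x ≠ 0 := by simp [ae_iff]
  filter_upwards [h0] with x hx h
  by_contra hneg
  rw [Set.mem_Ioi, not_lt] at hneg
  exact h (gammaPDF_of_neg (lt_of_le_of_ne hneg hx))

theorem lintegral_gammaMeasure (a r : ℝ) {f : ℝ → ℝ≥0∞} (hf : Measurable f) :
    ∫⁻ x, f x ∂(gammaMeasure a r) = ∫⁻ x in Set.Ioi (0 : ℝ), gammaPDF a r x * f x := by
  rw [gammaMeasure_eq_restrict, lintegral_withDensity_eq_lintegral_mul _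
    (measurable_gammaPDF a r) hf]
  rfl

theorem lintegral_gammaPDF_Ioi {a r : ℝ} (ha : 0 < a) (hr : 0 < r) :
    ∫⁻ x in Set.Ioi (0 : ℝ), gammaPDF a r x = 1 := by
  have h := lintegral_gammaMeasure a r (f := fun _ => 1) measurable_const
  have := isProbabilityMeasure_gammaMeasure ha hr
  simpa using h.symm

theorem lintegral_id_gammaMeasure {a r : ℝ} (ha : 0 < a) (hr : 0 < r) :
    ∫⁻ x, ENNReal.ofReal x ∂(gammaMeasure a r) = ENNReal.ofReal (a / r) := by
  rw [lintegral_gammaMeasure a r ENNReal.measurable_ofReal]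
  calc _ = ∫⁻ x in Set.Ioi (0 : ℝ), ENNReal.ofReal (a / r) * gammaPDF (a + 1) r x := by
        refine setLIntegral_congr_fun measurableSet_Ioi fun x hx => ?_
        rw [Set.mem_Ioi] at hx
        change ENNReal.ofReal _ * _ = _ * ENNReal.ofReal _
        rw [← ENNReal.ofReal_mul (gammaPDFReal_nonneg ha hr x), ← ENNReal.ofReal_mul (by positivity),
          gammaPDFReal_of_pos hx, gammaPDFReal_of_pos hx, Real.Gamma_add_one ha.ne',
          Real.rpow_add_one hr.ne', show a + 1 - 1 = a - 1 + 1 by ring, Real.rpow_add_one hx.ne']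
        congr 1
        have := (Real.Gamma_pos_of_pos ha).ne'
        field_simp
    _ = _ := by
        rw [lintegral_const_mul _ (measurable_gammaPDF _ r),
          lintegral_gammaPDF_Ioi (by linarith) hr, mul_one]

theorem lintegral_inv_gammaMeasure {a r : ℝ} (ha : 1 < a) (hr : 0 < r) :
    ∫⁻ x, ENNReal.ofReal x⁻¹ ∂(gammaMeasure a r) = ENNReal.ofReal (r / (a - 1)) := by
  have ha1 : 0 < a - 1 := by linarith
  rw [lintegral_gammaMeasure a r measurable_inv.ennreal_ofReal]
  calc _ = ∫⁻ x in Set.Ioi (0 : ℝ), ENNReal.ofReal (r / (a - 1)) * gammaPDF (a - 1) r x := by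
        refine setLIntegral_congr_fun measurableSet_Ioi fun x hx => ?_
        rw [Set.mem_Ioi] at hx
        change ENNReal.ofReal _ * _ = _ * ENNReal.ofReal _
        rw [← ENNReal.ofReal_mul (gammaPDFReal_nonneg (by linarith) hr x),
          ← ENNReal.ofReal_mul (by positivity),
          gammaPDFReal_of_pos hx, gammaPDFReal_of_pos hx]
        have e1 : Real.Gamma a = (a - 1) * Real.Gamma (a - 1) := by
          rw [← Real.Gamma_add_one ha1.ne', sub_add_cancel]
        have e2 : r ^ a = r ^ (a - 1) * r := by rw [← Real.rpow_add_one hr.ne', sub_add_cancel]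
        have e3 : x ^ (a - 1) = x ^ (a - 1 - 1) * x := by
          rw [← Real.rpow_add_one hx.ne', sub_add_cancel]
        rw [e1, e2, e3]
        congr 1
        have := (Real.Gamma_pos_of_pos ha1).ne'
        field_simp
    _ = _ := by
        rw [lintegral_const_mul _ (measurable_gammaPDF _ r),
          lintegral_gammaPDF_Ioi ha1 hr, mul_one]

/-- The geometric mean of two Gamma densities with a common shape is a multiple of the Gamma
density whose rate is the arithmetic mean; the factor is the Hellinger affinity of the two. -/
theorem gammaPDFReal_mul_gammaPDFReal {a b c x : ℝ} (ha : 0 < a) (hb : 0 < b) (hc : 0 < c)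
    (hx : 0 < x) :
    gammaPDFReal a b x * gammaPDFReal a c x =
      ((√(b * c) / ((b + c) / 2)) ^ a * gammaPDFReal a ((b + c) / 2) x) ^ 2 := by
  have hm : 0 < (b + c) / 2 := by linarith
  have hΓ := (Real.Gamma_pos_of_pos ha).ne'
  have hma : ((b + c) / 2) ^ a ≠ 0 := (Real.rpow_pos_of_pos hm a).ne'
  have h1 : (√(b * c) ^ a) ^ 2 = b ^ a * c ^ a := by
    rw [← Real.mul_rpow hb.le hc.le, ← Real.rpow_natCast, ← Real.rpow_mul (Real.sqrt_nonneg _),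
      mul_comm a, Real.rpow_mul (Real.sqrt_nonneg _)]
    simp only [Nat.cast_ofNat, Real.rpow_ofNat]
    rw [Real.sq_sqrt (by positivity)]
  have h2 : Real.exp (-((b + c) / 2 * x)) ^ 2 = Real.exp (-(b * x)) * Real.exp (-(c * x)) := by
    rw [← Real.exp_nat_mul, ← Real.exp_add]
    congr 1
    push_cast
    ring
  rw [gammaPDFReal_of_pos hx, gammaPDFReal_of_pos hx, gammaPDFReal_of_pos hx,
    Real.div_rpow (Real.sqrt_nonneg _) hm.le]
  have e : √(b * c) ^ a / ((b + c) / 2) ^ a *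
      (((b + c) / 2) ^ a / Real.Gamma a * x ^ (a - 1) * Real.exp (-((b + c) / 2 * x))) =
      √(b * c) ^ a * Real.exp (-((b + c) / 2 * x)) * (x ^ (a - 1) / Real.Gamma a) := by
    field_simp
  rw [e, mul_pow, mul_pow, h1, h2]
  ring

/-- The squared affinity of two Gamma laws with common shape `a` and rates `b`, `c` is close to one,
by Bernoulli's inequality. -/
theorem one_sub_affinity_le {a b c : ℝ} (ha : 1 ≤ a) (hb : 0 < b) (hc : 0 < c) :
    1 - (√(b * c) / ((b + c) / 2)) ^ a ≤ (√a * |b - c| / (b + c)) ^ 2 := by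
  have hbc : 0 < b + c := by linarith
  have hB := one_add_mul_self_le_rpow_one_add (s := √(b * c) / ((b + c) / 2) - 1)
    (by have : 0 ≤ √(b * c) / ((b + c) / 2) := by positivity
        linarith) ha
  rw [add_sub_cancel] at hB
  rw [div_pow, mul_pow, Real.sq_sqrt (by linarith), sq_abs]
  have h1 : 1 - √(b * c) / ((b + c) / 2) ≤ (b - c) ^ 2 / (b + c) ^ 2 := by
    set s := √(b * c) with hs
    have hs2 : s ^ 2 = b * c := Real.sq_sqrt (by positivity)
    have hs0 : 0 ≤ s := Real.sqrt_nonneg _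
    have hs1 : 2 * s ≤ b + c := by nlinarith [sq_nonneg (b - c)]
    rw [show 1 - s / ((b + c) / 2) = (b + c - 2 * s) * (b + c) / (b + c) ^ 2 by field_simp]
    gcongr
    nlinarith
  have : a * (1 - √(b * c) / ((b + c) / 2)) ≤ a * ((b - c) ^ 2 / (b + c) ^ 2) := by gcongr
  rw [mul_div_assoc]
  linarith

/-- Two Gamma laws with common shape `a` differ in total variation by at most a multiple of `√a`
times the relative difference of their rates. -/
theorem lintegral_gammaMeasure_le {a b c : ℝ} (ha : 1 ≤ a) (hb : 0 < b) (hc : 0 < c)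
    {h : ℝ → ℝ≥0∞} (hm : Measurable h) (h1 : ∀ x, h x ≤ 1) :
    ∫⁻ x, h x ∂(gammaMeasure a b) ≤
      ∫⁻ x, h x ∂(gammaMeasure a c) + ENNReal.ofReal (3 * (√a * |b - c| / (b + c))) := by
  have ha0 : 0 < a := by linarith
  rcases eq_or_ne b c with rfl | hne
  · simp
  set ε := √a * |b - c| / (b + c) with hε
  have hε0 : 0 < ε := by
    have : 0 < |b - c| := abs_pos.2 (sub_ne_zero.2 hne)
    positivity
  have hmid : 0 < (b + c) / 2 := by linarith
  set t := (√(b * c) / ((b + c) / 2)) ^ a with ht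
  have ht0 : 0 ≤ t := by positivity
  have hg := fun (r : ℝ) => measurable_gammaPDF a r
  have hpt : ∀ x ∈ Set.Ioi (0 : ℝ), gammaPDF a b x * h x +
      ENNReal.ofReal (t / ε) * gammaPDF a ((b + c) / 2) x ≤ gammaPDF a c x * h x +
      ENNReal.ofReal (1 / (2 * ε) + ε) * (gammaPDF a b x + gammaPDF a c x) := fun x hx => by
    rw [Set.mem_Ioi] at hx
    have hfin : h x ≠ ∞ := ((h1 x).trans_lt ENNReal.one_lt_top).ne
    obtain ⟨η, hη⟩ : ∃ η : ℝ≥0, h x = η := ⟨(h x).toNNReal, (ENNReal.coe_toNNReal hfin).symm⟩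
    have hη1 : (η : ℝ) ≤ 1 := by
      have := h1 x
      rw [hη] at this
      exact_mod_cast this
    have hη0 : (0 : ℝ) ≤ η := η.2
    have hgb := gammaPDFReal_nonneg ha0 hb x
    have hgc := gammaPDFReal_nonneg ha0 hc x
    have hgm := gammaPDFReal_nonneg ha0 hmid x
    have hprod := gammaPDFReal_mul_gammaPDFReal ha0 hb hc hx
    rw [← ht] at hprod
    rw [hη, ← ENNReal.ofReal_coe_nnreal]
    simp only [gammaPDF]
    rw [← ENNReal.ofReal_mul hgb, ← ENNReal.ofReal_mul hgc, ← ENNReal.ofReal_mul (by positivity),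
      ← ENNReal.ofReal_add hgb hgc, ← ENNReal.ofReal_mul (by positivity),
      ← ENNReal.ofReal_add (by positivity) (by positivity),
      ← ENNReal.ofReal_add (by positivity) (by positivity)]
    refine ENNReal.ofReal_le_ofReal ?_
    set g := gammaPDFReal a b x
    set g0 := gammaPDFReal a c x
    set gm := t * gammaPDFReal a ((b + c) / 2) x with hgmdef
    have hgm0 : 0 ≤ gm := by positivity
    -- with `p = √g` and `p₀ = √g₀`, use `|p² - p₀²| = |p - p₀| (p + p₀)` and Young's inequality
    set p := √g
    set p0 := √g0
    have hp : p ^ 2 = g := Real.sq_sqrt hgb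
    have hp0 : p0 ^ 2 = g0 := Real.sq_sqrt hgc
    have hpp : p * p0 = gm := by
      rw [← Real.sqrt_mul hgb, hprod, Real.sqrt_sq hgm0]
    have hpn : 0 ≤ p := Real.sqrt_nonneg _
    have hp0n : 0 ≤ p0 := Real.sqrt_nonneg _
    have e1 : t / ε * gammaPDFReal a ((b + c) / 2) x = p * p0 / ε := by rw [hpp, hgmdef]; ring
    rw [e1, ← hp, ← hp0]
    have hD : |p ^ 2 - p0 ^ 2| ≤ (1 / (2 * ε) + ε) * (p ^ 2 + p0 ^ 2) - p * p0 / ε := by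
      have e2 : (1 / (2 * ε) + ε) * (p ^ 2 + p0 ^ 2) - p * p0 / ε =
          (p - p0) ^ 2 / (2 * ε) + ε * (p ^ 2 + p0 ^ 2) := by field_simp; ring
      have e3 : |p ^ 2 - p0 ^ 2| = |p - p0| * (p + p0) := by
        rw [show p ^ 2 - p0 ^ 2 = (p - p0) * (p + p0) by ring, abs_mul,
          abs_of_nonneg (by positivity : 0 ≤ p + p0)]
      rw [e2, e3, ← sq_abs (p - p0)]
      have h4 : ε / 2 * (p + p0) ^ 2 ≤ ε * (p ^ 2 + p0 ^ 2) := by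
        nlinarith [mul_nonneg hε0.le (sq_nonneg (p - p0))]
      have h5 : 0 ≤ (|p - p0| - ε * (p + p0)) ^ 2 / (2 * ε) := by positivity
      have e6 : (|p - p0| - ε * (p + p0)) ^ 2 / (2 * ε) =
          |p - p0| ^ 2 / (2 * ε) - |p - p0| * (p + p0) + ε / 2 * (p + p0) ^ 2 := by
        field_simp
        ring
      linarith
    have h7 : (η : ℝ) * (p ^ 2 - p0 ^ 2) ≤ |p ^ 2 - p0 ^ 2| := by
      calc (η : ℝ) * (p ^ 2 - p0 ^ 2) ≤ η * |p ^ 2 - p0 ^ 2| := by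
            gcongr
            exact le_abs_self _
        _ ≤ 1 * |p ^ 2 - p0 ^ 2| := by gcongr
        _ = _ := one_mul _
    linarith
  have hint := setLIntegral_mono' (μ := volume) measurableSet_Ioi hpt
  rw [lintegral_add_left (f := fun x => gammaPDF a b x * h x) ((hg b).mul hm),
    lintegral_add_left (f := fun x => gammaPDF a c x * h x) ((hg c).mul hm),
    lintegral_const_mul _ (hg _),
    lintegral_const_mul (f := fun x => gammaPDF a b x + gammaPDF a c x) _ ((hg b).add (hg c)),
    lintegral_add_left (hg b), lintegral_gammaPDF_Ioi ha0 hb, lintegral_gammaPDF_Ioi ha0 hc,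
    lintegral_gammaPDF_Ioi ha0 hmid, mul_one, ← lintegral_gammaMeasure a b hm,
    ← lintegral_gammaMeasure a c hm] at hint
  have haff := one_sub_affinity_le ha hb hc
  rw [← ht, ← hε] at haff
  have hreal : (1 / (2 * ε) + ε) * 2 ≤ 3 * ε + t / ε := by
    have : (1 - t) / ε ≤ ε := by
      rw [div_le_iff₀ hε0]
      nlinarith
    have e : (1 / (2 * ε) + ε) * 2 = (1 - t) / ε + t / ε + 2 * ε := by field_simp; ring
    linarith
  have h8 : ENNReal.ofReal (1 / (2 * ε) + ε) * (1 + 1) ≤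
      ENNReal.ofReal (3 * ε) + ENNReal.ofReal (t / ε) := by
    rw [show (1 + 1 : ℝ≥0∞) = ENNReal.ofReal 2 by norm_num, ← ENNReal.ofReal_mul (by positivity),
      ← ENNReal.ofReal_add (by positivity) (by positivity)]
    exact ENNReal.ofReal_le_ofReal hreal
  have h9 := hint.trans (add_le_add_right h8 _)
  rw [← add_assoc] at h9
  exact (ENNReal.add_le_add_iff_right ENNReal.ofReal_ne_top).1 h9

end Gamma

/-! ### Mean energy of log-concave and Gaussian weights -/

section Energy

variable {E : Type*} [NormedAddCommGroup E] [MeasurableSpace E] [BorelSpace E]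

/-- Homothety of ratio `1/2` and centre `c`. -/
theorem lintegral_comp_half [NormedSpace ℝ E] [FiniteDimensional ℝ E] (μ : Measure E)
    [μ.IsAddHaarMeasure] (c : E) {f : E → ℝ≥0∞} (hf : Measurable f) :
    ∫⁻ z, f (c + (2⁻¹ : ℝ) • (z - c)) ∂μ = 2 ^ Module.finrank ℝ E * ∫⁻ z, f z ∂μ := by
  have h1 : ∀ z, c + (2⁻¹ : ℝ) • (z - c) = (2⁻¹ : ℝ) • z + (c - (2⁻¹ : ℝ) • c) := fun z => by
    rw [smul_sub]
    abel
  simp only [h1]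
  have hm : Measurable fun z : E => f (z + (c - (2⁻¹ : ℝ) • c)) := hf.comp (measurable_add_const _)
  rw [← lintegral_map (f := fun z => f (z + (c - (2⁻¹ : ℝ) • c))) hm
      (measurable_const_smul (2⁻¹ : ℝ)),
    Measure.map_addHaar_smul μ (by norm_num), lintegral_smul_measure,
    lintegral_add_right_eq_self (μ := μ) f]
  congr 1
  rw [inv_pow, inv_inv, abs_of_nonneg (by positivity), ENNReal.ofReal_pow (by norm_num)]
  norm_num

/-- The mean of a nonnegative convex function `Q` under the law with density proportional to
`exp (-Q / 2)` is at most `Q c` plus a multiple of the dimension. The homothety of ratio `1/2`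
centred at `c` multiplies the total mass by `2 ^ d`, and by convexity this bounds the mean of
`exp (Q / 4)`. -/
theorem lintegral_energy_le [NormedSpace ℝ E] [FiniteDimensional ℝ E] (μ : Measure E)
    [μ.IsAddHaarMeasure] {Q : E → ℝ} (hQ : Measurable Q) (h0 : ∀ z, 0 ≤ Q z) (c : E)
    (hconv : ∀ z, Q (c + (2⁻¹ : ℝ) • (z - c)) ≤ (Q c + Q z) / 2) :
    ∫⁻ z, ENNReal.ofReal (Q z) * ENNReal.ofReal (Real.exp (-(Q z / 2))) ∂μ ≤
      ENNReal.ofReal (4 * Module.finrank ℝ E + 4 + Q c) *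
        ∫⁻ z, ENNReal.ofReal (Real.exp (-(Q z / 2))) ∂μ := by
  set d := Module.finrank ℝ E with hd
  set J := ∫⁻ z, ENNReal.ofReal (Real.exp (-(Q z / 2))) ∂μ with hJ
  have hc0 := h0 c
  have hm2 : Measurable fun z => ENNReal.ofReal (Real.exp (-(Q z / 2))) := by fun_prop
  have hm4 : Measurable fun z => ENNReal.ofReal (Real.exp (-(Q z / 4))) := by fun_prop
  set M : ℝ := d + Q c / 4 with hM
  have hM0 : 0 ≤ M := by positivity
  have h4 : ∫⁻ z, ENNReal.ofReal (Real.exp (-(Q z / 4))) ∂μ ≤ ENNReal.ofReal (Real.exp M) * J := by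
    calc ∫⁻ z, ENNReal.ofReal (Real.exp (-(Q z / 4))) ∂μ
        ≤ ∫⁻ z, ENNReal.ofReal (Real.exp (Q c / 4)) *
            ENNReal.ofReal (Real.exp (-(Q (c + (2⁻¹ : ℝ) • (z - c)) / 2))) ∂μ := by
          refine lintegral_mono fun z => ?_
          rw [← ENNReal.ofReal_mul (Real.exp_nonneg _), ← Real.exp_add]
          refine ENNReal.ofReal_le_ofReal (Real.exp_le_exp.2 ?_)
          linarith [hconv z]
      _ = ENNReal.ofReal (Real.exp (Q c / 4)) * (2 ^ d * J) := by
          rw [lintegral_const_mul' _ _ ENNReal.ofReal_ne_top,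
            lintegral_comp_half μ c (f := fun z => ENNReal.ofReal (Real.exp (-(Q z / 2)))) hm2]
      _ ≤ ENNReal.ofReal (Real.exp (Q c / 4)) * (ENNReal.ofReal (Real.exp d) * J) := by
          gcongr
          rw [show (2 : ℝ≥0∞) = ENNReal.ofReal 2 by norm_num, ← ENNReal.ofReal_pow (by norm_num)]
          refine ENNReal.ofReal_le_ofReal ?_
          rw [← mul_one (d : ℝ), Real.exp_nat_mul]
          gcongr
          have := Real.add_one_le_exp (1 : ℝ)
          linarith
      _ = _ := by
          rw [← mul_assoc, ← ENNReal.ofReal_mul (Real.exp_nonneg _), ← Real.exp_add, add_comm]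
  calc ∫⁻ z, ENNReal.ofReal (Q z) * ENNReal.ofReal (Real.exp (-(Q z / 2))) ∂μ
      ≤ ∫⁻ z, (ENNReal.ofReal (4 * M) * ENNReal.ofReal (Real.exp (-(Q z / 2))) +
          ENNReal.ofReal (4 * Real.exp (-M)) * ENNReal.ofReal (Real.exp (-(Q z / 4)))) ∂μ := by
        refine lintegral_mono fun z => ?_
        rw [← ENNReal.ofReal_mul (h0 z), ← ENNReal.ofReal_mul (by positivity),
          ← ENNReal.ofReal_mul (by positivity), ← ENNReal.ofReal_add (by positivity) (by positivity)]
        refine ENNReal.ofReal_le_ofReal ?_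
        have e : Real.exp (-M) * Real.exp (-(Q z / 4)) =
            Real.exp (Q z / 4 - M) * Real.exp (-(Q z / 2)) := by
          rw [← Real.exp_add, ← Real.exp_add]
          congr 1
          ring
        have h5 := Real.add_one_le_exp (Q z / 4 - M)
        have h6 := Real.exp_pos (-(Q z / 2))
        rw [mul_assoc 4 (Real.exp (-M)), e]
        nlinarith
    _ = ENNReal.ofReal (4 * M) * J + ENNReal.ofReal (4 * Real.exp (-M)) *
          ∫⁻ z, ENNReal.ofReal (Real.exp (-(Q z / 4))) ∂μ := by
        rw [lintegral_add_left (hm2.const_mul _), lintegral_const_mul _ hm2,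
          lintegral_const_mul _ hm4]
    _ ≤ ENNReal.ofReal (4 * M) * J + ENNReal.ofReal (4 * Real.exp (-M)) *
          (ENNReal.ofReal (Real.exp M) * J) := by gcongr
    _ = _ := by
        rw [← mul_assoc, ← ENNReal.ofReal_mul (by positivity), mul_assoc, ← Real.exp_add,
          neg_add_cancel, Real.exp_zero, ← add_mul, ← ENNReal.ofReal_add (by positivity)
          (by norm_num)]
        congr 2
        rw [hM]
        ring

theorem lintegral_exp_neg_mul_sq_norm [InnerProductSpace ℝ E] [FiniteDimensional ℝ E] {b : ℝ}
    (hb : 0 < b) :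
    ∫⁻ z : E, ENNReal.ofReal (Real.exp (-(b * ‖z‖ ^ 2))) =
      ENNReal.ofReal ((Real.pi / b) ^ (Module.finrank ℝ E / 2 : ℝ)) := by
  have h := GaussianFourier.integral_rexp_neg_mul_sq_norm (V := E) hb
  simp only [neg_mul] at h
  rw [← h, ofReal_integral_eq_lintegral_ofReal]
  · refine Integrable.of_integral_ne_zero ?_
    rw [h]
    have : 0 < Real.pi / b := div_pos Real.pi_pos hb
    exact (Real.rpow_pos_of_pos this _).ne'
  · exact ae_of_all _ fun z => Real.exp_nonneg _

omit [MeasurableSpace E] [BorelSpace E] in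
theorem norm_half_sq_le [NormedSpace ℝ E] (x y : E) :
    ‖(2⁻¹ : ℝ) • x + (2⁻¹ : ℝ) • y‖ ^ 2 ≤ (‖x‖ ^ 2 + ‖y‖ ^ 2) / 2 := by
  have h := norm_add_le ((2⁻¹ : ℝ) • x) ((2⁻¹ : ℝ) • y)
  rw [norm_smul, norm_smul, Real.norm_of_nonneg (by norm_num : (0 : ℝ) ≤ 2⁻¹)] at h
  nlinarith [norm_nonneg ((2⁻¹ : ℝ) • x + (2⁻¹ : ℝ) • y), sq_nonneg (‖x‖ - ‖y‖)]

end Energy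

noncomputable section GaussianPair

variable {Z F₁ F₂ : Type*} [NormedAddCommGroup Z] [InnerProductSpace ℝ Z] [FiniteDimensional ℝ Z]
  [MeasurableSpace Z] [BorelSpace Z]
  [NormedAddCommGroup F₁] [NormedSpace ℝ F₁] [NormedAddCommGroup F₂] [NormedSpace ℝ F₂]
  (M : Z →L[ℝ] F₁) (L : Z →L[ℝ] F₂) (c : Z)

/-- Quadratic energy `τ ‖M (z - c)‖² + λ ‖L z‖²`. -/
def quadEnergy (lam tau : ℝ) (z : Z) : ℝ := tau * ‖M (z - c)‖ ^ 2 + lam * ‖L z‖ ^ 2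

omit [FiniteDimensional ℝ Z] in
theorem measurable_quadEnergy (lam tau : ℝ) : Measurable (quadEnergy M L c lam tau) := by
  have : Continuous (quadEnergy M L c lam tau) := by
    unfold quadEnergy
    fun_prop
  exact this.measurable

/-- Gaussian weight on `Z × ℝ`. -/
def pairWeight (lam tau : ℝ) (w : Z × ℝ) : ℝ≥0∞ :=
  ENNReal.ofReal (Real.exp (-(quadEnergy M L c lam tau w.1 / 2))) *
    ENNReal.ofReal (Real.exp (-(lam * w.2 ^ 2 / 2)))

omit [FiniteDimensional ℝ Z] in
theorem measurable_pairWeight (lam tau : ℝ) : Measurable (pairWeight M L c lam tau) := by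
  have := measurable_quadEnergy M L c lam tau
  unfold pairWeight
  fun_prop

theorem lintegral_pairWeight_mul {lam tau : ℝ} {f : Z → ℝ≥0∞} {g : ℝ → ℝ≥0∞} (hf : Measurable f)
    (hg : Measurable g) :
    ∫⁻ w : Z × ℝ, f w.1 * g w.2 * pairWeight M L c lam tau w =
      (∫⁻ z, f z * ENNReal.ofReal (Real.exp (-(quadEnergy M L c lam tau z / 2)))) *
        ∫⁻ v, g v * ENNReal.ofReal (Real.exp (-(lam * v ^ 2 / 2))) := by
  have hQ := measurable_quadEnergy M L c lam tau
  rw [Measure.volume_eq_prod, ← lintegral_prod_mul (by fun_prop) (by fun_prop)]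
  refine lintegral_congr fun w => ?_
  unfold pairWeight
  ring

theorem lintegral_pairWeight (lam tau : ℝ) :
    ∫⁻ w : Z × ℝ, pairWeight M L c lam tau w =
      (∫⁻ z, ENNReal.ofReal (Real.exp (-(quadEnergy M L c lam tau z / 2)))) *
        ∫⁻ v : ℝ, ENNReal.ofReal (Real.exp (-(lam * v ^ 2 / 2))) := by
  have := lintegral_pairWeight_mul M L c (lam := lam) (tau := tau) (f := fun _ => 1)
    (g := fun _ => 1) measurable_const measurable_const
  simpa using this

theorem lintegral_pairWeight_le {lam tau κ : ℝ} (hlam : 0 < lam) (htau : 0 < tau) (hκ : 0 < κ)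
    (hM : ∀ z, κ * ‖z‖ ^ 2 ≤ ‖M z‖ ^ 2) :
    ∫⁻ w : Z × ℝ, pairWeight M L c lam tau w ≤
      ENNReal.ofReal ((Real.pi / (tau * κ / 2)) ^ (Module.finrank ℝ Z / 2 : ℝ)) *
        ENNReal.ofReal ((Real.pi / (lam / 2)) ^ (1 / 2 : ℝ)) := by
  rw [lintegral_pairWeight]
  refine mul_le_mul' ?_ (le_of_eq ?_)
  · rw [← lintegral_exp_neg_mul_sq_norm (E := Z) (by positivity : 0 < tau * κ / 2),
      ← lintegral_sub_right_eq_self (fun z => ENNReal.ofReal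
        (Real.exp (-(tau * κ / 2 * ‖z‖ ^ 2)))) c]
    refine lintegral_mono fun z => ENNReal.ofReal_le_ofReal (Real.exp_le_exp.2 ?_)
    have h1 := mul_le_mul_of_nonneg_left (hM (z - c)) htau.le
    have h2 : 0 ≤ lam * ‖L z‖ ^ 2 := by positivity
    unfold quadEnergy
    linarith
  · have := lintegral_exp_neg_mul_sq_norm (E := ℝ) (by positivity : 0 < lam / 2)
    simp only [Module.finrank_self, Nat.cast_one, Real.norm_eq_abs, sq_abs] at this
    rw [← this]
    refine lintegral_congr fun v => ?_
    congr 3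
    ring

theorem lintegral_pairWeight_pos (lam tau : ℝ) :
    0 < ∫⁻ w : Z × ℝ, pairWeight M L c lam tau w := by
  rw [lintegral_pos_iff_support (measurable_pairWeight M L c lam tau)]
  have : Function.support (pairWeight M L c lam tau) = Set.univ := by
    refine Set.eq_univ_of_forall fun w => ?_
    have h1 : 0 < ENNReal.ofReal (Real.exp (-(quadEnergy M L c lam tau w.1 / 2))) :=
      ENNReal.ofReal_pos.2 (Real.exp_pos _)
    have h2 : 0 < ENNReal.ofReal (Real.exp (-(lam * w.2 ^ 2 / 2))) :=
      ENNReal.ofReal_pos.2 (Real.exp_pos _)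
    exact (ENNReal.mul_pos h1.ne' h2.ne').ne'
  rw [this]
  exact Measure.measure_univ_pos.2 (NeZero.ne _)

/-- Second moment of the real coordinate, which is independent of the other one. -/
theorem lintegral_sq_pairWeight_le {lam tau : ℝ} (hlam : 0 < lam) :
    ∫⁻ w : Z × ℝ, ENNReal.ofReal (w.2 ^ 2) * pairWeight M L c lam tau w ≤
      ENNReal.ofReal (8 / lam) * ∫⁻ w : Z × ℝ, pairWeight M L c lam tau w := by
  have h := lintegral_energy_le (volume : Measure ℝ) (Q := fun v => lam * v ^ 2) (by fun_prop)
    (fun v => by positivity) 0 (fun v => by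
      simp only [sub_zero, zero_add, smul_eq_mul]
      nlinarith [mul_nonneg hlam.le (sq_nonneg v)])
  simp only [Module.finrank_self] at h
  have h2 := lintegral_pairWeight_mul M L c (lam := lam) (tau := tau) (f := fun _ => 1)
    (g := fun v => ENNReal.ofReal (v ^ 2)) measurable_const (by fun_prop)
  simp only [one_mul] at h2
  rw [h2, lintegral_pairWeight, mul_left_comm]
  gcongr
  have e : ∀ v : ℝ, ENNReal.ofReal (v ^ 2) * ENNReal.ofReal (Real.exp (-(lam * v ^ 2 / 2))) =
      ENNReal.ofReal lam⁻¹ *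
        (ENNReal.ofReal (lam * v ^ 2) * ENNReal.ofReal (Real.exp (-(lam * v ^ 2 / 2)))) :=
    fun v => by
      rw [← mul_assoc, ← ENNReal.ofReal_mul (inv_nonneg.2 hlam.le), inv_mul_cancel_left₀ hlam.ne']
  simp only [e]
  rw [lintegral_const_mul' _ _ ENNReal.ofReal_ne_top]
  refine (mul_le_mul_right h _).trans_eq ?_
  rw [← mul_assoc, ← ENNReal.ofReal_mul (by positivity)]
  congr 2
  field_simp
  norm_num

/-- Mean of the squared distance to the centre in the seminorm `‖M ·‖`. -/
theorem lintegral_norm_sq_pairWeight_le {lam tau : ℝ} (hlam : 0 < lam) (htau : 0 < tau) :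
    ∫⁻ w : Z × ℝ, ENNReal.ofReal (‖M (w.1 - c)‖ ^ 2) * pairWeight M L c lam tau w ≤
      ENNReal.ofReal ((4 * Module.finrank ℝ Z + 4 + lam * ‖L c‖ ^ 2) / tau) *
        ∫⁻ w : Z × ℝ, pairWeight M L c lam tau w := by
  have h := lintegral_energy_le (volume : Measure Z) (Q := quadEnergy M L c lam tau)
    (measurable_quadEnergy M L c lam tau) (fun z => by unfold quadEnergy; positivity) c (fun z => by
      unfold quadEnergy
      have e1 : M (c + (2⁻¹ : ℝ) • (z - c) - c) = (2⁻¹ : ℝ) • M (z - c) := by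
        rw [add_sub_cancel_left, map_smul]
      have e2 : L (c + (2⁻¹ : ℝ) • (z - c)) = (2⁻¹ : ℝ) • L c + (2⁻¹ : ℝ) • L z := by
        rw [← map_smul, ← map_smul, ← map_add]
        congr 1
        rw [smul_sub]
        have : c = (2⁻¹ : ℝ) • c + (2⁻¹ : ℝ) • c := by
          rw [← add_smul]
          norm_num
        nth_rewrite 1 [this]
        abel
      have h1 := mul_le_mul_of_nonneg_left (norm_half_sq_le (L c) (L z)) hlam.le
      rw [e1, e2, sub_self, map_zero, norm_zero, norm_smul, mul_pow,
        Real.norm_of_nonneg (by norm_num : (0 : ℝ) ≤ 2⁻¹)]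
      have h2 : 0 ≤ tau * ‖M (z - c)‖ ^ 2 := by positivity
      nlinarith)
  have hM : Measurable fun z => ENNReal.ofReal (‖M (z - c)‖ ^ 2) := by
    have : Continuous fun z => ‖M (z - c)‖ ^ 2 := by fun_prop
    exact this.measurable.ennreal_ofReal
  have h2 := lintegral_pairWeight_mul M L c (lam := lam) (tau := tau)
    (f := fun z => ENNReal.ofReal (‖M (z - c)‖ ^ 2)) (g := fun _ => 1) hM measurable_const
  simp only [mul_one, one_mul] at h2
  rw [h2, lintegral_pairWeight, ← mul_assoc]
  refine mul_le_mul_left ?_ _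
  have hQc : quadEnergy M L c lam tau c = lam * ‖L c‖ ^ 2 := by
    simp [quadEnergy]
  rw [hQc] at h
  calc _ ≤ ∫⁻ z, ENNReal.ofReal tau⁻¹ * (ENNReal.ofReal (quadEnergy M L c lam tau z) *
        ENNReal.ofReal (Real.exp (-(quadEnergy M L c lam tau z / 2)))) := by
        refine lintegral_mono fun z => ?_
        rw [← mul_assoc, ← ENNReal.ofReal_mul (inv_nonneg.2 htau.le)]
        refine mul_le_mul_left (ENNReal.ofReal_le_ofReal ?_) _
        unfold quadEnergy
        have : 0 ≤ lam * ‖L z‖ ^ 2 := by positivity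
        rw [inv_mul_eq_div, le_div_iff₀ htau]
        nlinarith
    _ ≤ _ := by
        rw [lintegral_const_mul' _ _ ENNReal.ofReal_ne_top]
        refine (mul_le_mul_right h _).trans_eq ?_
        rw [← mul_assoc, ← ENNReal.ofReal_mul (by positivity), inv_mul_eq_div]

end GaussianPair

/-! ### The posterior as a Gamma-Gaussian mixture -/

noncomputable section Posterior

theorem measurable_lintegral_fst {α : Type*} [MeasurableSpace α] (ν : Measure α) [SFinite ν]
    (f : α → ℝ → ℝ → ℝ≥0∞) (hf : Measurable fun z : α × ℝ × ℝ => f z.1 z.2.1 z.2.2) :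
    Measurable fun w : ℝ × ℝ => ∫⁻ a, f a w.1 w.2 ∂ν := by
  have h : Measurable fun v : (ℝ × ℝ) × α => f v.2 v.1.1 v.1.2 :=
    hf.comp (measurable_snd.prodMk measurable_fst)
  exact h.lintegral_prod_right'

theorem measurable_section {α : Type*} [MeasurableSpace α]
    (f : α → ℝ → ℝ → ℝ≥0∞) (hf : Measurable fun z : α × ℝ × ℝ => f z.1 z.2.1 z.2.2) (a : α) :
    Measurable fun w : ℝ × ℝ => f a w.1 w.2 :=
  hf.comp (measurable_const.prodMk measurable_id)

/-- Fubini's theorem for a mixture of the densities `c · s t` with mixing density `g`. -/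
theorem lintegral_mix_swap {α : Type*} [MeasurableSpace α] (ν : Measure α) [SFinite ν]
    (c : α → ℝ → ℝ → ℝ≥0∞) (g : ℝ → ℝ → ℝ≥0∞) (h : α → ℝ≥0∞)
    (hc : Measurable fun z : α × ℝ × ℝ => c z.1 z.2.1 z.2.2)
    (hg : Measurable fun w : ℝ × ℝ => g w.1 w.2) (hh : Measurable h) :
    ∫⁻ a, (∫⁻ s in Set.Ioi (0 : ℝ), ∫⁻ t in Set.Ioi (0 : ℝ), c a s t * g s t) * h a ∂ν =
      ∫⁻ s in Set.Ioi (0 : ℝ), ∫⁻ t in Set.Ioi (0 : ℝ), g s t * ∫⁻ a, c a s t * h a ∂ν := by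
  set P : Measure ℝ := volume.restrict (Set.Ioi (0 : ℝ)) with hP
  have hca : ∀ a, Measurable fun w : ℝ × ℝ => c a w.1 w.2 := measurable_section c hc
  have e1 : ∀ a, (∫⁻ s, ∫⁻ t, c a s t * g s t ∂P ∂P) * h a =
      ∫⁻ w : ℝ × ℝ, c a w.1 w.2 * g w.1 w.2 * h a ∂(P.prod P) := fun a => by
    rw [lintegral_mul_const (f := fun w : ℝ × ℝ => c a w.1 w.2 * g w.1 w.2) _ ((hca a).mul hg),
      lintegral_prod (fun w : ℝ × ℝ => c a w.1 w.2 * g w.1 w.2) ((hca a).mul hg).aemeasurable]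
  have hm : Measurable fun v : α × (ℝ × ℝ) => c v.1 v.2.1 v.2.2 * g v.2.1 v.2.2 * h v.1 :=
    (hc.mul (hg.comp measurable_snd)).mul (hh.comp measurable_fst)
  have hm' : Measurable fun v : (ℝ × ℝ) × α => c v.2 v.1.1 v.1.2 * h v.2 :=
    (hc.comp (measurable_snd.prodMk measurable_fst)).mul (hh.comp measurable_snd)
  have hm3 : Measurable fun w : ℝ × ℝ => ∫⁻ a, c a w.1 w.2 * h a ∂ν := hm'.lintegral_prod_right'
  simp only [e1]
  rw [lintegral_lintegral_swap hm.aemeasurable]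
  have e2 : ∀ w : ℝ × ℝ, ∫⁻ a, c a w.1 w.2 * g w.1 w.2 * h a ∂ν =
      g w.1 w.2 * ∫⁻ a, c a w.1 w.2 * h a ∂ν := fun w => by
    rw [← lintegral_const_mul (f := fun a => c a w.1 w.2 * h a) _
      (hm'.comp (measurable_prodMk_left (x := w)))]
    exact lintegral_congr fun a => by ring
  simp only [e2]
  exact lintegral_prod _ (hg.mul hm3).aemeasurable

theorem lintegral_gammaMeasure_gammaMeasure {a b a' b' : ℝ} (ha' : 0 < a') (hb' : 0 < b')
    {p h : ℝ → ℝ → ℝ≥0∞} (hh : Measurable fun w : ℝ × ℝ => h w.1 w.2)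
    (hp : ∀ s t, 0 < s → 0 < t → p s t = gammaPDF a b s * gammaPDF a' b' t) :
    ∫⁻ s in Set.Ioi (0 : ℝ), ∫⁻ t in Set.Ioi (0 : ℝ), p s t * h s t =
      ∫⁻ s, ∫⁻ t, h s t ∂(gammaMeasure a' b') ∂(gammaMeasure a b) := by
  have := isProbabilityMeasure_gammaMeasure ha' hb'
  have h1 : Measurable fun s => ∫⁻ t, h s t ∂(gammaMeasure a' b') := hh.lintegral_prod_right'
  rw [lintegral_gammaMeasure a b h1]
  refine setLIntegral_congr_fun measurableSet_Ioi fun s hs => ?_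
  have h2 : Measurable fun t => h s t := hh.comp measurable_prodMk_left
  change _ = gammaPDF a b s * ∫⁻ t, h s t ∂(gammaMeasure a' b')
  rw [lintegral_gammaMeasure a' b' h2, ← lintegral_const_mul' (gammaPDF a b s) _ ENNReal.ofReal_ne_top]
  refine setLIntegral_congr_fun measurableSet_Ioi fun t ht => ?_
  rw [hp s t hs ht, mul_assoc]

theorem gaussianPDF_toNNReal_inv {s : ℝ} (hs : 0 < s) (m y : ℝ) :
    gaussianPDF m (Real.toNNReal s⁻¹) y =
      ENNReal.ofReal (s ^ (1 / 2 : ℝ) * (√(2 * Real.pi))⁻¹ * Real.exp (-(s * ((y - m) ^ 2 / 2)))) := by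
  rw [gaussianPDF, gaussianPDFReal, Real.coe_toNNReal _ (inv_nonneg.2 hs.le)]
  congr 2
  · rw [Real.sqrt_mul (by positivity), Real.sqrt_inv, ← Real.sqrt_eq_rpow, mul_inv, inv_inv, mul_comm]
  · congr 1
    field_simp

namespace MixedModelData

variable {q : ℕ} (D : MixedModelData q)

/-- Total number of observations. -/
def total : ℕ := ∑ i, D.r i

/-- Residual sum of squares `∑ (y i j - x i jᵀ β - u i) ^ 2` as a function of `η`. -/
def resSq (η : D.State) : ℝ :=
  ∑ i, ∑ j, (D.y i j - (D.x i j ⬝ᵥ ((√(q : ℝ))⁻¹ • η.fixedPart) + η.effect i)) ^ 2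

/-- Sum of squares `∑ (u i - μ) ^ 2` as a function of `η`. -/
def effSq (η : D.State) : ℝ := ∑ i, (η.effect i - η.meanPart / √(q : ℝ)) ^ 2

/-- Rate of the conditional Gamma law of `lam`. -/
def rateLam (b₁ : ℝ) (η : D.State) : ℝ := b₁ + D.effSq η / 2

/-- Rate of the conditional Gamma law of `tau`. -/
def rateTau (b₂ : ℝ) (η : D.State) : ℝ := b₂ + D.resSq η / 2

/-- Shape of the conditional Gamma law of `lam`. -/
def shapeLam (_ : MixedModelData q) (a₁ : ℝ) : ℝ := a₁ + q / 2

/-- Shape of the conditional Gamma law of `tau`. -/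
def shapeTau (a₂ : ℝ) : ℝ := a₂ + D.total / 2

theorem resSq_nonneg (η : D.State) : 0 ≤ D.resSq η :=
  Finset.sum_nonneg fun _ _ => Finset.sum_nonneg fun _ _ => sq_nonneg _

theorem effSq_nonneg (η : D.State) : 0 ≤ D.effSq η := Finset.sum_nonneg fun _ _ => sq_nonneg _

theorem rateLam_pos {b₁ : ℝ} (hb₁ : 0 < b₁) (η : D.State) : 0 < D.rateLam b₁ η := by
  have := D.effSq_nonneg η
  unfold rateLam
  positivity

theorem rateTau_pos {b₂ : ℝ} (hb₂ : 0 < b₂) (η : D.State) : 0 < D.rateTau b₂ η := by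
  have := D.resSq_nonneg η
  unfold rateTau
  positivity

theorem shapeLam_pos {a₁ : ℝ} (ha₁ : 0 < a₁) : 0 < D.shapeLam a₁ := by
  unfold shapeLam
  positivity

theorem shapeTau_pos {a₂ : ℝ} (ha₂ : 0 < a₂) : 0 < D.shapeTau a₂ := by
  unfold shapeTau
  positivity

theorem continuous_resSq : Continuous D.resSq := by
  unfold resSq State.fixedPart State.effect dotProduct
  simp only [Pi.smul_apply]
  fun_prop

theorem continuous_effSq : Continuous D.effSq := by
  unfold effSq State.meanPart State.effect
  fun_prop

/-- Normalising constant in the exponential form of the posterior density. -/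
def postConst (a₁ a₂ b₁ b₂ : ℝ) : ℝ :=
  (√(2 * Real.pi))⁻¹ ^ D.total * (√(2 * Real.pi))⁻¹ ^ q *
    (b₁ ^ a₁ / Real.Gamma a₁) * (b₂ ^ a₂ / Real.Gamma a₂)

variable {a₁ a₂ b₁ b₂ : ℝ}

theorem postConst_pos (ha₁ : 0 < a₁) (ha₂ : 0 < a₂) (hb₁ : 0 < b₁) (hb₂ : 0 < b₂) :
    0 < D.postConst a₁ a₂ b₁ b₂ := by
  have := Real.Gamma_pos_of_pos ha₁
  have := Real.Gamma_pos_of_pos ha₂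
  have := Real.pi_pos
  unfold postConst
  positivity

theorem postDensity_eq_exp (ha₁ : 0 < a₁) (hb₁ : 0 < b₁) {lam tau : ℝ} (hlam : 0 < lam)
    (htau : 0 < tau) (η : D.State) :
    D.postDensity a₁ a₂ b₁ b₂ η lam tau =
      ENNReal.ofReal (D.postConst a₁ a₂ b₁ b₂ *
        (lam ^ (D.shapeLam a₁ - 1) * Real.exp (-(D.rateLam b₁ η * lam))) *
        (tau ^ (D.shapeTau a₂ - 1) * Real.exp (-(D.rateTau b₂ η * tau)))) := by
  have h1 : ∀ (i : Fin q) (j : Fin (D.r i)) (m : ℝ), 0 ≤ tau ^ (1 / 2 : ℝ) * (√(2 * Real.pi))⁻¹ *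
      Real.exp (-(tau * ((D.y i j - m) ^ 2 / 2))) := fun i j m => by positivity
  have h2 : ∀ (u m : ℝ), 0 ≤ lam ^ (1 / 2 : ℝ) * (√(2 * Real.pi))⁻¹ *
      Real.exp (-(lam * ((u - m) ^ 2 / 2))) := fun u m => by positivity
  unfold postDensity jointDensity
  simp only [gaussianPDF_toNNReal_inv hlam, gaussianPDF_toNNReal_inv htau]
  simp only [← ENNReal.ofReal_prod_of_nonneg (fun j _ => h1 _ j _)]
  rw [← ENNReal.ofReal_prod_of_nonneg (fun i _ => Finset.prod_nonneg fun j _ => h1 i j _),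
    ← ENNReal.ofReal_prod_of_nonneg (fun i _ => h2 _ _), gammaPDF, gammaPDF,
    ← ENNReal.ofReal_mul (Finset.prod_nonneg fun i _ => Finset.prod_nonneg fun j _ => h1 i j _),
    ← ENNReal.ofReal_mul (mul_nonneg (Finset.prod_nonneg fun i _ => Finset.prod_nonneg
      fun j _ => h1 i j _) (Finset.prod_nonneg fun i _ => h2 _ _)),
    ← ENNReal.ofReal_mul (mul_nonneg (mul_nonneg (Finset.prod_nonneg fun i _ =>
      Finset.prod_nonneg fun j _ => h1 i j _) (Finset.prod_nonneg fun i _ => h2 _ _))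
      (gammaPDFReal_nonneg ha₁ hb₁ lam)), gammaPDFReal_of_pos hlam, gammaPDFReal_of_pos htau]
  congr 1
  have e1 : ∏ i, ∏ j, (tau ^ (1 / 2 : ℝ) * (√(2 * Real.pi))⁻¹ *
      Real.exp (-(tau * ((D.y i j - (D.x i j ⬝ᵥ ((√(q : ℝ))⁻¹ • η.fixedPart) + η.effect i)) ^ 2 / 2)))) =
      tau ^ (D.total / 2 : ℝ) * (√(2 * Real.pi))⁻¹ ^ D.total *
        Real.exp (-(D.resSq η / 2 * tau)) := by
    simp only [Finset.prod_mul_distrib, Finset.prod_const, Finset.card_univ, Fintype.card_fin,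
      ← Real.exp_sum, Finset.prod_pow_eq_pow_sum]
    rw [← total, ← Real.rpow_mul_natCast htau.le]
    congr 2
    · congr 1
      ring
    · simp only [Finset.sum_neg_distrib, ← Finset.mul_sum, ← Finset.sum_div]
      rw [← resSq, mul_comm]
  have e2 : ∏ i, (lam ^ (1 / 2 : ℝ) * (√(2 * Real.pi))⁻¹ *
      Real.exp (-(lam * ((η.effect i - η.meanPart / √(q : ℝ)) ^ 2 / 2)))) =
      lam ^ (q / 2 : ℝ) * (√(2 * Real.pi))⁻¹ ^ q * Real.exp (-(D.effSq η / 2 * lam)) := by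
    simp only [Finset.prod_mul_distrib, Finset.prod_const, Finset.card_univ, Fintype.card_fin,
      ← Real.exp_sum]
    rw [← Real.rpow_mul_natCast hlam.le]
    congr 2
    · congr 1
      ring
    · simp only [Finset.sum_neg_distrib, ← Finset.mul_sum, ← Finset.sum_div]
      rw [← effSq, mul_comm]
  have e3 : lam ^ (D.shapeLam a₁ - 1) = lam ^ (q / 2 : ℝ) * lam ^ (a₁ - 1) := by
    rw [← Real.rpow_add hlam, shapeLam]
    congr 1
    ring
  have e4 : tau ^ (D.shapeTau a₂ - 1) = tau ^ (D.total / 2 : ℝ) * tau ^ (a₂ - 1) := by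
    rw [← Real.rpow_add htau, shapeTau]
    congr 1
    ring
  have e5 : Real.exp (-(D.rateLam b₁ η * lam)) =
      Real.exp (-(D.effSq η / 2 * lam)) * Real.exp (-(b₁ * lam)) := by
    rw [← Real.exp_add, rateLam]
    congr 1
    ring
  have e6 : Real.exp (-(D.rateTau b₂ η * tau)) =
      Real.exp (-(D.resSq η / 2 * tau)) * Real.exp (-(b₂ * tau)) := by
    rw [← Real.exp_add, rateTau]
    congr 1
    ring
  rw [e1, e2, e3, e4, e5, e6, postConst]
  ring

/-- Value of the unnormalised marginal density of `η`. -/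
def margConst (a₁ a₂ b₁ b₂ : ℝ) (η : D.State) : ℝ :=
  D.postConst a₁ a₂ b₁ b₂ *
    (Real.Gamma (D.shapeLam a₁) / D.rateLam b₁ η ^ D.shapeLam a₁) *
    (Real.Gamma (D.shapeTau a₂) / D.rateTau b₂ η ^ D.shapeTau a₂)

theorem margConst_pos (ha₁ : 0 < a₁) (ha₂ : 0 < a₂) (hb₁ : 0 < b₁) (hb₂ : 0 < b₂) (η : D.State) :
    0 < D.margConst a₁ a₂ b₁ b₂ η := by
  have := D.postConst_pos ha₁ ha₂ hb₁ hb₂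
  have := Real.Gamma_pos_of_pos (D.shapeLam_pos ha₁)
  have := Real.Gamma_pos_of_pos (D.shapeTau_pos ha₂)
  have := D.rateLam_pos hb₁ η
  have := D.rateTau_pos hb₂ η
  unfold margConst
  positivity

/-- Given `η`, the two precisions are independent Gamma variables. -/
theorem postDensity_eq_gamma (ha₁ : 0 < a₁) (ha₂ : 0 < a₂) (hb₁ : 0 < b₁) (hb₂ : 0 < b₂)
    {lam tau : ℝ} (hlam : 0 < lam) (htau : 0 < tau) (η : D.State) :
    D.postDensity a₁ a₂ b₁ b₂ η lam tau =
      ENNReal.ofReal (D.margConst a₁ a₂ b₁ b₂ η) *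
        (gammaPDF (D.shapeLam a₁) (D.rateLam b₁ η) lam *
          gammaPDF (D.shapeTau a₂) (D.rateTau b₂ η) tau) := by
  have hA := D.rateLam_pos hb₁ η
  have hB := D.rateTau_pos hb₂ η
  have hα := D.shapeLam_pos ha₁
  have hβ := D.shapeTau_pos ha₂
  have hAα := Real.rpow_pos_of_pos hA (D.shapeLam a₁)
  have hBβ := Real.rpow_pos_of_pos hB (D.shapeTau a₂)
  have hG := Real.Gamma_pos_of_pos hα
  have hG' := Real.Gamma_pos_of_pos hβ
  rw [D.postDensity_eq_exp ha₁ hb₁ hlam htau, gammaPDF, gammaPDF,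
    ← ENNReal.ofReal_mul (gammaPDFReal_nonneg hα hA lam),
    ← ENNReal.ofReal_mul (D.margConst_pos ha₁ ha₂ hb₁ hb₂ η).le, gammaPDFReal_of_pos hlam,
    gammaPDFReal_of_pos htau, margConst]
  congr 1
  field_simp

theorem margDensity_eq (ha₁ : 0 < a₁) (ha₂ : 0 < a₂) (hb₁ : 0 < b₁) (hb₂ : 0 < b₂) (η : D.State) :
    D.margDensity a₁ a₂ b₁ b₂ η = ENNReal.ofReal (D.margConst a₁ a₂ b₁ b₂ η) := by
  have hA := D.rateLam_pos hb₁ η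
  have hB := D.rateTau_pos hb₂ η
  have hα := D.shapeLam_pos ha₁
  have hβ := D.shapeTau_pos ha₂
  unfold margDensity
  calc _ = ∫⁻ lam in Set.Ioi (0 : ℝ), ∫⁻ tau in Set.Ioi (0 : ℝ),
      ENNReal.ofReal (D.margConst a₁ a₂ b₁ b₂ η) *
        (gammaPDF (D.shapeLam a₁) (D.rateLam b₁ η) lam *
          gammaPDF (D.shapeTau a₂) (D.rateTau b₂ η) tau) :=
        setLIntegral_congr_fun measurableSet_Ioi fun lam hlam =>
          setLIntegral_congr_fun measurableSet_Ioi fun tau htau =>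
            D.postDensity_eq_gamma ha₁ ha₂ hb₁ hb₂ hlam htau η
    _ = ∫⁻ lam in Set.Ioi (0 : ℝ), ENNReal.ofReal (D.margConst a₁ a₂ b₁ b₂ η) *
        gammaPDF (D.shapeLam a₁) (D.rateLam b₁ η) lam := by
        refine lintegral_congr fun lam => ?_
        rw [lintegral_const_mul' _ _ ENNReal.ofReal_ne_top,
          lintegral_const_mul' (gammaPDF (D.shapeLam a₁) (D.rateLam b₁ η) lam) _
            ENNReal.ofReal_ne_top, lintegral_gammaPDF_Ioi hβ hB, mul_one]
    _ = _ := by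
        rw [lintegral_const_mul' _ _ ENNReal.ofReal_ne_top, lintegral_gammaPDF_Ioi hα hA, mul_one]

theorem condPrec_eq (ha₁ : 0 < a₁) (ha₂ : 0 < a₂) (hb₁ : 0 < b₁) (hb₂ : 0 < b₂)
    {lam tau : ℝ} (hlam : 0 < lam) (htau : 0 < tau) (η : D.State) :
    D.condPrec a₁ a₂ b₁ b₂ lam tau η =
      gammaPDF (D.shapeLam a₁) (D.rateLam b₁ η) lam *
        gammaPDF (D.shapeTau a₂) (D.rateTau b₂ η) tau := by
  rw [condPrec, D.postDensity_eq_gamma ha₁ ha₂ hb₁ hb₂ hlam htau, D.margDensity_eq ha₁ ha₂ hb₁ hb₂,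
    mul_comm, ENNReal.mul_div_cancel_right
      (ENNReal.ofReal_pos.2 (D.margConst_pos ha₁ ha₂ hb₁ hb₂ η)).ne' ENNReal.ofReal_ne_top]

/-- Normalising integral of the conditional density of `η` given the precisions. -/
def condMass (a₁ a₂ b₁ b₂ lam tau : ℝ) : ℝ≥0∞ :=
  ∫⁻ η : D.State, D.postDensity a₁ a₂ b₁ b₂ η lam tau

/-- Conditional mean of `g η` given the precisions. -/
def condMean (a₁ a₂ b₁ b₂ : ℝ) (g : D.State → ℝ≥0∞) (lam tau : ℝ) : ℝ≥0∞ :=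
  ∫⁻ η : D.State, D.condEta a₁ a₂ b₁ b₂ η lam tau * g η

theorem measurable_condMass : Measurable fun w : ℝ × ℝ => D.condMass a₁ a₂ b₁ b₂ w.1 w.2 :=
  measurable_lintegral_fst volume (D.postDensity a₁ a₂ b₁ b₂)
    (D.measurable_postDensity a₁ a₂ b₁ b₂)

theorem measurable_condEta :
    Measurable fun z : D.State × ℝ × ℝ => D.condEta a₁ a₂ b₁ b₂ z.1 z.2.1 z.2.2 :=
  (D.measurable_postDensity a₁ a₂ b₁ b₂).div (D.measurable_condMass.comp measurable_snd)

theorem measurable_condMean {g : D.State → ℝ≥0∞} (hg : Measurable g) :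
    Measurable fun w : ℝ × ℝ => D.condMean a₁ a₂ b₁ b₂ g w.1 w.2 := by
  have h : Measurable fun v : (ℝ × ℝ) × D.State =>
      D.condEta a₁ a₂ b₁ b₂ v.2 v.1.1 v.1.2 * g v.2 :=
    (D.measurable_condEta.comp (measurable_snd.prodMk measurable_fst)).mul (hg.comp measurable_snd)
  exact h.lintegral_prod_right'

theorem measurable_condPrec (η : D.State) :
    Measurable fun w : ℝ × ℝ => D.condPrec a₁ a₂ b₁ b₂ w.1 w.2 η :=
  (measurable_section (D.postDensity a₁ a₂ b₁ b₂)
    (D.measurable_postDensity a₁ a₂ b₁ b₂) η).div_const _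

/-- One step of the Gibbs chain: draw the precisions from their conditional Gamma laws, then draw
`η` given the precisions. -/
theorem lintegral_gibbsKernel (ha₁ : 0 < a₁) (ha₂ : 0 < a₂) (hb₁ : 0 < b₁) (hb₂ : 0 < b₂)
    (η : D.State) {g : D.State → ℝ≥0∞} (hg : Measurable g) :
    ∫⁻ η', g η' ∂(D.gibbsKernel a₁ a₂ b₁ b₂ η) =
      ∫⁻ lam, ∫⁻ tau, D.condMean a₁ a₂ b₁ b₂ g lam tau
        ∂(gammaMeasure (D.shapeTau a₂) (D.rateTau b₂ η))
        ∂(gammaMeasure (D.shapeLam a₁) (D.rateLam b₁ η)) := by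
  have hk : Measurable (D.transDensity a₁ a₂ b₁ b₂ η) :=
    (D.measurable_transDensity a₁ a₂ b₁ b₂).of_uncurry_left
  have hcm := D.measurable_condMean (a₁ := a₁) (a₂ := a₂) (b₁ := b₁) (b₂ := b₂) hg
  rw [D.gibbsKernel_apply, lintegral_withDensity_eq_lintegral_mul _ hk hg]
  have h1 : ∫⁻ η', (D.transDensity a₁ a₂ b₁ b₂ η * g) η' =
      ∫⁻ lam in Set.Ioi (0 : ℝ), ∫⁻ tau in Set.Ioi (0 : ℝ),
        D.condPrec a₁ a₂ b₁ b₂ lam tau η * D.condMean a₁ a₂ b₁ b₂ g lam tau :=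
    lintegral_mix_swap volume (D.condEta a₁ a₂ b₁ b₂)
      (fun lam tau => D.condPrec a₁ a₂ b₁ b₂ lam tau η) g D.measurable_condEta
      (D.measurable_condPrec η) hg
  rw [h1]
  exact lintegral_gammaMeasure_gammaMeasure (D.shapeTau_pos ha₂) (D.rateTau_pos hb₂ η) hcm
    (fun lam tau hlam htau => D.condPrec_eq ha₁ ha₂ hb₁ hb₂ hlam htau η)

/-- Mixtures over independent Gamma precisions whose rates are relatively close are close. -/
theorem lintegral_gamma_gamma_le (ha₁ : 0 < a₁) (ha₂ : 0 < a₂) (hα : 1 ≤ D.shapeLam a₁)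
    (hβ : 1 ≤ D.shapeTau a₂) {h : ℝ → ℝ → ℝ≥0∞}
    (hm : Measurable (Function.uncurry h)) (h1 : ∀ lam tau, h lam tau ≤ 1) {A A' B B' : ℝ}
    (hA : 0 < A) (hA' : 0 < A') (hB : 0 < B) (hB' : 0 < B') :
    ∫⁻ lam, ∫⁻ tau, h lam tau ∂(gammaMeasure (D.shapeTau a₂) B)
        ∂(gammaMeasure (D.shapeLam a₁) A) ≤
      ∫⁻ lam, ∫⁻ tau, h lam tau ∂(gammaMeasure (D.shapeTau a₂) B')
        ∂(gammaMeasure (D.shapeLam a₁) A') +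
        ENNReal.ofReal (3 * (√(D.shapeLam a₁) * |A - A'| / (A + A')) +
          3 * (√(D.shapeTau a₂) * |B - B'| / (B + B'))) := by
  have := isProbabilityMeasure_gammaMeasure (D.shapeTau_pos ha₂) hB
  have := isProbabilityMeasure_gammaMeasure (D.shapeTau_pos ha₂) hB'
  have := isProbabilityMeasure_gammaMeasure (D.shapeLam_pos ha₁) hA'
  calc _ ≤ ∫⁻ lam, ∫⁻ tau, h lam tau ∂(gammaMeasure (D.shapeTau a₂) B)
        ∂(gammaMeasure (D.shapeLam a₁) A') +
        ENNReal.ofReal (3 * (√(D.shapeLam a₁) * |A - A'| / (A + A'))) := by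
        refine lintegral_gammaMeasure_le hα hA hA' hm.lintegral_prod_right' fun lam => ?_
        calc _ ≤ ∫⁻ _, (1 : ℝ≥0∞) ∂(gammaMeasure (D.shapeTau a₂) B) :=
              lintegral_mono fun tau => h1 lam tau
          _ = 1 := by simp
    _ ≤ ∫⁻ lam, (∫⁻ tau, h lam tau ∂(gammaMeasure (D.shapeTau a₂) B') +
          ENNReal.ofReal (3 * (√(D.shapeTau a₂) * |B - B'| / (B + B'))))
        ∂(gammaMeasure (D.shapeLam a₁) A') +
        ENNReal.ofReal (3 * (√(D.shapeLam a₁) * |A - A'| / (A + A'))) := by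
        gcongr with lam
        exact lintegral_gammaMeasure_le hβ hB hB' hm.of_uncurry_left (h1 lam)
    _ = _ := by
        rw [lintegral_add_right _ measurable_const, lintegral_const, measure_univ, mul_one,
          add_assoc, ← ENNReal.ofReal_add (by positivity) (by positivity),
          add_comm (3 * (√(D.shapeTau a₂) * _ / _))]

end MixedModelData

end Posterior

/-! ### Linear coordinates and least squares -/

noncomputable section Coordinates

/-- Least squares: `‖y - M z‖²` is its minimum plus a squared seminorm. -/
theorem exists_leastSquares {E F : Type*} [NormedAddCommGroup E] [NormedSpace ℝ E]
    [FiniteDimensional ℝ E] [NormedAddCommGroup F] [InnerProductSpace ℝ F] (M : E →L[ℝ] F) (y : F) :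
    ∃ c : E, ∀ z, ‖y - M z‖ ^ 2 = ‖y - M c‖ ^ 2 + ‖M (z - c)‖ ^ 2 := by
  let K : Submodule ℝ F := LinearMap.range (M : E →ₗ[ℝ] F)
  have : FiniteDimensional ℝ K := inferInstance
  obtain ⟨c, hc⟩ : K.starProjection y ∈ K := K.starProjection_apply_mem y
  refine ⟨c, fun z => ?_⟩
  have hc' : M c = K.starProjection y := hc
  have horth : inner ℝ (y - M c) (M (z - c)) = 0 := by
    rw [hc']
    exact K.starProjection_inner_eq_zero y _ ⟨z - c, rfl⟩
  have e : y - M z = (y - M c) - M (z - c) := by rw [map_sub]; abel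
  rw [e, norm_sub_sq_real, horth]
  ring

namespace MixedModelData

variable {q : ℕ} (D : MixedModelData q)

/-- The coordinates other than `η₀`: the pair `(η₀₀, u)` of the fixed part and the effects. -/
abbrev Core : Type := EuclideanSpace ℝ (Fin D.p ⊕ Fin q)

/-- The space of responses with its Euclidean norm. -/
abbrev Obs : Type := EuclideanSpace ℝ (Σ i : Fin q, Fin (D.r i))

/-- The vector of responses. -/
def obsY : D.Obs := WithLp.toLp 2 fun o => D.y o.1 o.2

/-- Linear predictor `x i jᵀ β + u i` as a function of `(η₀₀, u)`. -/
def predMap : D.Core →L[ℝ] D.Obs :=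
  LinearMap.toContinuousLinearMap
    { toFun := fun z => WithLp.toLp 2 fun o =>
        D.x o.1 o.2 ⬝ᵥ ((√(q : ℝ))⁻¹ • fun k => z (Sum.inl k)) + z (Sum.inr o.1)
      map_add' := fun z w => by
        ext o
        simp only [dotProduct, Pi.smul_apply, smul_eq_mul, PiLp.add_apply, mul_add,
          Finset.sum_add_distrib]
        ring
      map_smul' := fun c z => by
        ext o
        simp only [dotProduct, Pi.smul_apply, smul_eq_mul, PiLp.smul_apply, RingHom.id_apply,
          mul_add, Finset.mul_sum]
        congr 1
        exact Finset.sum_congr rfl fun k _ => by ring }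

/-- Mean of the effects. -/
def effMean (z : D.Core) : ℝ := (q : ℝ)⁻¹ * ∑ i, z (Sum.inr i)

/-- Centred effects. -/
def centMap : D.Core →L[ℝ] EuclideanSpace ℝ (Fin q) :=
  LinearMap.toContinuousLinearMap
    { toFun := fun z => WithLp.toLp 2 fun i => z (Sum.inr i) - D.effMean z
      map_add' := fun z w => by
        ext i
        simp only [effMean, PiLp.add_apply, Finset.sum_add_distrib]
        ring
      map_smul' := fun c z => by
        ext i
        simp only [effMean, PiLp.smul_apply, smul_eq_mul, RingHom.id_apply, ← Finset.mul_sum]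
        ring }

theorem centMap_apply (z : D.Core) (i : Fin q) : D.centMap z i = z (Sum.inr i) - D.effMean z := rfl

/-- The core coordinates of a state. -/
def coreOf (η : D.State) : D.Core :=
  WithLp.toLp 2 (Sum.elim (fun k => η (Sum.inl k)) fun i => η (Sum.inr (Sum.inr i)))

/-- Deviation of `η₀` from `√q` times the mean of the effects. -/
def devOf (η : D.State) : ℝ := η (Sum.inr (Sum.inl ())) - √(q : ℝ) * D.effMean (D.coreOf η)

/-- Linear change of coordinates `(η₀₀, u, η₀ - √q ū) ↦ η`, in which the conditional law of `η`
given the precisions is a product of Gaussian laws. -/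
def coord : (D.Core × ℝ) ≃L[ℝ] D.State :=
  LinearEquiv.toContinuousLinearEquiv
    { toFun := fun w => WithLp.toLp 2 (Sum.elim (fun k => w.1 (Sum.inl k))
        (Sum.elim (fun _ => w.2 + √(q : ℝ) * D.effMean w.1) fun i => w.1 (Sum.inr i)))
      map_add' := fun z w => by
        ext k
        rcases k with k | k | k
        · simp
        · simp only [effMean, PiLp.add_apply, Finset.sum_add_distrib, Sum.elim_inr, Sum.elim_inl,
            Prod.fst_add, Prod.snd_add]
          ring
        · simp
      map_smul' := fun c z => by
        ext k
        rcases k with k | k | k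
        · simp
        · simp only [effMean, PiLp.smul_apply, smul_eq_mul, RingHom.id_apply, ← Finset.mul_sum,
            Sum.elim_inr, Sum.elim_inl, Prod.smul_fst, Prod.smul_snd]
          ring
        · simp
      invFun := fun η => (D.coreOf η, D.devOf η)
      left_inv := fun w => by
        refine Prod.ext ?_ ?_
        · ext k
          rcases k with k | k <;> simp [coreOf]
        · simp [devOf, coreOf, effMean]
      right_inv := fun η => by
        ext k
        rcases k with k | k | k <;> simp [coreOf, devOf] }

theorem coreOf_coord (w : D.Core × ℝ) : D.coreOf (D.coord w) = w.1 :=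
  congrArg Prod.fst (D.coord.symm_apply_apply w)

theorem devOf_coord (w : D.Core × ℝ) : D.devOf (D.coord w) = w.2 :=
  congrArg Prod.snd (D.coord.symm_apply_apply w)

theorem continuous_coreOf : Continuous D.coreOf :=
  continuous_fst.comp D.coord.symm.continuous

theorem continuous_devOf : Continuous D.devOf :=
  continuous_snd.comp D.coord.symm.continuous

theorem resSq_eq_norm (η : D.State) : D.resSq η = ‖D.obsY - D.predMap (D.coreOf η)‖ ^ 2 := by
  rw [EuclideanSpace.real_norm_sq_eq, Fintype.sum_sigma]
  rfl

/-- The sum of squares of the effects splits into the part around their mean and the deviation of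
their mean from `μ`. -/
theorem effSq_eq_norm (hq : 0 < q) (η : D.State) :
    D.effSq η = ‖D.centMap (D.coreOf η)‖ ^ 2 + D.devOf η ^ 2 := by
  have hq' : (0 : ℝ) < q := by exact_mod_cast hq
  have hs : √(q : ℝ) ≠ 0 := (Real.sqrt_pos.2 hq').ne'
  have hs2 : √(q : ℝ) ^ 2 = q := Real.sq_sqrt hq'.le
  rw [EuclideanSpace.real_norm_sq_eq]
  set z := D.coreOf η with hz
  set m := D.effMean z with hm
  set v := D.devOf η with hv
  have hmean : η.meanPart / √(q : ℝ) = m + v / √(q : ℝ) := by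
    have : η.meanPart = v + √(q : ℝ) * m := by
      rw [hv, devOf, ← hz, ← hm]
      simp [State.meanPart]
    rw [this]
    field_simp
    ring
  have hsum : ∑ i, (z (Sum.inr i) - m) = 0 := by
    rw [Finset.sum_sub_distrib, Finset.sum_const, Finset.card_univ, Fintype.card_fin, hm, effMean,
      nsmul_eq_mul, mul_inv_cancel_left₀ hq'.ne', sub_self]
  have heff : ∀ i, η.effect i = z (Sum.inr i) := fun i => rfl
  unfold effSq
  simp only [hmean, heff, centMap_apply, ← hm]
  set t := v / √(q : ℝ) with ht
  have e : ∀ i, (z (Sum.inr i) - (m + t)) ^ 2 =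
      (z (Sum.inr i) - m) ^ 2 - 2 * t * (z (Sum.inr i) - m) + t ^ 2 := fun i => by ring
  have ht2 : (q : ℝ) * t ^ 2 = v ^ 2 := by
    rw [ht, div_pow, hs2]
    field_simp
  rw [Finset.sum_congr rfl fun i _ => e i, Finset.sum_add_distrib, Finset.sum_sub_distrib,
    ← Finset.mul_sum, hsum, Finset.sum_const, Finset.card_univ, Fintype.card_fin, nsmul_eq_mul, ht2]
  ring

/-- A least squares estimate of `(η₀₀, u)`. -/
def lsq : D.Core := (exists_leastSquares D.predMap D.obsY).choose

theorem norm_sub_predMap_sq (z : D.Core) :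
    ‖D.obsY - D.predMap z‖ ^ 2 =
      ‖D.obsY - D.predMap D.lsq‖ ^ 2 + ‖D.predMap (z - D.lsq)‖ ^ 2 :=
  (exists_leastSquares D.predMap D.obsY).choose_spec z

/-- Rate of the law of `tau` at the least squares estimate: the smallest value of `rateTau`. -/
def optTau (b₂ : ℝ) : ℝ := b₂ + ‖D.obsY - D.predMap D.lsq‖ ^ 2 / 2

/-- Rate of the law of `lam` at the least squares estimate. -/
def optLam (b₁ : ℝ) : ℝ := b₁ + ‖D.centMap D.lsq‖ ^ 2 / 2

variable {b₁ b₂ : ℝ}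

theorem rateTau_eq (b₂ : ℝ) (η : D.State) :
    D.rateTau b₂ η = D.optTau b₂ + ‖D.predMap (D.coreOf η - D.lsq)‖ ^ 2 / 2 := by
  rw [rateTau, resSq_eq_norm, norm_sub_predMap_sq, optTau]
  ring

theorem rateLam_eq (hq : 0 < q) (b₁ : ℝ) (η : D.State) :
    D.rateLam b₁ η = b₁ + ‖D.centMap (D.coreOf η)‖ ^ 2 / 2 + D.devOf η ^ 2 / 2 := by
  rw [rateLam, effSq_eq_norm D hq]
  ring

/-- Lebesgue measure in the linear coordinates, up to the constant Jacobian. -/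
theorem exists_lintegral_eq_coord :
    ∃ κ : ℝ≥0∞, κ ≠ 0 ∧ κ ≠ ∞ ∧ ∀ f : D.State → ℝ≥0∞, Measurable f →
      ∫⁻ η, f η = κ * ∫⁻ w : D.Core × ℝ, f (D.coord w) := by
  have : (volume : Measure (D.Core × ℝ)).IsAddHaarMeasure :=
    (inferInstance : ((volume : Measure D.Core).prod (volume : Measure ℝ)).IsAddHaarMeasure)
  have : ((volume : Measure (D.Core × ℝ)).map D.coord).IsAddHaarMeasure :=
    ContinuousLinearEquiv.isAddHaarMeasure_map D.coord _
  refine ⟨Measure.addHaarScalarFactor volume ((volume : Measure (D.Core × ℝ)).map D.coord), ?_, ?_,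
    fun f hf => ?_⟩
  · exact_mod_cast (Measure.addHaarScalarFactor_pos_of_isAddHaarMeasure _ _).ne'
  · exact ENNReal.coe_ne_top
  · rw [← lintegral_map hf D.coord.continuous.measurable]
    conv_lhs => rw [Measure.isAddLeftInvariant_eq_smul volume
      ((volume : Measure (D.Core × ℝ)).map D.coord)]
    rw [lintegral_smul_measure]
    rfl

end MixedModelData

end Coordinates

/-! ### The conditional law of the coefficients given the precisions -/

noncomputable section Gibbs

namespace MixedModelData

variable {q : ℕ} (D : MixedModelData q) {a₁ a₂ b₁ b₂ : ℝ}

/-- The part of the posterior density that depends on the precisions only. -/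
def precFactor (a₁ a₂ b₁ b₂ lam tau : ℝ) : ℝ :=
  D.postConst a₁ a₂ b₁ b₂ * (lam ^ (D.shapeLam a₁ - 1) * Real.exp (-(b₁ * lam))) *
    (tau ^ (D.shapeTau a₂ - 1) * Real.exp (-(D.optTau b₂ * tau)))

theorem precFactor_pos (ha₁ : 0 < a₁) (ha₂ : 0 < a₂) (hb₁ : 0 < b₁) (hb₂ : 0 < b₂) {lam tau : ℝ}
    (hlam : 0 < lam) (htau : 0 < tau) : 0 < D.precFactor a₁ a₂ b₁ b₂ lam tau := by
  have := D.postConst_pos ha₁ ha₂ hb₁ hb₂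
  unfold precFactor
  positivity

theorem optTau_pos (hb₂ : 0 < b₂) : 0 < D.optTau b₂ := by
  unfold optTau
  positivity

theorem optLam_pos (hb₁ : 0 < b₁) : 0 < D.optLam b₁ := by
  unfold optLam
  positivity

/-- Given the precisions, the law of `η` is Gaussian with independent coordinates
`(η₀₀, u)` and `η₀ - √q ū`. -/
theorem postDensity_coord_aux (hq : 0 < q) (ha₁ : 0 < a₁) (ha₂ : 0 < a₂) (hb₁ : 0 < b₁) (hb₂ : 0 < b₂)
    {lam tau : ℝ} (hlam : 0 < lam) (htau : 0 < tau) (w : D.Core × ℝ) :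
    D.postDensity a₁ a₂ b₁ b₂ (D.coord w) lam tau =
      ENNReal.ofReal (D.precFactor a₁ a₂ b₁ b₂ lam tau) *
        pairWeight D.predMap D.centMap D.lsq lam tau w := by
  have hp := (D.precFactor_pos ha₁ ha₂ hb₁ hb₂ hlam htau).le
  rw [D.postDensity_eq_exp ha₁ hb₁ hlam htau, pairWeight, ← ENNReal.ofReal_mul (Real.exp_nonneg _),
    ← ENNReal.ofReal_mul hp]
  congr 1
  rw [rateTau_eq, rateLam_eq D hq, coreOf_coord, devOf_coord, precFactor, quadEnergy]
  have e : Real.exp (-((b₁ + ‖D.centMap w.1‖ ^ 2 / 2 + w.2 ^ 2 / 2) * lam)) *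
      Real.exp (-((D.optTau b₂ + ‖D.predMap (w.1 - D.lsq)‖ ^ 2 / 2) * tau)) =
      Real.exp (-(b₁ * lam)) * Real.exp (-(D.optTau b₂ * tau)) *
      (Real.exp (-((tau * ‖D.predMap (w.1 - D.lsq)‖ ^ 2 + lam * ‖D.centMap w.1‖ ^ 2) / 2)) *
        Real.exp (-(lam * w.2 ^ 2 / 2))) := by
    rw [← Real.exp_add, ← Real.exp_add, ← Real.exp_add, ← Real.exp_add]
    congr 1
    ring
  linear_combination (D.postConst a₁ a₂ b₁ b₂ * lam ^ (D.shapeLam a₁ - 1) *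
    tau ^ (D.shapeTau a₂ - 1)) * e

theorem finrank_core : Module.finrank ℝ D.Core = D.p + q := by
  rw [finrank_euclideanSpace, Fintype.card_sum, Fintype.card_fin, Fintype.card_fin]

theorem measurable_postDensity_left (lam tau : ℝ) :
    Measurable fun η : D.State => D.postDensity a₁ a₂ b₁ b₂ η lam tau :=
  (D.measurable_postDensity a₁ a₂ b₁ b₂).comp
    (f := fun η : D.State => (η, lam, tau)) (measurable_id.prodMk measurable_const)

/-- Standing assumptions on the data and the hyperparameters: there is at least one group, the
linear predictor determines `(η₀₀, u)` with constant `κ`, and there are at least as many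
observations as coefficients. -/
structure Regular (a₁ a₂ b₁ b₂ κ : ℝ) : Prop where
  hq : 0 < q
  ha₁ : 0 < a₁
  ha₂ : 0 < a₂
  hb₁ : 0 < b₁
  hb₂ : 0 < b₂
  hκ : 0 < κ
  hM : ∀ z, κ * ‖z‖ ^ 2 ≤ ‖D.predMap z‖ ^ 2
  hN : D.p + q ≤ D.total

namespace Regular

variable {D} {κ : ℝ} (H : D.Regular a₁ a₂ b₁ b₂ κ)

section
include H

theorem postDensity_coord {lam tau : ℝ} (hlam : 0 < lam) (htau : 0 < tau) (w : D.Core × ℝ) :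
    D.postDensity a₁ a₂ b₁ b₂ (D.coord w) lam tau =
      ENNReal.ofReal (D.precFactor a₁ a₂ b₁ b₂ lam tau) *
        pairWeight D.predMap D.centMap D.lsq lam tau w :=
  D.postDensity_coord_aux H.hq H.ha₁ H.ha₂ H.hb₁ H.hb₂ hlam htau w

theorem precFactor_pos {lam tau : ℝ} (hlam : 0 < lam) (htau : 0 < tau) :
    0 < D.precFactor a₁ a₂ b₁ b₂ lam tau :=
  MixedModelData.precFactor_pos D H.ha₁ H.ha₂ H.hb₁ H.hb₂ hlam htau

theorem rateLam_pos (η : D.State) : 0 < D.rateLam b₁ η := D.rateLam_pos H.hb₁ η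

theorem rateTau_pos (η : D.State) : 0 < D.rateTau b₂ η := D.rateTau_pos H.hb₂ η

theorem shapeLam_pos : 0 < D.shapeLam a₁ := D.shapeLam_pos H.ha₁

theorem shapeTau_pos : 0 < D.shapeTau a₂ := D.shapeTau_pos H.ha₂

theorem condMass_ne_zero {lam tau : ℝ} (hlam : 0 < lam) (htau : 0 < tau) :
    D.condMass a₁ a₂ b₁ b₂ lam tau ≠ 0 := by
  obtain ⟨J, hJ0, hJ, hint⟩ := D.exists_lintegral_eq_coord
  rw [condMass, hint _ (D.measurable_postDensity_left lam tau)]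
  simp only [H.postDensity_coord hlam htau]
  rw [lintegral_const_mul' _ _ ENNReal.ofReal_ne_top]
  refine mul_ne_zero hJ0 (mul_ne_zero ?_ (lintegral_pairWeight_pos _ _ _ _ _).ne')
  exact (ENNReal.ofReal_pos.2 (H.precFactor_pos hlam htau)).ne'

/-- The conditional mass of `η` in terms of the precisions, up to a constant. -/
theorem exists_condMass_le : ∃ C : ℝ≥0∞, C ≠ ∞ ∧ ∀ {lam tau : ℝ}, 0 < lam → 0 < tau →
    D.condMass a₁ a₂ b₁ b₂ lam tau ≤
      C * (ENNReal.ofReal (D.precFactor a₁ a₂ b₁ b₂ lam tau) *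
        (ENNReal.ofReal ((Real.pi / (tau * κ / 2)) ^ ((D.p + q : ℕ) / 2 : ℝ)) *
          ENNReal.ofReal ((Real.pi / (lam / 2)) ^ (1 / 2 : ℝ)))) := by
  obtain ⟨J, hJ0, hJ, hint⟩ := D.exists_lintegral_eq_coord
  refine ⟨J, hJ, fun {lam tau} hlam htau => ?_⟩
  rw [condMass, hint _ (D.measurable_postDensity_left lam tau)]
  simp only [H.postDensity_coord hlam htau]
  rw [lintegral_const_mul' _ _ ENNReal.ofReal_ne_top]
  have h := lintegral_pairWeight_le D.predMap D.centMap D.lsq hlam htau H.hκ H.hM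
  rw [D.finrank_core] at h
  gcongr

theorem condMass_ne_top {lam tau : ℝ} (hlam : 0 < lam) (htau : 0 < tau) :
    D.condMass a₁ a₂ b₁ b₂ lam tau ≠ ∞ := by
  obtain ⟨C, hC, h⟩ := H.exists_condMass_le
  refine ne_top_of_le_ne_top ?_ (h hlam htau)
  finiteness

/-- A bound on the mean of `g` under the Gaussian weight bounds its conditional mean. -/
theorem condMean_le {g : D.State → ℝ≥0∞} (hg : Measurable g) {lam tau : ℝ} (hlam : 0 < lam)
    (htau : 0 < tau) {c : ℝ≥0∞}
    (h : ∫⁻ w, g (D.coord w) * pairWeight D.predMap D.centMap D.lsq lam tau w ≤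
      c * ∫⁻ w, pairWeight D.predMap D.centMap D.lsq lam tau w) :
    D.condMean a₁ a₂ b₁ b₂ g lam tau ≤ c := by
  obtain ⟨J, hJ0, hJ, hint⟩ := D.exists_lintegral_eq_coord
  have hm := D.measurable_postDensity_left (a₁ := a₁) (a₂ := a₂) (b₁ := b₁) (b₂ := b₂) lam tau
  have h0 := H.condMass_ne_zero hlam htau
  have ht := H.condMass_ne_top hlam htau
  have e1 : D.condMean a₁ a₂ b₁ b₂ g lam tau =
      (∫⁻ η, D.postDensity a₁ a₂ b₁ b₂ η lam tau * g η) * (D.condMass a₁ a₂ b₁ b₂ lam tau)⁻¹ := by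
    rw [condMean, ← lintegral_mul_const' _ _ (ENNReal.inv_ne_top.2 h0)]
    refine lintegral_congr fun η => ?_
    rw [condEta, ← condMass, ENNReal.div_eq_inv_mul]
    ring
  have e2 : ∫⁻ η, D.postDensity a₁ a₂ b₁ b₂ η lam tau * g η ≤
      c * D.condMass a₁ a₂ b₁ b₂ lam tau := by
    rw [condMass, hint (fun η => D.postDensity a₁ a₂ b₁ b₂ η lam tau * g η) (hm.mul hg), hint _ hm]
    simp only [H.postDensity_coord hlam htau, mul_assoc]
    rw [lintegral_const_mul' _ _ ENNReal.ofReal_ne_top, lintegral_const_mul' _ _ ENNReal.ofReal_ne_top]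
    calc _ ≤ J * (ENNReal.ofReal (D.precFactor a₁ a₂ b₁ b₂ lam tau) *
          (c * ∫⁻ w, pairWeight D.predMap D.centMap D.lsq lam tau w)) := by
          simp only [mul_comm (pairWeight _ _ _ _ _ _)]
          gcongr
      _ = _ := by ring
  rw [e1]
  calc _ ≤ c * D.condMass a₁ a₂ b₁ b₂ lam tau * (D.condMass a₁ a₂ b₁ b₂ lam tau)⁻¹ := by gcongr
    _ = c := by rw [mul_assoc, ENNReal.mul_inv_cancel h0 ht, mul_one]

theorem condMean_one {lam tau : ℝ} (hlam : 0 < lam) (htau : 0 < tau) :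
    D.condMean a₁ a₂ b₁ b₂ (fun _ => 1) lam tau = 1 := by
  have h0 := H.condMass_ne_zero hlam htau
  have ht := H.condMass_ne_top hlam htau
  have e : ∀ η, D.condEta a₁ a₂ b₁ b₂ η lam tau * 1 =
      (D.condMass a₁ a₂ b₁ b₂ lam tau)⁻¹ * D.postDensity a₁ a₂ b₁ b₂ η lam tau := fun η => by
    rw [mul_one, condEta, ← condMass, ENNReal.div_eq_inv_mul]
  simp only [condMean, e]
  rw [lintegral_const_mul' _ _ (ENNReal.inv_ne_top.2 h0), ← condMass, ENNReal.inv_mul_cancel h0 ht]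

end

end Regular

end MixedModelData

end Gibbs

/-! ### Properness, reversibility and one-step moments -/

noncomputable section GibbsChain

theorem gammaMeasure_ae_pos (a r : ℝ) : ∀ᵐ x ∂(gammaMeasure a r), 0 < x := by
  rw [gammaMeasure_eq_restrict]
  exact (withDensity_absolutelyContinuous _ _).ae_le (ae_restrict_mem measurableSet_Ioi)

/-- Mixing over two Gamma laws only involves positive arguments. -/
theorem lintegral_gamma_gamma_mono {a b a' b' : ℝ} {f g : ℝ → ℝ → ℝ≥0∞}
    (h : ∀ s t, 0 < s → 0 < t → f s t ≤ g s t) :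
    ∫⁻ s, ∫⁻ t, f s t ∂(gammaMeasure a' b') ∂(gammaMeasure a b) ≤
      ∫⁻ s, ∫⁻ t, g s t ∂(gammaMeasure a' b') ∂(gammaMeasure a b) := by
  refine lintegral_mono_ae ?_
  filter_upwards [gammaMeasure_ae_pos a b] with s hs
  refine lintegral_mono_ae ?_
  filter_upwards [gammaMeasure_ae_pos a' b'] with t ht
  exact h s t hs ht

theorem lintegral_Ioi_rpow_mul_exp_ne_top {s b : ℝ} (hs : 0 < s) (hb : 0 < b) :
    ∫⁻ x in Set.Ioi (0 : ℝ), ENNReal.ofReal (x ^ (s - 1) * Real.exp (-(b * x))) ≠ ∞ := by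
  have hG := Real.Gamma_pos_of_pos hs
  have hbs := Real.rpow_pos_of_pos hb s
  have e : ∀ x ∈ Set.Ioi (0 : ℝ), ENNReal.ofReal (x ^ (s - 1) * Real.exp (-(b * x))) =
      ENNReal.ofReal (Real.Gamma s / b ^ s) * gammaPDF s b x := fun x hx => by
    rw [gammaPDF, gammaPDFReal_of_pos hx, ← ENNReal.ofReal_mul (by positivity)]
    congr 1
    field_simp
  rw [setLIntegral_congr_fun measurableSet_Ioi e, lintegral_const_mul' _ _ ENNReal.ofReal_ne_top,
    lintegral_gammaPDF_Ioi hs hb, mul_one]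
  exact ENNReal.ofReal_ne_top

namespace MixedModelData

namespace Regular

variable {q : ℕ} {D : MixedModelData q} {a₁ a₂ b₁ b₂ κ : ℝ}
  (H : D.Regular a₁ a₂ b₁ b₂ κ)

section
include H

theorem isMarkovKernel : IsMarkovKernel (D.gibbsKernel a₁ a₂ b₁ b₂) := by
  refine ⟨fun η => ⟨?_⟩⟩
  have := isProbabilityMeasure_gammaMeasure H.shapeLam_pos (H.rateLam_pos η)
  have := isProbabilityMeasure_gammaMeasure H.shapeTau_pos (H.rateTau_pos η)
  rw [← lintegral_one, D.lintegral_gibbsKernel H.ha₁ H.ha₂ H.hb₁ H.hb₂ η measurable_const]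
  have e : ∫⁻ _, ∫⁻ _, (1 : ℝ≥0∞) ∂(gammaMeasure (D.shapeTau a₂) (D.rateTau b₂ η))
      ∂(gammaMeasure (D.shapeLam a₁) (D.rateLam b₁ η)) = 1 := by simp
  refine le_antisymm ?_ ?_
  · refine (lintegral_gamma_gamma_mono fun s t hs ht => (H.condMean_one hs ht).le).trans e.le
  · exact e.ge.trans (lintegral_gamma_gamma_mono fun s t hs ht => (H.condMean_one hs ht).ge)

theorem lintegral_margDensity_ne_top : ∫⁻ η, D.margDensity a₁ a₂ b₁ b₂ η ≠ ∞ := by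
  have hsw := lintegral_mix_swap (volume : Measure D.State) (D.postDensity a₁ a₂ b₁ b₂)
    (fun _ _ => 1) (fun _ => 1) (D.measurable_postDensity a₁ a₂ b₁ b₂) measurable_const
    measurable_const
  simp only [mul_one, one_mul] at hsw
  change ∫⁻ η, D.margDensity a₁ a₂ b₁ b₂ η = _ at hsw
  rw [hsw]
  obtain ⟨C, hC, h⟩ := H.exists_condMass_le
  set d : ℝ := ((D.p + q : ℕ) : ℝ) with hd
  have hN : d ≤ D.total := by
    rw [hd]
    exact_mod_cast H.hN
  have hq : (1 : ℝ) ≤ q := by exact_mod_cast H.hq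
  have hs : 0 < D.shapeLam a₁ - 1 / 2 := by
    have := H.ha₁
    unfold shapeLam
    linarith
  have hs' : 0 < D.shapeTau a₂ - d / 2 := by
    have := H.ha₂
    unfold shapeTau
    linarith
  have hI := lintegral_Ioi_rpow_mul_exp_ne_top hs H.hb₁
  have hI' := lintegral_Ioi_rpow_mul_exp_ne_top hs' (D.optTau_pos H.hb₂)
  have hpc := D.postConst_pos H.ha₁ H.ha₂ H.hb₁ H.hb₂
  have hκ := H.hκ
  have hpi := Real.pi_pos
  set P := D.postConst a₁ a₂ b₁ b₂ * (2 * Real.pi / κ) ^ (d / 2) * (2 * Real.pi) ^ (1 / 2 : ℝ)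
  set f : ℝ → ℝ≥0∞ := fun lam =>
    ENNReal.ofReal (lam ^ (D.shapeLam a₁ - 1 / 2 - 1) * Real.exp (-(b₁ * lam)))
  set g : ℝ → ℝ≥0∞ := fun tau =>
    ENNReal.ofReal (tau ^ (D.shapeTau a₂ - d / 2 - 1) * Real.exp (-(D.optTau b₂ * tau)))
  have hle : ∀ lam ∈ Set.Ioi (0 : ℝ), ∀ tau ∈ Set.Ioi (0 : ℝ),
      D.condMass a₁ a₂ b₁ b₂ lam tau ≤ C * ENNReal.ofReal P * f lam * g tau := by
    intro lam hlam tau htau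
    rw [Set.mem_Ioi] at hlam htau
    refine (h hlam htau).trans (le_of_eq ?_)
    have h1 : 0 ≤ lam ^ (D.shapeLam a₁ - 1 / 2 - 1) * Real.exp (-(b₁ * lam)) := by positivity
    have h2 : 0 ≤ (Real.pi / (tau * κ / 2)) ^ (d / 2) := by positivity
    have h3 := (H.precFactor_pos hlam htau).le
    have h4 : 0 ≤ P := by positivity
    rw [mul_assoc C, mul_assoc C, ← ENNReal.ofReal_mul h4, ← ENNReal.ofReal_mul (mul_nonneg h4 h1),
      ← ENNReal.ofReal_mul h2, ← ENNReal.ofReal_mul h3]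
    congr 2
    have e1 : (Real.pi / (tau * κ / 2)) ^ (d / 2) = (2 * Real.pi / κ) ^ (d / 2) * tau ^ (-(d / 2)) := by
      rw [Real.rpow_neg htau.le, ← Real.inv_rpow htau.le, ← Real.mul_rpow (by positivity) (by positivity)]
      congr 1
      field_simp
    have e2 : (Real.pi / (lam / 2)) ^ (1 / 2 : ℝ) = (2 * Real.pi) ^ (1 / 2 : ℝ) * lam ^ (-(1 / 2) : ℝ) := by
      rw [Real.rpow_neg hlam.le, ← Real.inv_rpow hlam.le, ← Real.mul_rpow (by positivity) (by positivity)]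
      congr 1
      field_simp
    have e3 : lam ^ (D.shapeLam a₁ - 1 / 2 - 1) = lam ^ (D.shapeLam a₁ - 1) * lam ^ (-(1 / 2) : ℝ) := by
      rw [← Real.rpow_add hlam]
      congr 1
      ring
    have e4 : tau ^ (D.shapeTau a₂ - d / 2 - 1) = tau ^ (D.shapeTau a₂ - 1) * tau ^ (-(d / 2)) := by
      rw [← Real.rpow_add htau]
      congr 1
      ring
    rw [e1, e2, e3, e4, precFactor]
    ring
  refine ne_top_of_le_ne_top ?_ (setLIntegral_mono' measurableSet_Ioi fun lam hlam =>
    setLIntegral_mono' measurableSet_Ioi fun tau htau => hle lam hlam tau htau)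
  have hfm : Measurable f := by fun_prop
  have hgm : Measurable g := by fun_prop
  have e : ∀ lam, ∫⁻ tau in Set.Ioi (0 : ℝ), C * ENNReal.ofReal P * f lam * g tau =
      C * ENNReal.ofReal P * f lam * ∫⁻ tau in Set.Ioi (0 : ℝ), g tau := fun lam =>
    lintegral_const_mul _ hgm
  simp only [e]
  rw [lintegral_mul_const _ (hfm.const_mul _), lintegral_const_mul _ hfm]
  exact ENNReal.mul_ne_top (ENNReal.mul_ne_top (ENNReal.mul_ne_top hC ENNReal.ofReal_ne_top) hI) hI'

theorem lintegral_margDensity_ne_zero : ∫⁻ η, D.margDensity a₁ a₂ b₁ b₂ η ≠ 0 := by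
  rw [← pos_iff_ne_zero, lintegral_pos_iff_support (D.measurable_margDensity a₁ a₂ b₁ b₂)]
  have : Function.support (D.margDensity a₁ a₂ b₁ b₂) = Set.univ := by
    refine Set.eq_univ_of_forall fun η => ?_
    rw [Function.mem_support, D.margDensity_eq H.ha₁ H.ha₂ H.hb₁ H.hb₂]
    exact (ENNReal.ofReal_pos.2 (D.margConst_pos H.ha₁ H.ha₂ H.hb₁ H.hb₂ η)).ne'
  rw [this]
  exact isOpen_univ.measure_pos volume Set.univ_nonempty

theorem isProbabilityMeasure_posterior : IsProbabilityMeasure (D.posterior a₁ a₂ b₁ b₂) := by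
  refine ⟨?_⟩
  rw [posterior, withDensity_apply _ MeasurableSet.univ, Measure.restrict_univ]
  simp only [div_eq_mul_inv]
  rw [lintegral_mul_const' _ _ (ENNReal.inv_ne_top.2 H.lintegral_margDensity_ne_zero),
    ENNReal.mul_inv_cancel H.lintegral_margDensity_ne_zero H.lintegral_margDensity_ne_top]

/-- Detailed balance. -/
theorem margDensity_mul_transDensity (η η' : D.State) :
    D.margDensity a₁ a₂ b₁ b₂ η * D.transDensity a₁ a₂ b₁ b₂ η η' =
      D.margDensity a₁ a₂ b₁ b₂ η' * D.transDensity a₁ a₂ b₁ b₂ η' η := by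
  have key : ∀ x y : D.State, D.margDensity a₁ a₂ b₁ b₂ x * D.transDensity a₁ a₂ b₁ b₂ x y =
      ∫⁻ lam in Set.Ioi (0 : ℝ), ∫⁻ tau in Set.Ioi (0 : ℝ),
        D.postDensity a₁ a₂ b₁ b₂ y lam tau * D.postDensity a₁ a₂ b₁ b₂ x lam tau /
          D.condMass a₁ a₂ b₁ b₂ lam tau := fun x y => by
    have hm0 : D.margDensity a₁ a₂ b₁ b₂ x ≠ 0 := by
      rw [D.margDensity_eq H.ha₁ H.ha₂ H.hb₁ H.hb₂]
      exact (ENNReal.ofReal_pos.2 (D.margConst_pos H.ha₁ H.ha₂ H.hb₁ H.hb₂ x)).ne'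
    have hmt : D.margDensity a₁ a₂ b₁ b₂ x ≠ ∞ := by
      rw [D.margDensity_eq H.ha₁ H.ha₂ H.hb₁ H.hb₂]
      exact ENNReal.ofReal_ne_top
    rw [transDensity, ← lintegral_const_mul' _ _ hmt]
    refine lintegral_congr fun lam => ?_
    rw [← lintegral_const_mul' _ _ hmt]
    refine lintegral_congr fun tau => ?_
    rw [condEta, condPrec, ← condMass]
    simp only [div_eq_mul_inv]
    calc _ = D.postDensity a₁ a₂ b₁ b₂ y lam tau * D.postDensity a₁ a₂ b₁ b₂ x lam tau *
          (D.condMass a₁ a₂ b₁ b₂ lam tau)⁻¹ *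
          (D.margDensity a₁ a₂ b₁ b₂ x * (D.margDensity a₁ a₂ b₁ b₂ x)⁻¹) := by ring
      _ = _ := by rw [ENNReal.mul_inv_cancel hm0 hmt, mul_one]
  rw [key, key]
  refine lintegral_congr fun lam => lintegral_congr fun tau => ?_
  rw [mul_comm (D.postDensity _ _ _ _ η' lam tau)]

theorem invariant :
    (D.gibbsKernel a₁ a₂ b₁ b₂).Invariant (D.posterior a₁ a₂ b₁ b₂) := by
  have := H.isMarkovKernel
  refine Kernel.IsReversible.invariant fun A B hA hB => ?_
  set Z := ∫⁻ η : D.State, D.margDensity a₁ a₂ b₁ b₂ η with hZ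
  have hmm := D.measurable_margDensity a₁ a₂ b₁ b₂
  have hmk := D.measurable_transDensity a₁ a₂ b₁ b₂
  have hden : Measurable fun η => D.margDensity a₁ a₂ b₁ b₂ η / Z := hmm.div_const _
  have key : ∀ S T : Set D.State, MeasurableSet S → MeasurableSet T →
      ∫⁻ x in S, D.gibbsKernel a₁ a₂ b₁ b₂ x T ∂(D.posterior a₁ a₂ b₁ b₂) =
      ∫⁻ x in S, ∫⁻ y in T, D.margDensity a₁ a₂ b₁ b₂ x / Z * D.transDensity a₁ a₂ b₁ b₂ x y := by
    intro S T hS hT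
    have hKm := (D.gibbsKernel a₁ a₂ b₁ b₂).measurable_coe hT
    rw [posterior, ← hZ, setLIntegral_withDensity_eq_setLIntegral_mul _ hden hKm hS]
    refine lintegral_congr fun x => ?_
    rw [Pi.mul_apply, gibbsKernel_apply, withDensity_apply _ hT,
      lintegral_const_mul _ hmk.of_uncurry_left]
  rw [key A B hA hB, key B A hB hA]
  have hm2 : Measurable (Function.uncurry fun x y : D.State =>
      D.margDensity a₁ a₂ b₁ b₂ x / Z * D.transDensity a₁ a₂ b₁ b₂ x y) :=
    (hden.comp measurable_fst).mul hmk
  rw [lintegral_lintegral_swap hm2.aemeasurable]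
  refine lintegral_congr fun y => lintegral_congr fun x => ?_
  simp only [div_eq_mul_inv]
  rw [mul_right_comm, H.margDensity_mul_transDensity, mul_right_comm]

/-- Conditional mean of a nonnegative function of `η` after one step. -/
theorem lintegral_gibbsKernel_le (η : D.State) {g : D.State → ℝ≥0∞} (hg : Measurable g)
    {c : ℝ → ℝ → ℝ≥0∞} (h : ∀ lam tau, 0 < lam → 0 < tau →
      ∫⁻ w, g (D.coord w) * pairWeight D.predMap D.centMap D.lsq lam tau w ≤
        c lam tau * ∫⁻ w, pairWeight D.predMap D.centMap D.lsq lam tau w) :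
    ∫⁻ η', g η' ∂(D.gibbsKernel a₁ a₂ b₁ b₂ η) ≤
      ∫⁻ lam, ∫⁻ tau, c lam tau
        ∂(gammaMeasure (D.shapeTau a₂) (D.rateTau b₂ η))
        ∂(gammaMeasure (D.shapeLam a₁) (D.rateLam b₁ η)) := by
  rw [D.lintegral_gibbsKernel H.ha₁ H.ha₂ H.hb₁ H.hb₂ η hg]
  exact lintegral_gamma_gamma_mono fun lam tau hlam htau =>
    H.condMean_le hg hlam htau (h lam tau hlam htau)

theorem lintegral_norm_sq_predMap_le (hβ : 1 < D.shapeTau a₂) (η : D.State) :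
    ∫⁻ η', ENNReal.ofReal (‖D.predMap (D.coreOf η' - D.lsq)‖ ^ 2) ∂(D.gibbsKernel a₁ a₂ b₁ b₂ η) ≤
      ENNReal.ofReal ((4 * (D.p + q) + 4 +
        D.shapeLam a₁ / D.rateLam b₁ η * ‖D.centMap D.lsq‖ ^ 2) *
          (D.rateTau b₂ η / (D.shapeTau a₂ - 1))) := by
  have hA := H.rateLam_pos η
  have hB := H.rateTau_pos η
  have hα := H.shapeLam_pos
  have := isProbabilityMeasure_gammaMeasure H.shapeLam_pos (H.rateLam_pos η)
  have hcont : Continuous fun η' => ‖D.predMap (D.coreOf η' - D.lsq)‖ ^ 2 := by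
    have := D.continuous_coreOf
    fun_prop
  have hS : 0 ≤ ‖D.centMap D.lsq‖ ^ 2 := by positivity
  refine (H.lintegral_gibbsKernel_le η (ENNReal.measurable_ofReal.comp hcont.measurable)
    (c := fun lam tau => (ENNReal.ofReal (4 * (D.p + q) + 4) +
      ENNReal.ofReal lam * ENNReal.ofReal (‖D.centMap D.lsq‖ ^ 2)) * ENNReal.ofReal tau⁻¹)
    fun lam tau hlam htau => ?_).trans (le_of_eq ?_)
  · have h := lintegral_norm_sq_pairWeight_le D.predMap D.centMap D.lsq hlam htau
    simp only [Function.comp_apply, coreOf_coord]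
    refine h.trans (le_of_eq ?_)
    rw [D.finrank_core, ← ENNReal.ofReal_mul hlam.le, ← ENNReal.ofReal_add (by positivity)
      (by positivity), ← ENNReal.ofReal_mul (by positivity)]
    push_cast
    rfl
  · have hm : Measurable fun t : ℝ => ENNReal.ofReal t⁻¹ := by fun_prop
    simp only [lintegral_const_mul _ hm, lintegral_inv_gammaMeasure hβ hB]
    rw [lintegral_mul_const' _ _ ENNReal.ofReal_ne_top, lintegral_add_left measurable_const,
      lintegral_mul_const' _ _ ENNReal.ofReal_ne_top, lintegral_id_gammaMeasure hα hA,
      lintegral_const, measure_univ, mul_one, ← ENNReal.ofReal_mul (by positivity),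
      ← ENNReal.ofReal_add (by positivity) (by positivity), ← ENNReal.ofReal_mul (by positivity)]

theorem lintegral_devOf_sq_le (hα : 1 < D.shapeLam a₁) (η : D.State) :
    ∫⁻ η', ENNReal.ofReal (D.devOf η' ^ 2) ∂(D.gibbsKernel a₁ a₂ b₁ b₂ η) ≤
      ENNReal.ofReal (8 * (D.rateLam b₁ η / (D.shapeLam a₁ - 1))) := by
  have hA := H.rateLam_pos η
  have := isProbabilityMeasure_gammaMeasure H.shapeTau_pos (H.rateTau_pos η)
  have hcont : Continuous fun η' => D.devOf η' ^ 2 := D.continuous_devOf.pow 2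
  refine (H.lintegral_gibbsKernel_le η (ENNReal.measurable_ofReal.comp hcont.measurable)
    (c := fun lam _ => ENNReal.ofReal 8 * ENNReal.ofReal lam⁻¹)
    fun lam tau hlam htau => ?_).trans (le_of_eq ?_)
  · have h := lintegral_sq_pairWeight_le D.predMap D.centMap D.lsq (tau := tau) hlam
    simp only [Function.comp_apply, devOf_coord]
    refine h.trans (le_of_eq ?_)
    rw [← ENNReal.ofReal_mul (by norm_num), div_eq_mul_inv]
  · simp only [lintegral_const, measure_univ, mul_one]
    rw [lintegral_const_mul' _ _ ENNReal.ofReal_ne_top, lintegral_inv_gammaMeasure hα hA,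
      ← ENNReal.ofReal_mul (by norm_num)]

end

end Regular

end MixedModelData

end GibbsChain

/-! ### Pointwise bounds for the rates -/

noncomputable section Pointwise

namespace MixedModelData

variable {q : ℕ} (D : MixedModelData q) {a₁ a₂ b₁ b₂ : ℝ}

theorem norm_centMap_sq_add (hq : 0 < q) (z : D.Core) :
    ‖D.centMap z‖ ^ 2 + q * D.effMean z ^ 2 = ∑ i, z (Sum.inr i) ^ 2 := by
  have hq' : (q : ℝ) ≠ 0 := by exact_mod_cast hq.ne'
  have hs : ∑ i, z (Sum.inr i) = q * D.effMean z := by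
    unfold effMean
    field_simp
  rw [EuclideanSpace.real_norm_sq_eq]
  have e : ∀ i, D.centMap z i ^ 2 =
      z (Sum.inr i) ^ 2 - 2 * D.effMean z * z (Sum.inr i) + D.effMean z ^ 2 := fun i => by
    rw [centMap_apply]
    ring
  simp only [e, Finset.sum_add_distrib, Finset.sum_sub_distrib, ← Finset.mul_sum, hs,
    Finset.sum_const, Finset.card_univ, Fintype.card_fin, nsmul_eq_mul]
  ring

theorem norm_core_sq (z : D.Core) :
    ‖z‖ ^ 2 = ∑ k, z (Sum.inl k) ^ 2 + ∑ i, z (Sum.inr i) ^ 2 := by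
  rw [EuclideanSpace.real_norm_sq_eq, Fintype.sum_sum_type]

theorem norm_centMap_le (hq : 0 < q) (z : D.Core) : ‖D.centMap z‖ ≤ ‖z‖ := by
  have h1 := D.norm_centMap_sq_add hq z
  have h2 := D.norm_core_sq z
  have h3 : 0 ≤ ∑ k, z (Sum.inl k) ^ 2 := Finset.sum_nonneg fun _ _ => sq_nonneg _
  have h4 : (0 : ℝ) ≤ q * D.effMean z ^ 2 := by positivity
  exact le_of_sq_le_sq (by linarith) (norm_nonneg _)

theorem effMean_sq_le (hq : 0 < q) (z : D.Core) : q * D.effMean z ^ 2 ≤ ‖z‖ ^ 2 := by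
  have h1 := D.norm_centMap_sq_add hq z
  have h2 := D.norm_core_sq z
  have h3 : 0 ≤ ∑ k, z (Sum.inl k) ^ 2 := Finset.sum_nonneg fun _ _ => sq_nonneg _
  have h4 : 0 ≤ ‖D.centMap z‖ ^ 2 := by positivity
  linarith

theorem norm_state_sq_le (hq : 0 < q) (η : D.State) :
    ‖η‖ ^ 2 ≤ 3 * ‖D.coreOf η‖ ^ 2 + 2 * D.devOf η ^ 2 := by
  have hq' : (0 : ℝ) ≤ q := by positivity
  have h1 : ‖η‖ ^ 2 = ‖D.coreOf η‖ ^ 2 + η (Sum.inr (Sum.inl ())) ^ 2 := by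
    rw [norm_core_sq, EuclideanSpace.real_norm_sq_eq, Fintype.sum_sum_type, Fintype.sum_sum_type]
    simp only [coreOf, Sum.elim_inl, Sum.elim_inr, Finset.univ_unique, Finset.sum_singleton,
      PUnit.default_eq_unit]
    ring
  have h2 : η (Sum.inr (Sum.inl ())) = D.devOf η + √(q : ℝ) * D.effMean (D.coreOf η) := by
    rw [devOf]
    ring
  have h3 := D.effMean_sq_le hq (D.coreOf η)
  have h4 : (√(q : ℝ) * D.effMean (D.coreOf η)) ^ 2 = q * D.effMean (D.coreOf η) ^ 2 := by
    rw [mul_pow, Real.sq_sqrt hq']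
  rw [h1, h2]
  nlinarith [sq_nonneg (D.devOf η - √(q : ℝ) * D.effMean (D.coreOf η))]

/-- Distance of a state from the least squares estimate, measured by the linear predictor. -/
def fitSq (η : D.State) : ℝ := ‖D.predMap (D.coreOf η - D.lsq)‖ ^ 2

theorem fitSq_nonneg (η : D.State) : 0 ≤ D.fitSq η := sq_nonneg _

theorem rateTau_eq_fitSq (b₂ : ℝ) (η : D.State) :
    D.rateTau b₂ η = D.optTau b₂ + D.fitSq η / 2 := D.rateTau_eq b₂ η

theorem le_optLam (b₁ : ℝ) : b₁ ≤ D.optLam b₁ := by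
  have := sq_nonneg ‖D.centMap D.lsq‖
  unfold optLam
  linarith

theorem le_optTau (b₂ : ℝ) : b₂ ≤ D.optTau b₂ := by
  have := sq_nonneg ‖D.obsY - D.predMap D.lsq‖
  unfold optTau
  linarith

theorem le_rateLam (b₁ : ℝ) (η : D.State) : b₁ ≤ D.rateLam b₁ η := by
  have := D.effSq_nonneg η
  unfold rateLam
  linarith

/-- Lyapunov function: it compares the two rates with their values at the least squares
estimate. -/
def lyap (b₁ b₂ : ℝ) (η : D.State) : ℝ :=
  D.rateLam b₁ η / D.optLam b₁ + D.optLam b₁ / D.rateLam b₁ η + D.rateTau b₂ η / D.optTau b₂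

/-- Size of a state: the two rates on their natural scales. It controls the norm. -/
def size (b₁ b₂ : ℝ) (η : D.State) : ℝ := 1 + D.rateLam b₁ η / q + D.rateTau b₂ η / D.total

/-- The quantitative consequences of the assumptions on the data that the convergence analysis
uses, with one constant `Λ` for all of them. -/
structure Bounds (a₁ a₂ b₁ b₂ Λ : ℝ) : Prop where
  hΛ : 1 ≤ Λ
  hq : (4 : ℝ) ≤ q
  hr : (q : ℝ) ^ 2 ≤ D.rBar
  ha₁ : 0 < a₁
  ha₂ : 0 < a₂
  hb₁ : 0 < b₁
  hb₂ : 0 < b₂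
  one_le_b₁ : 1 ≤ Λ * b₁
  one_le_b₂ : 1 ≤ Λ * b₂
  b₁_le : b₁ ≤ Λ
  b₂_le : b₂ ≤ Λ
  norm_le_predMap : ∀ z, D.rBar * ‖z‖ ^ 2 ≤ Λ * ‖D.predMap z‖ ^ 2
  predMap_le : ∀ z, ‖D.predMap z‖ ^ 2 ≤ Λ * D.rBar * ‖z‖ ^ 2
  obsY_le : ‖D.obsY‖ ^ 2 ≤ Λ * D.total
  dim_le : (D.p : ℝ) + q + 1 ≤ Λ * q
  dim_le_total : D.p + q ≤ D.total
  shapeLam_le : D.shapeLam a₁ ≤ Λ * q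
  shapeTau_le : D.shapeTau a₂ ≤ Λ * D.total
  rateLam_le : ∀ η : D.State, D.rateLam b₁ η ≤ Λ * q * (1 + D.driftV η)
  rateTau_le : ∀ η : D.State, D.rateTau b₂ η ≤ Λ * D.total * (1 + D.driftV η)

theorem total_eq (hq : 0 < q) : (D.total : ℝ) = D.rBar * q := by
  have hq' : (q : ℝ) ≠ 0 := by exact_mod_cast hq.ne'
  rw [total, rBar]
  push_cast
  field_simp

namespace Bounds

variable {D} {Λ : ℝ} (H : D.Bounds a₁ a₂ b₁ b₂ Λ)

section
include H

theorem q_pos : 0 < q := by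
  have := H.hq
  rw [pos_iff_ne_zero]
  rintro rfl
  norm_num at this

theorem qR_pos : (0 : ℝ) < q := by linarith [H.hq]

theorem rBar_ge : (16 : ℝ) ≤ D.rBar := by nlinarith [H.hr, H.hq]

theorem rBar_pos : 0 < D.rBar := by linarith [H.rBar_ge]

theorem total_eq : (D.total : ℝ) = D.rBar * q := D.total_eq H.q_pos

theorem total_ge : (q : ℝ) ≤ D.total := by
  rw [H.total_eq]
  nlinarith [H.rBar_ge, H.hq]

theorem total_pos : (0 : ℝ) < D.total := lt_of_lt_of_le H.qR_pos H.total_ge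

theorem regular : D.Regular a₁ a₂ b₁ b₂ (D.rBar / Λ) where
  hq := H.q_pos
  ha₁ := H.ha₁
  ha₂ := H.ha₂
  hb₁ := H.hb₁
  hb₂ := H.hb₂
  hκ := div_pos H.rBar_pos (by linarith [H.hΛ])
  hM z := by
    have hΛ : 0 < Λ := by linarith [H.hΛ]
    rw [div_mul_eq_mul_div, div_le_iff₀ hΛ, mul_comm _ Λ]
    exact H.norm_le_predMap z
  hN := H.dim_le_total

theorem shapeLam_sub_one_ge : (q : ℝ) / 4 ≤ D.shapeLam a₁ - 1 := by
  have := H.ha₁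
  have := H.hq
  unfold shapeLam
  linarith

theorem shapeTau_sub_one_ge : (D.total : ℝ) / 4 ≤ D.shapeTau a₂ - 1 := by
  have := H.ha₂
  have := H.hq
  have := H.total_ge
  unfold shapeTau
  linarith

theorem centMap_lsq_sq_le : ‖D.centMap D.lsq‖ ^ 2 ≤ Λ ^ 2 * q := by
  have hr := H.rBar_pos
  have hΛ := H.hΛ
  have h1 := H.norm_le_predMap D.lsq
  have h2 := D.norm_sub_predMap_sq 0
  rw [map_zero, sub_zero, zero_sub, map_neg, norm_neg] at h2
  have h3 := H.obsY_le
  have h4 : ‖D.centMap D.lsq‖ ^ 2 ≤ ‖D.lsq‖ ^ 2 :=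
    pow_le_pow_left₀ (norm_nonneg _) (D.norm_centMap_le H.q_pos _) 2
  have h5 : ‖D.predMap D.lsq‖ ^ 2 ≤ Λ * D.total := by
    linarith [sq_nonneg ‖D.obsY - D.predMap D.lsq‖]
  have h6 : D.rBar * ‖D.lsq‖ ^ 2 ≤ D.rBar * (Λ ^ 2 * q) := by
    calc _ ≤ Λ * (Λ * D.total) := h1.trans (by gcongr)
      _ = _ := by rw [H.total_eq]; ring
  exact h4.trans (le_of_mul_le_mul_left h6 hr)

theorem optLam_pos : 0 < D.optLam b₁ := D.optLam_pos H.hb₁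

theorem optTau_pos : 0 < D.optTau b₂ := D.optTau_pos H.hb₂

theorem rateLam_pos (η : D.State) : 0 < D.rateLam b₁ η := D.rateLam_pos H.hb₁ η

theorem rateTau_pos (η : D.State) : 0 < D.rateTau b₂ η := D.rateTau_pos H.hb₂ η

theorem optLam_le : D.optLam b₁ ≤ 2 * Λ ^ 2 * q := by
  have h1 := H.centMap_lsq_sq_le
  have h2 := H.b₁_le
  have h3 : Λ ≤ Λ ^ 2 * q := by nlinarith [H.hΛ, H.hq]
  have h4 : 0 ≤ Λ ^ 2 * q := by positivity
  unfold optLam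
  linarith

theorem optTau_le : D.optTau b₂ ≤ 2 * Λ * D.total := by
  have h2 := D.norm_sub_predMap_sq 0
  rw [map_zero, sub_zero, zero_sub, map_neg, norm_neg] at h2
  have h3 := H.obsY_le
  have h4 := H.b₂_le
  have h5 : Λ ≤ Λ * D.total := by nlinarith [H.hΛ, H.hq, H.total_ge]
  unfold optTau
  linarith [sq_nonneg ‖D.predMap D.lsq‖, H.hΛ]

theorem norm_sub_lsq_sq_le (η : D.State) :
    ‖D.coreOf η - D.lsq‖ ^ 2 ≤ Λ / D.rBar * D.fitSq η := by
  rw [div_mul_eq_mul_div, le_div_iff₀ H.rBar_pos, mul_comm]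
  exact H.norm_le_predMap _

theorem norm_centMap_sub_sq_le (η : D.State) :
    ‖D.centMap (D.coreOf η) - D.centMap D.lsq‖ ^ 2 ≤ Λ / D.rBar * D.fitSq η := by
  rw [← map_sub]
  exact (pow_le_pow_left₀ (norm_nonneg _) (D.norm_centMap_le H.q_pos _) 2).trans
    (H.norm_sub_lsq_sq_le η)

theorem rateLam_le_optLam (η : D.State) :
    D.rateLam b₁ η ≤ 2 * D.optLam b₁ + Λ / D.rBar * D.fitSq η + D.devOf η ^ 2 / 2 := by
  have h := H.norm_centMap_sub_sq_le η
  have hb := H.hb₁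
  have h2 : ‖D.centMap (D.coreOf η)‖ ≤ ‖D.centMap D.lsq‖ +
      ‖D.centMap (D.coreOf η) - D.centMap D.lsq‖ := norm_le_norm_add_norm_sub' _ _
  rw [D.rateLam_eq H.q_pos, optLam]
  nlinarith [norm_nonneg (D.centMap (D.coreOf η)),
    sq_nonneg (‖D.centMap D.lsq‖ - ‖D.centMap (D.coreOf η) - D.centMap D.lsq‖)]

theorem optLam_le_rateLam (η : D.State) :
    D.optLam b₁ ≤ 2 * D.rateLam b₁ η + Λ / D.rBar * D.fitSq η := by
  have h := H.norm_centMap_sub_sq_le η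
  have hb := H.hb₁
  have h2 : ‖D.centMap D.lsq‖ ≤ ‖D.centMap (D.coreOf η)‖ +
      ‖D.centMap (D.coreOf η) - D.centMap D.lsq‖ := norm_le_norm_add_norm_sub _ _
  rw [D.rateLam_eq H.q_pos, optLam]
  nlinarith [norm_nonneg (D.centMap D.lsq), sq_nonneg (D.devOf η),
    sq_nonneg (‖D.centMap (D.coreOf η)‖ - ‖D.centMap (D.coreOf η) - D.centMap D.lsq‖)]

theorem one_div_le_of_le {c : ℝ} (hc : b₁ ≤ c) : 1 / c ≤ Λ := by
  have := H.hb₁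
  rw [div_le_iff₀ (by linarith)]
  nlinarith [H.one_le_b₁, H.hΛ]

theorem one_div_optTau_le : 1 / D.optTau b₂ ≤ Λ := by
  rw [div_le_iff₀ H.optTau_pos]
  nlinarith [H.one_le_b₂, H.hΛ, (D.le_optTau b₂)]

theorem one_le_lyap (η : D.State) : 1 ≤ D.lyap b₁ b₂ η := by
  have hA := H.rateLam_pos η
  have hA' := H.optLam_pos
  have hB := H.optTau_pos
  have h1 : 0 ≤ D.rateLam b₁ η / D.optLam b₁ := by positivity
  have h2 : 0 ≤ D.optLam b₁ / D.rateLam b₁ η := by positivity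
  have h3 : 1 ≤ D.rateTau b₂ η / D.optTau b₂ := by
    rw [le_div_iff₀ hB, rateTau_eq_fitSq]
    linarith [D.fitSq_nonneg η]
  unfold lyap
  linarith

/-- The constant terms are bounded, and what remains is quadratic in the distance from the least
squares estimate: both precision rates are quadratic polynomials. -/
theorem lyap_le (η : D.State) :
    D.lyap b₁ b₂ η ≤ 5 + (2 * Λ ^ 2 / D.rBar + 1 / (2 * D.optTau b₂)) * D.fitSq η +
      1 / (2 * D.optLam b₁) * D.devOf η ^ 2 := by
  have hA := H.rateLam_pos η
  have hA' := H.optLam_pos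
  have hB := H.optTau_pos
  have hX := D.fitSq_nonneg η
  have hr := H.rBar_pos
  have hΛ : 0 < Λ := by linarith [H.hΛ]
  have ht : 0 ≤ Λ / D.rBar * D.fitSq η := by positivity
  have i1 := H.one_div_le_of_le (D.le_optLam b₁)
  have i2 := H.one_div_le_of_le (D.le_rateLam b₁ η)
  have h1 : D.rateLam b₁ η / D.optLam b₁ ≤
      2 + Λ * (Λ / D.rBar * D.fitSq η) + 1 / (2 * D.optLam b₁) * D.devOf η ^ 2 := by
    calc _ ≤ (2 * D.optLam b₁ + Λ / D.rBar * D.fitSq η + D.devOf η ^ 2 / 2) / D.optLam b₁ := by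
          gcongr
          exact H.rateLam_le_optLam η
      _ = 2 + 1 / D.optLam b₁ * (Λ / D.rBar * D.fitSq η) +
          1 / (2 * D.optLam b₁) * D.devOf η ^ 2 := by field_simp
      _ ≤ _ := by gcongr
  have h2 : D.optLam b₁ / D.rateLam b₁ η ≤ 2 + Λ * (Λ / D.rBar * D.fitSq η) := by
    calc _ ≤ (2 * D.rateLam b₁ η + Λ / D.rBar * D.fitSq η) / D.rateLam b₁ η := by
          gcongr
          exact H.optLam_le_rateLam η
      _ = 2 + 1 / D.rateLam b₁ η * (Λ / D.rBar * D.fitSq η) := by field_simp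
      _ ≤ _ := by gcongr
  have h3 : D.rateTau b₂ η / D.optTau b₂ = 1 + 1 / (2 * D.optTau b₂) * D.fitSq η := by
    rw [rateTau_eq_fitSq]
    field_simp
  have e : (2 * Λ ^ 2 / D.rBar + 1 / (2 * D.optTau b₂)) * D.fitSq η =
      2 * (Λ * (Λ / D.rBar * D.fitSq η)) + 1 / (2 * D.optTau b₂) * D.fitSq η := by
    field_simp
  unfold lyap
  rw [h3, e]
  linarith

theorem optLam_div_rateLam_le (η : D.State) : 1 + D.optLam b₁ / D.rateLam b₁ η ≤ 3 * Λ ^ 3 * q := by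
  have hΛ := H.hΛ
  have hq := H.hq
  have i2 := H.one_div_le_of_le (D.le_rateLam b₁ η)
  have h1 : D.optLam b₁ / D.rateLam b₁ η ≤ 2 * Λ ^ 2 * q * Λ := by
    rw [div_eq_mul_one_div]
    have := H.optLam_le
    have := H.rateLam_pos η
    gcongr
  have h2 : 1 ≤ Λ ^ 3 * q := by
    have : 1 ≤ Λ ^ 3 := one_le_pow₀ hΛ
    nlinarith
  linarith

theorem one_le_size (η : D.State) : 1 ≤ D.size b₁ b₂ η := by
  have hA := H.rateLam_pos η
  have hB := H.rateTau_pos η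
  have h1 : 0 ≤ D.rateLam b₁ η / q := by positivity
  have h2 : 0 ≤ D.rateTau b₂ η / D.total := by positivity
  unfold size
  linarith

theorem rateLam_le_size (η : D.State) : D.rateLam b₁ η ≤ q * D.size b₁ b₂ η := by
  have hB := H.rateTau_pos η
  have h2 : 0 ≤ D.rateTau b₂ η / D.total := by positivity
  rw [mul_comm, ← div_le_iff₀ H.qR_pos]
  unfold size
  linarith

theorem rateTau_le_size (η : D.State) : D.rateTau b₂ η ≤ D.total * D.size b₁ b₂ η := by
  have hB := H.rateLam_pos η
  have h2 : 0 ≤ D.rateLam b₁ η / q := by positivity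
  rw [mul_comm, ← div_le_iff₀ H.total_pos]
  unfold size
  linarith

theorem size_le_driftV (η : D.State) : D.size b₁ b₂ η ≤ 3 * Λ * (1 + D.driftV η) := by
  have h1 : D.rateLam b₁ η / q ≤ Λ * (1 + D.driftV η) := by
    rw [div_le_iff₀ H.qR_pos]
    linarith [H.rateLam_le η]
  have h2 : D.rateTau b₂ η / D.total ≤ Λ * (1 + D.driftV η) := by
    rw [div_le_iff₀ H.total_pos]
    linarith [H.rateTau_le η]
  have h3 : 1 ≤ Λ * (1 + D.driftV η) := by
    have h : 0 ≤ D.driftV η := by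
      have := H.rBar_pos
      unfold driftV
      positivity
    nlinarith [H.hΛ]
  unfold size
  linarith

theorem size_le_lyap (η : D.State) : D.size b₁ b₂ η ≤ 3 * Λ ^ 2 * D.lyap b₁ b₂ η := by
  have hΛ := H.hΛ
  have hA := H.rateLam_pos η
  have hB := H.rateTau_pos η
  have hA' := H.optLam_pos
  have hB' := H.optTau_pos
  have hN := H.total_pos
  have hq := H.qR_pos
  have h1 : D.rateLam b₁ η / q ≤ 2 * Λ ^ 2 * (D.rateLam b₁ η / D.optLam b₁) := by
    rw [← mul_div_assoc, div_le_div_iff₀ hq hA']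
    nlinarith [H.optLam_le]
  have h2 : D.rateTau b₂ η / D.total ≤ 2 * Λ ^ 2 * (D.rateTau b₂ η / D.optTau b₂) := by
    rw [← mul_div_assoc, div_le_div_iff₀ hN hB']
    have : D.optTau b₂ ≤ 2 * Λ ^ 2 * D.total := H.optTau_le.trans (by gcongr; nlinarith)
    nlinarith
  have h3 := H.one_le_lyap η
  have h4 : 0 ≤ D.optLam b₁ / D.rateLam b₁ η := by positivity
  have h5 : 1 ≤ Λ ^ 2 := one_le_pow₀ hΛ
  have h6 : D.rateLam b₁ η / D.optLam b₁ + D.rateTau b₂ η / D.optTau b₂ ≤ D.lyap b₁ b₂ η := by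
    unfold lyap
    linarith
  unfold size
  nlinarith

/-- The rates at the least squares estimate are only bounded below by `b₁` and `b₂`, whence the factor
`D.total`; `lintegral_lyap_pow_le` removes it. -/
theorem lyap_le_size (η : D.State) :
    D.lyap b₁ b₂ η ≤ 5 * Λ ^ 3 * D.total * D.size b₁ b₂ η := by
  have hΛ := H.hΛ
  have hN := H.total_ge
  have hq := H.qR_pos
  have hs := H.one_le_size η
  have hA := H.rateLam_pos η
  have hB := H.rateTau_pos η
  have hΛ3 : Λ ≤ Λ ^ 3 := le_self_pow₀ hΛ (by norm_num)
  have hP : D.total ≤ D.total * D.size b₁ b₂ η := by nlinarith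
  have h1 : D.rateLam b₁ η / D.optLam b₁ ≤ Λ ^ 3 * (D.total * D.size b₁ b₂ η) := by
    calc _ = D.rateLam b₁ η * (1 / D.optLam b₁) := by ring
      _ ≤ (q * D.size b₁ b₂ η) * Λ :=
        mul_le_mul (H.rateLam_le_size η) (H.one_div_le_of_le (D.le_optLam b₁))
          (by have := H.optLam_pos; positivity) (by positivity)
      _ ≤ (D.total * D.size b₁ b₂ η) * Λ ^ 3 := by gcongr
      _ = _ := by ring
  have h2 : D.rateTau b₂ η / D.optTau b₂ ≤ Λ ^ 3 * (D.total * D.size b₁ b₂ η) := by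
    calc _ = D.rateTau b₂ η * (1 / D.optTau b₂) := by ring
      _ ≤ (D.total * D.size b₁ b₂ η) * Λ :=
        mul_le_mul (H.rateTau_le_size η) H.one_div_optTau_le
          (by have := H.optTau_pos; positivity) (by positivity)
      _ ≤ (D.total * D.size b₁ b₂ η) * Λ ^ 3 := by gcongr
      _ = _ := by ring
  have h3 : D.optLam b₁ / D.rateLam b₁ η ≤ 3 * (Λ ^ 3 * (D.total * D.size b₁ b₂ η)) := by
    have h := H.optLam_div_rateLam_le η
    have : Λ ^ 3 * q ≤ Λ ^ 3 * (D.total * D.size b₁ b₂ η) := by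
      gcongr
      linarith
    linarith
  unfold lyap
  linarith

theorem norm_sq_le (η : D.State) : ‖η‖ ^ 2 ≤ 22 * Λ ^ 2 * q * D.size b₁ b₂ η := by
  have hΛ := H.hΛ
  have hr := H.rBar_pos
  have hs := H.one_le_size η
  have hq := H.qR_pos
  have h1 := D.norm_state_sq_le H.q_pos η
  have h2 := H.norm_le_predMap (D.coreOf η)
  have h3 : ‖D.predMap (D.coreOf η)‖ ^ 2 ≤ (4 + 2 * Λ) * (D.total * D.size b₁ b₂ η) := by
    have e1 : ‖D.predMap (D.coreOf η)‖ ≤ ‖D.obsY‖ + ‖D.obsY - D.predMap (D.coreOf η)‖ :=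
      norm_le_norm_add_norm_sub _ _
    have e2 : ‖D.obsY - D.predMap (D.coreOf η)‖ ^ 2 ≤ 2 * D.rateTau b₂ η := by
      rw [← resSq_eq_norm, rateTau]
      linarith [H.hb₂]
    have e3 := H.rateTau_le_size η
    have e4 := H.obsY_le
    have e5 : D.total ≤ D.total * D.size b₁ b₂ η := by nlinarith [H.total_pos]
    have e6 : Λ * D.total ≤ Λ * (D.total * D.size b₁ b₂ η) := by gcongr
    nlinarith [norm_nonneg (D.predMap (D.coreOf η)),
      sq_nonneg (‖D.obsY‖ - ‖D.obsY - D.predMap (D.coreOf η)‖)]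
  have h4 : ‖D.coreOf η‖ ^ 2 ≤ 6 * Λ ^ 2 * (q * D.size b₁ b₂ η) := by
    refine le_of_mul_le_mul_left ?_ hr
    calc _ ≤ Λ * ((6 * Λ) * (D.total * D.size b₁ b₂ η)) := by
          refine h2.trans ?_
          have : 0 ≤ D.total * D.size b₁ b₂ η := by positivity
          gcongr
          refine h3.trans ?_
          gcongr
          linarith
      _ = _ := by rw [H.total_eq]; ring
  have h5 : D.devOf η ^ 2 ≤ 2 * (q * D.size b₁ b₂ η) := by
    have := H.rateLam_le_size η
    rw [D.rateLam_eq H.q_pos] at this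
    nlinarith [H.hb₁, sq_nonneg ‖D.centMap (D.coreOf η)‖]
  have h6 : q * D.size b₁ b₂ η ≤ Λ ^ 2 * (q * D.size b₁ b₂ η) :=
    le_mul_of_one_le_left (by positivity) (one_le_pow₀ hΛ)
  linarith

/-- The metric of the state space is dominated by the square root of the size. -/
theorem edist_le (η η' : D.State) :
    edist η η' ≤ ENNReal.ofReal (6 * Λ * √(q : ℝ)) *
      (ENNReal.ofReal (√(D.size b₁ b₂ η)) + ENNReal.ofReal (√(D.size b₁ b₂ η'))) := by
  have hΛ := H.hΛ
  have h : ∀ x : D.State, ‖x‖ ≤ 6 * Λ * √(q : ℝ) * √(D.size b₁ b₂ x) := fun x => by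
    have hs := H.one_le_size x
    refine le_of_sq_le_sq ((H.norm_sq_le x).trans ?_) (by positivity)
    rw [mul_pow, mul_pow, mul_pow, Real.sq_sqrt H.qR_pos.le, Real.sq_sqrt (by linarith)]
    have := H.qR_pos
    gcongr
    norm_num
  rw [edist_dist, ← ENNReal.ofReal_add (by positivity) (by positivity),
    ← ENNReal.ofReal_mul (by positivity)]
  refine ENNReal.ofReal_le_ofReal ?_
  rw [dist_eq_norm]
  linarith [norm_sub_le η η', h η, h η']

theorem continuous_lyap : Continuous (D.lyap b₁ b₂) := by
  have h1 : Continuous (D.rateLam b₁) := (D.continuous_effSq.div_const 2).const_add b₁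
  have h2 : Continuous (D.rateTau b₂) := (D.continuous_resSq.div_const 2).const_add b₂
  exact ((h1.div_const _).add (continuous_const.div h1 fun η => (H.rateLam_pos η).ne')).add
    (h2.div_const _)

end

end Bounds

theorem continuous_rateLam (b₁ : ℝ) : Continuous (D.rateLam b₁) :=
  (D.continuous_effSq.div_const 2).const_add b₁

theorem continuous_rateTau (b₂ : ℝ) : Continuous (D.rateTau b₂) :=
  (D.continuous_resSq.div_const 2).const_add b₂

theorem continuous_size (b₁ b₂ : ℝ) : Continuous (D.size b₁ b₂) :=
  (((D.continuous_rateLam b₁).div_const _).const_add 1).add ((D.continuous_rateTau b₂).div_const _)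

end MixedModelData

end Pointwise

/-! ### Drift of the Lyapunov function and overlap of two-step laws -/

noncomputable section DriftOverlap

namespace MixedModelData

variable {q : ℕ} (D : MixedModelData q) {a₁ a₂ b₁ b₂ : ℝ}

/-- Mixture of the conditional laws of `η` over independent Gamma precisions with rates `A`, `B`.
The minimum with `1` only matters at precisions that are not positive. -/
def mixLaw (a₁ a₂ b₁ b₂ A B : ℝ) (S : Set D.State) : ℝ≥0∞ :=
  ∫⁻ lam, ∫⁻ tau, min (D.condMean a₁ a₂ b₁ b₂ (S.indicator fun _ => 1) lam tau) 1
    ∂(gammaMeasure (D.shapeTau a₂) B) ∂(gammaMeasure (D.shapeLam a₁) A)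

/-- Bound for the total variation distance of two such mixtures. -/
def mixGap (a₁ a₂ A A' B B' : ℝ) : ℝ :=
  3 * (√(D.shapeLam a₁) * |A - A'| / (A + A')) + 3 * (√(D.shapeTau a₂) * |B - B'| / (B + B'))

namespace Bounds

variable {D} {Λ : ℝ} (H : D.Bounds a₁ a₂ b₁ b₂ Λ)

section
include H

theorem gibbsKernel_eq_mixLaw (η : D.State) {S : Set D.State} (hS : MeasurableSet S) :
    D.gibbsKernel a₁ a₂ b₁ b₂ η S =
      D.mixLaw a₁ a₂ b₁ b₂ (D.rateLam b₁ η) (D.rateTau b₂ η) S := by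
  have hone : ∀ lam tau, 0 < lam → 0 < tau →
      D.condMean a₁ a₂ b₁ b₂ (S.indicator fun _ => 1) lam tau ≤ 1 := fun lam tau hl ht => by
    refine le_trans ?_ (H.regular.condMean_one hl ht).le
    refine lintegral_mono fun η => ?_
    gcongr
    by_cases h : η ∈ S <;> simp [h]
  rw [← lintegral_indicator_one hS]
  have h := D.lintegral_gibbsKernel H.ha₁ H.ha₂ H.hb₁ H.hb₂ η
    (g := S.indicator fun _ => 1) (measurable_const.indicator hS)
  refine Eq.trans h (le_antisymm ?_ ?_)
  · exact lintegral_gamma_gamma_mono fun lam tau hl ht => le_min le_rfl (hone lam tau hl ht)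
  · exact lintegral_gamma_gamma_mono fun lam tau hl ht => min_le_left _ _

theorem one_le_shapeLam : 1 ≤ D.shapeLam a₁ := by
  linarith [H.shapeLam_sub_one_ge, H.qR_pos]

theorem one_le_shapeTau : 1 ≤ D.shapeTau a₂ := by
  linarith [H.shapeTau_sub_one_ge, H.total_pos]

theorem mixLaw_le {A A' B B' : ℝ} (hA : 0 < A) (hA' : 0 < A') (hB : 0 < B) (hB' : 0 < B')
    {S : Set D.State} (hS : MeasurableSet S) :
    D.mixLaw a₁ a₂ b₁ b₂ A B S ≤
      D.mixLaw a₁ a₂ b₁ b₂ A' B' S + ENNReal.ofReal (D.mixGap a₁ a₂ A A' B B') :=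
  D.lintegral_gamma_gamma_le H.ha₁ H.ha₂ H.one_le_shapeLam H.one_le_shapeTau
    (h := fun lam tau => min (D.condMean a₁ a₂ b₁ b₂ (S.indicator fun _ => 1) lam tau) 1)
    ((D.measurable_condMean (measurable_const.indicator hS)).min measurable_const)
    (fun _ _ => min_le_right _ _) hA hA' hB hB'

theorem lintegral_fitSq_le (η : D.State) :
    ∫⁻ η', ENNReal.ofReal (D.fitSq η') ∂(D.gibbsKernel a₁ a₂ b₁ b₂ η) ≤
      ENNReal.ofReal (16 * Λ / D.rBar * (1 + D.optLam b₁ / D.rateLam b₁ η) *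
        D.rateTau b₂ η) := by
  have hA := H.rateLam_pos η
  have hB := H.rateTau_pos η
  have hA' := H.optLam_pos
  have hN := H.total_pos
  have hq := H.qR_pos
  have hr := H.rBar_pos
  have hΛ := H.hΛ
  have hα := H.shapeLam_le
  have hα0 := H.regular.shapeLam_pos
  have hb := H.hb₁
  have h1 : 1 < D.shapeTau a₂ := by linarith [H.shapeTau_sub_one_ge]
  refine (H.regular.lintegral_norm_sq_predMap_le h1 η).trans (ENNReal.ofReal_le_ofReal ?_)
  have hS : ‖D.centMap D.lsq‖ ^ 2 ≤ 2 * D.optLam b₁ := by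
    unfold optLam
    linarith
  have e1 : D.shapeLam a₁ / D.rateLam b₁ η * ‖D.centMap D.lsq‖ ^ 2 ≤
      4 * Λ * q * (D.optLam b₁ / D.rateLam b₁ η) := by
    calc _ ≤ (Λ * q) / D.rateLam b₁ η * (2 * D.optLam b₁) := by gcongr
      _ = 2 * (Λ * q * (D.optLam b₁ / D.rateLam b₁ η)) := by ring
      _ ≤ 4 * (Λ * q * (D.optLam b₁ / D.rateLam b₁ η)) := by gcongr; norm_num
      _ = _ := by ring
  have e2 : D.rateTau b₂ η / (D.shapeTau a₂ - 1) ≤ D.rateTau b₂ η / (D.total / 4) := by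
    have := H.shapeTau_sub_one_ge
    gcongr
  have e3 := H.dim_le
  calc _ ≤ (4 * Λ * q + 4 * Λ * q * (D.optLam b₁ / D.rateLam b₁ η)) *
        (D.rateTau b₂ η / (D.total / 4)) := by
        refine mul_le_mul (by linarith) e2 ?_ (by positivity)
        have : 0 < D.shapeTau a₂ - 1 := by linarith
        positivity
    _ = _ := by
        rw [H.total_eq]
        field_simp
        ring

theorem lintegral_devOf_sq_le (η : D.State) :
    ∫⁻ η', ENNReal.ofReal (D.devOf η' ^ 2) ∂(D.gibbsKernel a₁ a₂ b₁ b₂ η) ≤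
      ENNReal.ofReal (32 * D.rateLam b₁ η / q) := by
  have hA := H.rateLam_pos η
  have hq := H.qR_pos
  have h := H.shapeLam_sub_one_ge
  refine (H.regular.lintegral_devOf_sq_le (by linarith) η).trans (ENNReal.ofReal_le_ofReal ?_)
  calc _ ≤ 8 * (D.rateLam b₁ η / (q / 4)) := by gcongr
    _ = _ := by ring

/-- One-step mean of a function dominated by the two second moments. -/
theorem lintegral_le_moments {f : D.State → ℝ} {c₀ c₁ c₂ : ℝ} (h0 : 0 ≤ c₀) (h1 : 0 ≤ c₁)
    (h2 : 0 ≤ c₂) (hf : ∀ η, f η ≤ c₀ + c₁ * D.fitSq η + c₂ * D.devOf η ^ 2) (η : D.State) :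
    ∫⁻ η', ENNReal.ofReal (f η') ∂(D.gibbsKernel a₁ a₂ b₁ b₂ η) ≤
      ENNReal.ofReal (c₀ + c₁ * (16 * Λ / D.rBar * (1 + D.optLam b₁ / D.rateLam b₁ η) *
        D.rateTau b₂ η) + c₂ * (32 * D.rateLam b₁ η / q)) := by
  have := H.regular.isMarkovKernel
  have hA := H.rateLam_pos η
  have hB := H.rateTau_pos η
  have hA' := H.optLam_pos
  have hr := H.rBar_pos
  have hΛ := H.hΛ
  have hq := H.qR_pos
  have m1 : Measurable fun η => ENNReal.ofReal (D.fitSq η) := by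
    have : Continuous fun η => D.fitSq η := by
      have := D.continuous_coreOf
      unfold fitSq
      fun_prop
    exact this.measurable.ennreal_ofReal
  have m2 : Measurable fun η => ENNReal.ofReal (D.devOf η ^ 2) :=
    (D.continuous_devOf.pow 2).measurable.ennreal_ofReal
  calc _ ≤ ∫⁻ η', (ENNReal.ofReal c₀ + ENNReal.ofReal c₁ * ENNReal.ofReal (D.fitSq η') +
        ENNReal.ofReal c₂ * ENNReal.ofReal (D.devOf η' ^ 2))
          ∂(D.gibbsKernel a₁ a₂ b₁ b₂ η) := by
        refine lintegral_mono fun η' => ?_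
        have := D.fitSq_nonneg η'
        rw [← ENNReal.ofReal_mul h1, ← ENNReal.ofReal_mul h2,
          ← ENNReal.ofReal_add h0 (by positivity), ← ENNReal.ofReal_add (by positivity)
            (by positivity)]
        exact ENNReal.ofReal_le_ofReal (hf η')
    _ = ENNReal.ofReal c₀ + ENNReal.ofReal c₁ *
          ∫⁻ η', ENNReal.ofReal (D.fitSq η') ∂(D.gibbsKernel a₁ a₂ b₁ b₂ η) +
        ENNReal.ofReal c₂ *
          ∫⁻ η', ENNReal.ofReal (D.devOf η' ^ 2) ∂(D.gibbsKernel a₁ a₂ b₁ b₂ η) := by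
        rw [lintegral_add_right _ (m2.const_mul _), lintegral_add_right _ (m1.const_mul _),
          lintegral_const_mul _ m1, lintegral_const_mul _ m2]
        simp
    _ ≤ _ := by
        rw [ENNReal.ofReal_add (by positivity) (by positivity),
          ENNReal.ofReal_add h0 (by positivity), ENNReal.ofReal_mul h1, ENNReal.ofReal_mul h2]
        have e1 := H.lintegral_fitSq_le η
        have e2 := H.lintegral_devOf_sq_le η
        gcongr

theorem lintegral_lyap_le (η : D.State) :
    ∫⁻ η', ENNReal.ofReal (D.lyap b₁ b₂ η') ∂(D.gibbsKernel a₁ a₂ b₁ b₂ η) ≤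
      ENNReal.ofReal (5 + (2 * Λ ^ 2 / D.rBar + 1 / (2 * D.optTau b₂)) *
        (48 * Λ ^ 4 * q / D.rBar * D.rateTau b₂ η) +
          16 / q * (D.rateLam b₁ η / D.optLam b₁)) := by
  have hA := H.rateLam_pos η
  have hB := H.rateTau_pos η
  have hA' := H.optLam_pos
  have hB' := H.optTau_pos
  have hr := H.rBar_pos
  have hΛ := H.hΛ
  have hq := H.qR_pos
  refine (H.lintegral_le_moments (by norm_num) (by positivity) (by positivity) H.lyap_le η).trans
    (ENNReal.ofReal_le_ofReal ?_)
  have h := H.optLam_div_rateLam_le η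
  refine add_le_add ?_ (le_of_eq ?_)
  · have : 16 * Λ / D.rBar * (1 + D.optLam b₁ / D.rateLam b₁ η) * D.rateTau b₂ η ≤
        48 * Λ ^ 4 * q / D.rBar * D.rateTau b₂ η := by
      calc _ ≤ 16 * Λ / D.rBar * (3 * Λ ^ 3 * q) * D.rateTau b₂ η := by gcongr
        _ = _ := by ring
    gcongr
  · field_simp
    norm_num

/-- Drift condition with a small multiplicative constant. -/
theorem drift_lyap (η : D.State) :
    ∫⁻ η', ENNReal.ofReal (D.lyap b₁ b₂ η') ∂(D.gibbsKernel a₁ a₂ b₁ b₂ η) ≤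
      ENNReal.ofReal (5 + 216 * Λ ^ 7 * ((q : ℝ) ^ 2 / D.rBar + 1 / q) * D.lyap b₁ b₂ η) := by
  have hA := H.rateLam_pos η
  have hB := H.rateTau_pos η
  have hA' := H.optLam_pos
  have hB' := H.optTau_pos
  have hr := H.rBar_pos
  have hΛ := H.hΛ
  have hq := H.qR_pos
  have hq4 := H.hq
  refine (H.lintegral_lyap_le η).trans (ENNReal.ofReal_le_ofReal ?_)
  set b := D.rateTau b₂ η / D.optTau b₂ with hb
  set a := D.rateLam b₁ η / D.optLam b₁ with ha
  have ha0 : 0 ≤ a := by positivity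
  have hb0 : 0 ≤ b := by positivity
  have hc0 : 0 ≤ D.optLam b₁ / D.rateLam b₁ η := by positivity
  have hW : a + b ≤ D.lyap b₁ b₂ η := by
    unfold lyap
    linarith
  have hBe : D.rateTau b₂ η = D.optTau b₂ * b := by rw [hb]; field_simp
  have e1 : 2 * Λ ^ 2 / D.rBar * (48 * Λ ^ 4 * q / D.rBar * D.rateTau b₂ η) ≤
      192 * Λ ^ 7 * ((q : ℝ) ^ 2 / D.rBar) * b := by
    calc _ ≤ 2 * Λ ^ 2 / D.rBar * (48 * Λ ^ 4 * q / D.rBar * ((2 * Λ * D.total) * b)) := by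
          rw [hBe]
          have := H.optTau_le
          gcongr
      _ = _ := by
          rw [H.total_eq]
          field_simp
          ring
  have e2 : 1 / (2 * D.optTau b₂) * (48 * Λ ^ 4 * q / D.rBar * D.rateTau b₂ η) ≤
      24 * Λ ^ 7 * ((q : ℝ) ^ 2 / D.rBar) * b := by
    calc _ = 24 * Λ ^ 4 * ((q : ℝ) ^ 1 / D.rBar) * b := by
          rw [hBe]
          field_simp
          ring
      _ ≤ _ := by
          have : Λ ^ 4 ≤ Λ ^ 7 := pow_le_pow_right₀ hΛ (by norm_num)
          have : (q : ℝ) ^ 1 ≤ (q : ℝ) ^ 2 := pow_le_pow_right₀ (by linarith) (by norm_num)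
          gcongr
  have hP : 1 ≤ Λ ^ 7 := one_le_pow₀ hΛ
  have e3 : 16 / q * a ≤ 216 * Λ ^ 7 * (1 / q) * a := by
    have : 16 / (q : ℝ) ≤ 216 * Λ ^ 7 * (1 / q) := by
      rw [mul_one_div]
      gcongr
      linarith
    gcongr
  have e4 : 216 * Λ ^ 7 * ((q : ℝ) ^ 2 / D.rBar + 1 / q) * (a + b) ≤
      216 * Λ ^ 7 * ((q : ℝ) ^ 2 / D.rBar + 1 / q) * D.lyap b₁ b₂ η := by gcongr
  have e5 : 0 ≤ 216 * Λ ^ 7 * ((q : ℝ) ^ 2 / D.rBar) * a := by positivity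
  have e6 : 0 ≤ 216 * Λ ^ 7 * (1 / q) * b := by positivity
  linarith

/-- The Lyapunov function after one step, in terms of the size: this bounds it uniformly in the
initial state after three steps. -/
theorem lintegral_lyap_le_size (η : D.State) :
    ∫⁻ η', ENNReal.ofReal (D.lyap b₁ b₂ η') ∂(D.gibbsKernel a₁ a₂ b₁ b₂ η) ≤
      ENNReal.ofReal (117 * Λ ^ 6) * (ENNReal.ofReal (D.size b₁ b₂ η) +
        ENNReal.ofReal (q / D.rBar) * ENNReal.ofReal (D.lyap b₁ b₂ η)) := by
  have hA := H.rateLam_pos η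
  have hB := H.rateTau_pos η
  have hA' := H.optLam_pos
  have hB' := H.optTau_pos
  have hr := H.rBar_pos
  have hΛ := H.hΛ
  have hq := H.qR_pos
  have hs := H.one_le_size η
  have hl := H.one_le_lyap η
  rw [← ENNReal.ofReal_mul (by positivity), ← ENNReal.ofReal_add (by positivity) (by positivity),
    ← ENNReal.ofReal_mul (by positivity)]
  refine (H.lintegral_lyap_le η).trans (ENNReal.ofReal_le_ofReal ?_)
  have hP : 1 ≤ Λ ^ 6 := one_le_pow₀ hΛ
  have e1 : 2 * Λ ^ 2 / D.rBar * (48 * Λ ^ 4 * q / D.rBar * D.rateTau b₂ η) ≤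
      96 * Λ ^ 6 * D.size b₁ b₂ η := by
    calc _ ≤ 2 * Λ ^ 2 / D.rBar * (48 * Λ ^ 4 * q / D.rBar * (D.total * D.size b₁ b₂ η)) := by
          have := H.rateTau_le_size η
          gcongr
      _ = 96 * Λ ^ 6 * ((q : ℝ) ^ 2 / D.rBar) * D.size b₁ b₂ η := by
          rw [H.total_eq]
          field_simp
          ring
      _ ≤ 96 * Λ ^ 6 * 1 * D.size b₁ b₂ η := by
          gcongr
          rw [div_le_one hr]
          exact H.hr
      _ = _ := by ring
  have e2 : 1 / (2 * D.optTau b₂) * (48 * Λ ^ 4 * q / D.rBar * D.rateTau b₂ η) ≤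
      117 * Λ ^ 6 * (q / D.rBar * D.lyap b₁ b₂ η) := by
    have h0 : D.rateTau b₂ η / D.optTau b₂ ≤ D.lyap b₁ b₂ η := by
      have : 0 ≤ D.optLam b₁ / D.rateLam b₁ η := by positivity
      have : 0 ≤ D.rateLam b₁ η / D.optLam b₁ := by positivity
      unfold lyap
      linarith
    calc _ = 24 * Λ ^ 4 * (q / D.rBar * (D.rateTau b₂ η / D.optTau b₂)) := by
          field_simp
          ring
      _ ≤ _ := by
          have : Λ ^ 4 ≤ Λ ^ 6 := pow_le_pow_right₀ hΛ (by norm_num)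
          gcongr
          norm_num
  have e3 : 16 / q * (D.rateLam b₁ η / D.optLam b₁) ≤ 16 * Λ ^ 6 * D.size b₁ b₂ η := by
    calc _ = 16 / q * (D.rateLam b₁ η * (1 / D.optLam b₁)) := by ring
      _ ≤ 16 / q * ((q * D.size b₁ b₂ η) * Λ) := by
          have := H.rateLam_le_size η
          have := H.one_div_le_of_le (D.le_optLam b₁)
          gcongr
      _ = 16 * Λ * D.size b₁ b₂ η := by field_simp
      _ ≤ _ := by
          have : Λ ≤ Λ ^ 6 := le_self_pow₀ hΛ (by norm_num)
          gcongr
  have e4 : 5 ≤ 5 * (Λ ^ 6 * D.size b₁ b₂ η) := by nlinarith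
  linarith

/-- The size grows at most by a constant factor in one step, unlike the Lyapunov function, whose
reference values depend on the least squares fit. -/
theorem lintegral_size_le (η : D.State) :
    ∫⁻ η', ENNReal.ofReal (D.size b₁ b₂ η') ∂(D.gibbsKernel a₁ a₂ b₁ b₂ η) ≤
      ENNReal.ofReal (119 * Λ ^ 5) * ENNReal.ofReal (D.size b₁ b₂ η) := by
  have hA := H.rateLam_pos η
  have hB := H.rateTau_pos η
  have hA' := H.optLam_pos
  have hr := H.rBar_pos
  have hΛ := H.hΛ
  have hq := H.qR_pos
  have hN := H.total_pos
  have hs := H.one_le_size η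
  rw [← ENNReal.ofReal_mul (by positivity)]
  have hle : ∀ η', D.size b₁ b₂ η' ≤ 7 * Λ ^ 2 + 2 * Λ / D.total * D.fitSq η' +
      1 / (2 * q) * D.devOf η' ^ 2 := fun η' => by
    have hX := D.fitSq_nonneg η'
    have h1 : D.rateLam b₁ η' / q ≤ 4 * Λ ^ 2 + Λ / D.total * D.fitSq η' +
        1 / (2 * q) * D.devOf η' ^ 2 := by
      calc _ ≤ (2 * (2 * Λ ^ 2 * q) + Λ / D.rBar * D.fitSq η' + D.devOf η' ^ 2 / 2) / q := by
            have := H.rateLam_le_optLam η'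
            have := H.optLam_le
            gcongr
            linarith
        _ = _ := by
            rw [H.total_eq]
            field_simp
            ring
    have h2 : D.rateTau b₂ η' / D.total ≤ 2 * Λ + Λ / D.total * D.fitSq η' := by
      calc _ ≤ (2 * Λ * D.total + Λ * D.fitSq η') / D.total := by
            rw [rateTau_eq_fitSq]
            have := H.optTau_le
            gcongr
            nlinarith
        _ = _ := by field_simp
    have h3 : Λ ≤ Λ ^ 2 := le_self_pow₀ hΛ (by norm_num)
    have h4 : 2 * Λ / D.total * D.fitSq η' =
        Λ / D.total * D.fitSq η' + Λ / D.total * D.fitSq η' := by ring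
    unfold size
    linarith
  refine (H.lintegral_le_moments (by positivity) (by positivity) (by positivity) hle η).trans
    (ENNReal.ofReal_le_ofReal ?_)
  have hP : 1 ≤ Λ ^ 5 := one_le_pow₀ hΛ
  have e1 : 2 * Λ / D.total * (16 * Λ / D.rBar * (1 + D.optLam b₁ / D.rateLam b₁ η) *
      D.rateTau b₂ η) ≤ 96 * Λ ^ 5 * D.size b₁ b₂ η := by
    calc _ ≤ 2 * Λ / D.total * (16 * Λ / D.rBar * (3 * Λ ^ 3 * q) *
          (D.total * D.size b₁ b₂ η)) := by
          have := H.rateTau_le_size η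
          have := H.optLam_div_rateLam_le η
          gcongr
      _ = 96 * Λ ^ 5 * (q / D.rBar) * D.size b₁ b₂ η := by
          field_simp
          ring
      _ ≤ 96 * Λ ^ 5 * 1 * D.size b₁ b₂ η := by
          gcongr
          rw [div_le_one hr]
          nlinarith [H.hr, H.hq]
      _ = _ := by ring
  have e2 : 1 / (2 * q) * (32 * D.rateLam b₁ η / q) ≤ 16 * Λ ^ 5 * D.size b₁ b₂ η := by
    calc _ ≤ 1 / (2 * q) * (32 * (q * D.size b₁ b₂ η) / q) := by
          have := H.rateLam_le_size η
          gcongr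
      _ = 16 * (1 / q) * D.size b₁ b₂ η := by
          field_simp
          ring
      _ ≤ 16 * Λ ^ 5 * D.size b₁ b₂ η := by
          gcongr
          refine le_trans ?_ hP
          rw [div_le_one hq]
          linarith [H.hq]
  have e3 : 7 * Λ ^ 2 ≤ 7 * Λ ^ 5 * D.size b₁ b₂ η := by
    have : Λ ^ 2 ≤ Λ ^ 5 := pow_le_pow_right₀ hΛ (by norm_num)
    nlinarith
  linarith

/-- Relative distance of `rateLam` from its value at the least squares estimate. -/
theorem abs_rateLam_sub_optLam_le (η : D.State) {s : ℝ} (hs : 0 < s) :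
    |D.rateLam b₁ η - D.optLam b₁| / (D.rateLam b₁ η + D.optLam b₁) ≤
      Λ * (s + Λ / D.rBar * D.fitSq η / s) / 2 + 1 / (2 * D.optLam b₁) * D.devOf η ^ 2 := by
  have hA := H.rateLam_pos η
  have hA' := H.optLam_pos
  have hΛ := H.hΛ
  have hb := H.hb₁
  have hb' := H.one_le_b₁
  set x := ‖D.centMap (D.coreOf η)‖ with hx
  set y := ‖D.centMap D.lsq‖ with hy
  set t := ‖D.centMap (D.coreOf η) - D.centMap D.lsq‖ with ht
  have hx0 : 0 ≤ x := norm_nonneg _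
  have hy0 : 0 ≤ y := norm_nonneg _
  have ht0 : 0 ≤ t := norm_nonneg _
  have hxy : |x - y| ≤ t := abs_norm_sub_norm_le _ _
  have ht2 : t ^ 2 ≤ Λ / D.rBar * D.fitSq η := H.norm_centMap_sub_sq_le η
  have hAe : D.rateLam b₁ η = b₁ + x ^ 2 / 2 + D.devOf η ^ 2 / 2 := D.rateLam_eq H.q_pos b₁ η
  have hA'e : D.optLam b₁ = b₁ + y ^ 2 / 2 := rfl
  -- the factor `x + y` from the difference of squares is absorbed by the sum of the rates
  have hsum : x + y ≤ 2 * Λ * (D.rateLam b₁ η + D.optLam b₁) := by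
    have h1 : 4 * b₁ + (x ^ 2 + y ^ 2) ≤ 2 * (D.rateLam b₁ η + D.optLam b₁) := by
      rw [hAe, hA'e]
      nlinarith [sq_nonneg (D.devOf η)]
    have h2 : x + y ≤ Λ * (4 * b₁ + (x ^ 2 + y ^ 2)) := by
      nlinarith [sq_nonneg (x - 1), sq_nonneg (y - 1), mul_nonneg (sub_nonneg.2 hΛ) (sq_nonneg x),
        mul_nonneg (sub_nonneg.2 hΛ) (sq_nonneg y)]
    nlinarith
  have hd : |D.rateLam b₁ η - D.optLam b₁| ≤ t * (x + y) / 2 + D.devOf η ^ 2 / 2 := by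
    have e : D.rateLam b₁ η - D.optLam b₁ = (x - y) * (x + y) / 2 + D.devOf η ^ 2 / 2 := by
      rw [hAe, hA'e]
      ring
    rw [e]
    refine (abs_add_le _ _).trans ?_
    rw [abs_of_nonneg (by positivity : 0 ≤ D.devOf η ^ 2 / 2), abs_div, abs_mul,
      abs_of_nonneg (by positivity : 0 ≤ x + y), abs_of_pos (by norm_num : (0 : ℝ) < 2)]
    gcongr
  have hts : t ≤ (s + Λ / D.rBar * D.fitSq η / s) / 2 := by
    have h1 : t ≤ (s + t ^ 2 / s) / 2 := by
      have : s + t ^ 2 / s - 2 * t = (s - t) ^ 2 / s := by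
        field_simp
        ring
      have : 0 ≤ (s - t) ^ 2 / s := by positivity
      linarith
    refine h1.trans ?_
    gcongr
  calc _ ≤ (t * (2 * Λ * (D.rateLam b₁ η + D.optLam b₁)) / 2 + D.devOf η ^ 2 / 2) /
        (D.rateLam b₁ η + D.optLam b₁) := by
        gcongr
        refine hd.trans ?_
        gcongr
    _ = Λ * t + D.devOf η ^ 2 / 2 / (D.rateLam b₁ η + D.optLam b₁) := by field_simp
    _ ≤ Λ * ((s + Λ / D.rBar * D.fitSq η / s) / 2) + D.devOf η ^ 2 / 2 / D.optLam b₁ := by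
        gcongr
        linarith
    _ = _ := by
        field_simp

theorem abs_rateTau_sub_optTau_le (η : D.State) :
    |D.rateTau b₂ η - D.optTau b₂| / (D.rateTau b₂ η + D.optTau b₂) ≤
      1 / (2 * D.optTau b₂) * D.fitSq η := by
  have hB := H.optTau_pos
  have hX := D.fitSq_nonneg η
  rw [rateTau_eq_fitSq, add_sub_cancel_left, abs_of_nonneg (by positivity)]
  calc _ ≤ D.fitSq η / 2 / D.optTau b₂ := by
        gcongr
        linarith
    _ = _ := by field_simp

theorem sqrt_shapeLam_le : √(D.shapeLam a₁) ≤ Λ * √(q : ℝ) := by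
  have hΛ := H.hΛ
  refine Real.sqrt_le_iff.2 ⟨by positivity, ?_⟩
  rw [mul_pow, Real.sq_sqrt H.qR_pos.le]
  refine H.shapeLam_le.trans ?_
  have : Λ ≤ Λ ^ 2 := le_self_pow₀ hΛ (by norm_num)
  gcongr

theorem sqrt_shapeTau_le : √(D.shapeTau a₂) ≤ Λ * (√D.rBar * √(q : ℝ)) := by
  have hΛ := H.hΛ
  have hr := H.rBar_pos
  refine Real.sqrt_le_iff.2 ⟨by positivity, ?_⟩
  rw [mul_pow, mul_pow, Real.sq_sqrt H.qR_pos.le, Real.sq_sqrt hr.le, ← H.total_eq]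
  refine H.shapeTau_le.trans ?_
  have : Λ ≤ Λ ^ 2 := le_self_pow₀ hΛ (by norm_num)
  gcongr

/-- After one step from a sublevel set of the Lyapunov function, the conditional laws of the
precisions are close to those at the least squares estimate. -/
theorem lintegral_mixGap_le {R : ℝ} (hR : 1 ≤ R) (η : D.State) (hη : D.lyap b₁ b₂ η ≤ R ^ 2) :
    ∫⁻ η', ENNReal.ofReal (D.mixGap a₁ a₂ (D.rateLam b₁ η') (D.optLam b₁) (D.rateTau b₂ η')
        (D.optTau b₂)) ∂(D.gibbsKernel a₁ a₂ b₁ b₂ η) ≤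
      ENNReal.ofReal (150 * Λ ^ 5 * R ^ 4 * (q / √D.rBar + 1 / √(q : ℝ))) := by
  have hA := H.rateLam_pos η
  have hB := H.rateTau_pos η
  have hA' := H.optLam_pos
  have hB' := H.optTau_pos
  have hΛ := H.hΛ
  have hqp := H.qR_pos
  have hrp := H.rBar_pos
  have hsq : 0 < √(q : ℝ) := Real.sqrt_pos.2 hqp
  have hsr : 0 < √D.rBar := Real.sqrt_pos.2 hrp
  have hsq2 : (q : ℝ) = √(q : ℝ) ^ 2 := (Real.sq_sqrt hqp.le).symm
  have hsr2 : D.rBar = √D.rBar ^ 2 := (Real.sq_sqrt hrp.le).symm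
  have hN := H.total_eq
  have hBl := H.optTau_le
  have hs1 : 1 ≤ √(q : ℝ) := Real.one_le_sqrt.2 (by linarith [H.hq])
  have hsα := H.sqrt_shapeLam_le
  have hsβ := H.sqrt_shapeTau_le
  set u := √(q : ℝ) with hu
  set v := √D.rBar with hv
  have hle : ∀ η', D.mixGap a₁ a₂ (D.rateLam b₁ η') (D.optLam b₁) (D.rateTau b₂ η')
      (D.optTau b₂) ≤ 3 * Λ ^ 2 * u ^ 2 / (2 * v) +
        (3 * Λ ^ 3 / (2 * v) + 3 * Λ * u * v / (2 * D.optTau b₂)) * D.fitSq η' +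
        3 * Λ * u / (2 * D.optLam b₁) * D.devOf η' ^ 2 := fun η' => by
    have hX := D.fitSq_nonneg η'
    have h1 := H.abs_rateLam_sub_optLam_le η' (div_pos hsq hsr)
    have h2 := H.abs_rateTau_sub_optTau_le η'
    have hAη := H.rateLam_pos η'
    have hBη := H.rateTau_pos η'
    unfold mixGap
    rw [mul_div_assoc, mul_div_assoc]
    calc _ ≤ 3 * ((Λ * u) * (Λ * (u / v + Λ / D.rBar * D.fitSq η' / (u / v)) / 2 +
          1 / (2 * D.optLam b₁) * D.devOf η' ^ 2)) +
          3 * ((Λ * (v * u)) * (1 / (2 * D.optTau b₂) * D.fitSq η')) := by gcongr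
      _ = _ := by
          rw [hsr2]
          field_simp
          ring
  refine (H.lintegral_le_moments (by positivity) (by positivity) (by positivity) hle η).trans
    (ENNReal.ofReal_le_ofReal ?_)
  have hR2 : 1 ≤ R ^ 2 := one_le_pow₀ hR
  have hR4 : R ^ 2 ≤ R ^ 4 := pow_le_pow_right₀ hR (by norm_num)
  have p1 : 0 ≤ D.rateLam b₁ η / D.optLam b₁ := by positivity
  have p2 : 0 ≤ D.optLam b₁ / D.rateLam b₁ η := by positivity
  have p3 : 0 ≤ D.rateTau b₂ η / D.optTau b₂ := by positivity
  have hη' := hη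
  unfold lyap at hη'
  have c1 : 1 + D.optLam b₁ / D.rateLam b₁ η ≤ 2 * R ^ 2 := by linarith
  have c2 : D.rateTau b₂ η ≤ R ^ 2 * D.optTau b₂ := by
    rw [← div_le_iff₀ hB']
    linarith
  have c3 : D.rateLam b₁ η ≤ R ^ 2 * D.optLam b₁ := by
    rw [← div_le_iff₀ hA']
    linarith
  have c4 : 16 * Λ / D.rBar * (1 + D.optLam b₁ / D.rateLam b₁ η) * D.rateTau b₂ η ≤
      32 * Λ * R ^ 4 / D.rBar * D.optTau b₂ := by
    calc _ ≤ 16 * Λ / D.rBar * (2 * R ^ 2) * (R ^ 2 * D.optTau b₂) := by gcongr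
      _ = _ := by ring
  have L2 : Λ ^ 2 ≤ Λ ^ 5 := pow_le_pow_right₀ hΛ (by norm_num)
  have L1 : Λ ≤ Λ ^ 5 := le_self_pow₀ hΛ (by norm_num)
  have e0 : 3 * Λ ^ 2 * u ^ 2 / (2 * v) ≤ (3 / 2) * (Λ ^ 5 * R ^ 4 * (u ^ 2 / v)) := by
    calc _ = (3 / 2) * (Λ ^ 2 * 1 * (u ^ 2 / v)) := by ring
      _ ≤ _ := by
        gcongr
        linarith
  have e1 : 3 * Λ ^ 3 / (2 * v) * (32 * Λ * R ^ 4 / D.rBar * D.optTau b₂) ≤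
      96 * (Λ ^ 5 * R ^ 4 * (u ^ 2 / v)) := by
    calc _ ≤ 3 * Λ ^ 3 / (2 * v) * (32 * Λ * R ^ 4 / D.rBar * (2 * Λ * (D.rBar * u ^ 2))) := by
          rw [← hsq2, ← hN]
          gcongr
      _ = _ := by
          field_simp
          ring
  have e2 : 3 * Λ * u * v / (2 * D.optTau b₂) * (32 * Λ * R ^ 4 / D.rBar * D.optTau b₂) ≤
      48 * (Λ ^ 5 * R ^ 4 * (u ^ 2 / v)) := by
    calc _ = 48 * (Λ ^ 2 * R ^ 4 * (u ^ 1 / v)) := by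
          rw [hsr2]
          field_simp
          ring
      _ ≤ _ := by
          have : u ^ 1 ≤ u ^ 2 := pow_le_pow_right₀ hs1 (by norm_num)
          gcongr
  have e3 : 3 * Λ * u / (2 * D.optLam b₁) * (32 * D.rateLam b₁ η / q) ≤
      48 * (Λ ^ 5 * R ^ 4 * (1 / u)) := by
    calc _ ≤ 3 * Λ * u / (2 * D.optLam b₁) * (32 * (R ^ 2 * D.optLam b₁) / q) := by gcongr
      _ = 48 * (Λ * R ^ 2 * (1 / u)) := by
          rw [hsq2]
          field_simp
          ring
      _ ≤ _ := by gcongr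
  have e4 : 0 ≤ Λ ^ 5 * R ^ 4 * (1 / u) := by positivity
  have e5 : 0 ≤ Λ ^ 5 * R ^ 4 * (u ^ 2 / v) := by positivity
  have e6 : (3 * Λ ^ 3 / (2 * v) + 3 * Λ * u * v / (2 * D.optTau b₂)) *
      (16 * Λ / D.rBar * (1 + D.optLam b₁ / D.rateLam b₁ η) * D.rateTau b₂ η) ≤
      (3 * Λ ^ 3 / (2 * v) + 3 * Λ * u * v / (2 * D.optTau b₂)) *
      (32 * Λ * R ^ 4 / D.rBar * D.optTau b₂) := by gcongr
  have e7 : 150 * Λ ^ 5 * R ^ 4 * (q / v + 1 / u) =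
      150 * (Λ ^ 5 * R ^ 4 * (u ^ 2 / v)) + 150 * (Λ ^ 5 * R ^ 4 * (1 / u)) := by
    rw [← hsq2]
    ring
  rw [e7]
  linarith

/-- Two states in a sublevel set of the Lyapunov function have close two-step laws. -/
theorem excessMass_le {R : ℝ} (hR : 1 ≤ R) (η η' : D.State) (hη : D.lyap b₁ b₂ η ≤ R ^ 2)
    (hη' : D.lyap b₁ b₂ η' ≤ R ^ 2) :
    excessMass volume (twoStep volume (D.transDensity a₁ a₂ b₁ b₂)) η η' ≤
      ENNReal.ofReal (300 * Λ ^ 5 * R ^ 4 * (q / √D.rBar + 1 / √(q : ℝ))) := by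
  have := H.regular.isMarkovKernel
  have hq := H.qR_pos
  have hr := H.rBar_pos
  have hΛ := H.hΛ
  have hm : Measurable fun η => ENNReal.ofReal (D.mixGap a₁ a₂ (D.rateLam b₁ η) (D.optLam b₁)
      (D.rateTau b₂ η) (D.optTau b₂)) := by
    have h1 := (D.continuous_rateLam b₁).measurable
    have h2 := (D.continuous_rateTau b₂).measurable
    unfold mixGap
    fun_prop
  have hsymm : ∀ A A' B B' : ℝ, D.mixGap a₁ a₂ A A' B B' = D.mixGap a₁ a₂ A' A B' B :=
    fun A A' B B' => by
      unfold mixGap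
      rw [abs_sub_comm A, abs_sub_comm B, add_comm A, add_comm B]
  refine (excessMass_twoStep_le volume (D.measurable_transDensity a₁ a₂ b₁ b₂)
    (D.gibbsKernel_apply a₁ a₂ b₁ b₂)
    (G := D.mixLaw a₁ a₂ b₁ b₂ (D.optLam b₁) (D.optTau b₂)) hm (fun x S hS => ?_)
    (fun x S hS => ?_) η η').trans ?_
  · rw [H.gibbsKernel_eq_mixLaw x hS]
    exact H.mixLaw_le (H.rateLam_pos x) H.optLam_pos (H.rateTau_pos x) H.optTau_pos hS
  · rw [H.gibbsKernel_eq_mixLaw x hS, hsymm]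
    exact H.mixLaw_le H.optLam_pos (H.rateLam_pos x) H.optTau_pos (H.rateTau_pos x) hS
  · refine (add_le_add (H.lintegral_mixGap_le hR η hη) (H.lintegral_mixGap_le hR η' hη')).trans ?_
    rw [← ENNReal.ofReal_add (by positivity) (by positivity)]
    refine ENNReal.ofReal_le_ofReal (le_of_eq ?_)
    ring

end

end Bounds

end MixedModelData

end DriftOverlap

/-! ### Convergence of the chain for one data set -/

noncomputable section Convergence

/-- A linear recursion for two moments. -/
theorem moment_recursion {L S : ℕ → ℝ≥0∞} {c ζ N : ℝ≥0∞} (hc : 1 ≤ c) (hζ : ζ ≤ 1)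
    (hL : ∀ n, L (n + 1) ≤ c * (S n + ζ * L n)) (hS : ∀ n, S (n + 1) ≤ c * S n)
    (h0 : L 0 ≤ c * N * S 0) (n : ℕ) :
    S n ≤ c ^ n * S 0 ∧ L n ≤ (2 * c) ^ (n + 1) * (1 + ζ ^ n * N) * S 0 := by
  induction n with
  | zero =>
    refine ⟨by simp, h0.trans ?_⟩
    simp only [zero_add, pow_one, pow_zero, one_mul]
    gcongr
    · exact le_mul_of_one_le_left zero_le one_le_two
    · exact le_add_self
  | succ n ih =>
    obtain ⟨h1, h2⟩ := ih
    have hcn : c ^ n ≤ (2 * c) ^ (n + 1) := by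
      calc c ^ n ≤ (2 * c) ^ n := by
            gcongr
            exact le_mul_of_one_le_left zero_le one_le_two
        _ ≤ (2 * c) ^ (n + 1) := by
            refine pow_le_pow_right₀ ?_ n.le_succ
            exact hc.trans (le_mul_of_one_le_left zero_le one_le_two)
    refine ⟨(hS n).trans ?_, (hL n).trans ?_⟩
    · rw [pow_succ', mul_assoc]
      gcongr
    · calc c * (S n + ζ * L n) ≤
          c * ((2 * c) ^ (n + 1) * S 0 + ζ * ((2 * c) ^ (n + 1) * (1 + ζ ^ n * N) * S 0)) := by
            have := h1.trans (mul_le_mul_left hcn (S 0))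
            gcongr
        _ = c * (2 * c) ^ (n + 1) * (1 + ζ + ζ ^ (n + 1) * N) * S 0 := by ring
        _ ≤ c * (2 * c) ^ (n + 1) * (1 + 1 + 2 * (ζ ^ (n + 1) * N)) * S 0 := by
            have : ζ ^ (n + 1) * N ≤ 2 * (ζ ^ (n + 1) * N) :=
              le_mul_of_one_le_left zero_le (one_le_two (α := ℝ≥0∞))
            exact mul_le_mul_left (mul_le_mul_right (add_le_add (add_le_add le_rfl hζ) this) _) _
        _ = _ := by ring

/-- Rates which are quadratic in `s` are relatively Lipschitz in `s`. -/
theorem abs_sub_div_add_le {Λ b s s' : ℝ} (hb : 0 < b) (hΛ : 1 ≤ Λ) (hΛb : 1 ≤ Λ * b) (hs : 0 ≤ s)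
    (hs' : 0 ≤ s') :
    |(b + s ^ 2 / 2) - (b + s' ^ 2 / 2)| / ((b + s ^ 2 / 2) + (b + s' ^ 2 / 2)) ≤ Λ * |s - s'| := by
  have hsum : s + s' ≤ 2 * Λ * ((b + s ^ 2 / 2) + (b + s' ^ 2 / 2)) := by
    nlinarith [sq_nonneg (s - 1), sq_nonneg (s' - 1), mul_nonneg (sub_nonneg.2 hΛ) (sq_nonneg s),
      mul_nonneg (sub_nonneg.2 hΛ) (sq_nonneg s')]
  have e : (b + s ^ 2 / 2) - (b + s' ^ 2 / 2) = (s - s') * (s + s') / 2 := by ring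
  rw [e, abs_div, abs_mul, abs_of_nonneg (by positivity : 0 ≤ s + s'),
    abs_of_pos (by norm_num : (0 : ℝ) < 2), div_le_iff₀ (by positivity)]
  nlinarith [abs_nonneg (s - s')]

namespace MixedModelData

variable {q : ℕ} (D : MixedModelData q) {a₁ a₂ b₁ b₂ : ℝ}

/-- Deviations `u i - μ` of the effects from their prior mean. -/
def devVec (η : D.State) : EuclideanSpace ℝ (Fin q) :=
  WithLp.toLp 2 fun i => η.effect i - η.meanPart / √(q : ℝ)

theorem effSq_eq_devVec (η : D.State) : D.effSq η = ‖D.devVec η‖ ^ 2 := by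
  rw [EuclideanSpace.real_norm_sq_eq]
  rfl

theorem norm_devVec_sub_le (hq : 0 < q) (η η' : D.State) :
    ‖D.devVec η - D.devVec η'‖ ≤ 2 * ‖η - η'‖ := by
  have hq' : (0 : ℝ) < q := by exact_mod_cast hq
  have e : D.devVec η - D.devVec η' = D.devVec (η - η') := by
    ext i
    simp only [devVec, PiLp.sub_apply, State.effect, State.meanPart]
    ring
  rw [e]
  set x := η - η'
  refine le_of_sq_le_sq ?_ (by positivity)
  have h1 : ‖x‖ ^ 2 = ∑ k, x (Sum.inl k) ^ 2 + (x (Sum.inr (Sum.inl ())) ^ 2 +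
      ∑ i, x (Sum.inr (Sum.inr i)) ^ 2) := by
    rw [EuclideanSpace.real_norm_sq_eq, Fintype.sum_sum_type, Fintype.sum_sum_type]
    simp
  have h2 : ‖D.devVec x‖ ^ 2 ≤ 2 * ∑ i, x (Sum.inr (Sum.inr i)) ^ 2 +
      2 * x (Sum.inr (Sum.inl ())) ^ 2 := by
    rw [← effSq_eq_devVec]
    calc D.effSq x ≤ ∑ i : Fin q, (2 * x (Sum.inr (Sum.inr i)) ^ 2 +
          2 * (x (Sum.inr (Sum.inl ())) ^ 2 / q)) := by
          refine Finset.sum_le_sum fun i _ => ?_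
          have : x (Sum.inr (Sum.inl ())) ^ 2 / q =
              (x (Sum.inr (Sum.inl ())) / √(q : ℝ)) ^ 2 := by
            rw [div_pow, Real.sq_sqrt hq'.le]
          rw [this]
          unfold State.effect State.meanPart
          nlinarith [sq_nonneg (x (Sum.inr (Sum.inr i)) + x (Sum.inr (Sum.inl ())) / √(q : ℝ))]
      _ = _ := by
          rw [Finset.sum_add_distrib, ← Finset.mul_sum, Finset.sum_const, Finset.card_univ,
            Fintype.card_fin, nsmul_eq_mul]
          field_simp
  have h3 : 0 ≤ ∑ k, x (Sum.inl k) ^ 2 := Finset.sum_nonneg fun _ _ => sq_nonneg _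
  have h4 : 0 ≤ ∑ i, x (Sum.inr (Sum.inr i)) ^ 2 := Finset.sum_nonneg fun _ _ => sq_nonneg _
  nlinarith [sq_nonneg (x (Sum.inr (Sum.inl ())))]

theorem norm_coreOf_sub_le (η η' : D.State) : ‖D.coreOf η - D.coreOf η'‖ ≤ ‖η - η'‖ := by
  have e : D.coreOf η - D.coreOf η' = D.coreOf (η - η') := by
    ext i
    rcases i with i | i <;> simp [coreOf]
  rw [e]
  set x := η - η'
  refine le_of_sq_le_sq ?_ (norm_nonneg _)
  rw [norm_core_sq, EuclideanSpace.real_norm_sq_eq, Fintype.sum_sum_type, Fintype.sum_sum_type]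
  simp only [coreOf, Sum.elim_inl, Sum.elim_inr, Finset.univ_unique, Finset.sum_singleton]
  nlinarith [sq_nonneg (x (Sum.inr (Sum.inl default)))]

theorem driftV_nonneg (η : D.State) : 0 ≤ D.driftV η := by
  have : 0 ≤ D.rBar := by unfold rBar; positivity
  unfold driftV
  positivity

namespace Bounds

variable {D} {Λ : ℝ} (H : D.Bounds a₁ a₂ b₁ b₂ Λ)

section
include H

/-- The laws of the precisions depend on the state in a Lipschitz way in total variation, since the
square roots of the sums of squares do. -/
theorem mixGap_le (η η' : D.State) :
    D.mixGap a₁ a₂ (D.rateLam b₁ η) (D.rateLam b₁ η') (D.rateTau b₂ η) (D.rateTau b₂ η') ≤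
      9 * Λ ^ 3 * q * D.rBar ^ (3 / 2 : ℝ) * ‖η - η'‖ := by
  have hΛ := H.hΛ
  have hq := H.qR_pos
  have hr := H.rBar_pos
  have hb₁ := H.hb₁
  have hb₂ := H.hb₂
  have hr1 : 1 ≤ √D.rBar := Real.one_le_sqrt.2 (by linarith [H.rBar_ge])
  have hq1 : 1 ≤ √(q : ℝ) := Real.one_le_sqrt.2 (by linarith [H.hq])
  have hr2 : √D.rBar ^ 2 = D.rBar := Real.sq_sqrt hr.le
  have hq2 : √(q : ℝ) ^ 2 = q := Real.sq_sqrt hq.le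
  have hpow : D.rBar ^ (3 / 2 : ℝ) = √D.rBar ^ 3 := by
    rw [Real.sqrt_eq_rpow, ← Real.rpow_natCast, ← Real.rpow_mul hr.le]
    norm_num
  have h1 : |D.rateLam b₁ η - D.rateLam b₁ η'| / (D.rateLam b₁ η + D.rateLam b₁ η') ≤
      Λ * (2 * ‖η - η'‖) := by
    rw [rateLam, rateLam, effSq_eq_devVec, effSq_eq_devVec]
    refine (abs_sub_div_add_le hb₁ hΛ H.one_le_b₁ (norm_nonneg _) (norm_nonneg _)).trans ?_
    gcongr
    exact (abs_norm_sub_norm_le _ _).trans (D.norm_devVec_sub_le H.q_pos η η')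
  have h2 : |D.rateTau b₂ η - D.rateTau b₂ η'| / (D.rateTau b₂ η + D.rateTau b₂ η') ≤
      Λ * (Λ * √D.rBar * ‖η - η'‖) := by
    rw [rateTau, rateTau, resSq_eq_norm, resSq_eq_norm]
    refine (abs_sub_div_add_le hb₂ hΛ H.one_le_b₂ (norm_nonneg _) (norm_nonneg _)).trans ?_
    gcongr
    refine (abs_norm_sub_norm_le _ _).trans ?_
    rw [sub_sub_sub_cancel_left, ← map_sub]
    refine le_of_sq_le_sq ((H.predMap_le _).trans ?_) (by positivity)
    rw [mul_pow, mul_pow, hr2]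
    have : Λ ≤ Λ ^ 2 := le_self_pow₀ hΛ (by norm_num)
    have := D.norm_coreOf_sub_le η' η
    rw [norm_sub_rev η' η] at this
    gcongr
  have hα := H.sqrt_shapeLam_le
  have hβ := H.sqrt_shapeTau_le
  have hA := H.rateLam_pos η
  have hA' := H.rateLam_pos η'
  have hB := H.rateTau_pos η
  have hB' := H.rateTau_pos η'
  unfold mixGap
  rw [mul_div_assoc, mul_div_assoc, hpow]
  set u := √(q : ℝ)
  set v := √D.rBar
  have e1 : u ≤ u ^ 2 := le_self_pow₀ hq1 (by norm_num)
  have e2 : v ^ 2 ≤ v ^ 3 := pow_le_pow_right₀ hr1 (by norm_num)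
  have e3 : 1 ≤ v ^ 3 := one_le_pow₀ hr1
  have e4 : Λ ^ 2 ≤ Λ ^ 3 := pow_le_pow_right₀ hΛ (by norm_num)
  calc _ ≤ 3 * ((Λ * u) * (Λ * (2 * ‖η - η'‖))) +
        3 * ((Λ * (v * u)) * (Λ * (Λ * v * ‖η - η'‖))) := by gcongr
    _ = 6 * (Λ ^ 2 * u * 1 * ‖η - η'‖) + 3 * (Λ ^ 3 * u * v ^ 2 * ‖η - η'‖) := by ring
    _ ≤ 6 * (Λ ^ 3 * u ^ 2 * v ^ 3 * ‖η - η'‖) + 3 * (Λ ^ 3 * u ^ 2 * v ^ 3 * ‖η - η'‖) := by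
        gcongr
    _ = _ := by
        rw [hq2]
        ring

/-- Total variation after one more step is controlled by the Wasserstein distance. -/
theorem tvDist_pow_succ_le (η : D.State) (n : ℕ) :
    tvDist ((D.gibbsKernel a₁ a₂ b₁ b₂ ^ (n + 1)) η) (D.posterior a₁ a₂ b₁ b₂) ≤
      ENNReal.ofReal (9 * Λ ^ 3 * q * D.rBar ^ (3 / 2 : ℝ)) *
        wassersteinDist ((D.gibbsKernel a₁ a₂ b₁ b₂ ^ n) η) (D.posterior a₁ a₂ b₁ b₂) := by
  have hΛ := H.hΛ
  have hq := H.qR_pos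
  have hr := Real.rpow_pos_of_pos H.rBar_pos (3 / 2)
  have hc : 0 < 9 * Λ ^ 3 * q * D.rBar ^ (3 / 2 : ℝ) := by positivity
  have h := tvDist_bind_le_mul_wassersteinDist (D.gibbsKernel a₁ a₂ b₁ b₂)
    (c := ENNReal.ofReal (9 * Λ ^ 3 * q * D.rBar ^ (3 / 2 : ℝ))) (ENNReal.ofReal_pos.2 hc).ne'
    ENNReal.ofReal_ne_top (fun x y S hS => by
      rw [H.gibbsKernel_eq_mixLaw x hS, H.gibbsKernel_eq_mixLaw y hS, edist_dist,
        ← ENNReal.ofReal_mul hc.le, dist_eq_norm]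
      refine (H.mixLaw_le (H.rateLam_pos x) (H.rateLam_pos y) (H.rateTau_pos x) (H.rateTau_pos y)
        hS).trans ?_
      gcongr
      exact H.mixGap_le x y)
    ((D.gibbsKernel a₁ a₂ b₁ b₂ ^ n) η) (D.posterior a₁ a₂ b₁ b₂)
  have e1 : (D.gibbsKernel a₁ a₂ b₁ b₂ ^ (n + 1)) η =
      ((D.gibbsKernel a₁ a₂ b₁ b₂ ^ n) η).bind (D.gibbsKernel a₁ a₂ b₁ b₂) := by
    rw [pow_succ']
    exact Kernel.comp_apply _ _ _
  have e2 : (D.posterior a₁ a₂ b₁ b₂).bind (D.gibbsKernel a₁ a₂ b₁ b₂) =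
      D.posterior a₁ a₂ b₁ b₂ := H.regular.invariant
  rwa [e2, ← e1] at h

theorem measurable_lyap : Measurable fun η => ENNReal.ofReal (D.lyap b₁ b₂ η) :=
  H.continuous_lyap.measurable.ennreal_ofReal

theorem lintegral_size_lyap_pow_le (η : D.State) (n : ℕ) :
    ∫⁻ x, ENNReal.ofReal (D.size b₁ b₂ x) ∂((D.gibbsKernel a₁ a₂ b₁ b₂ ^ n) η) ≤
        ENNReal.ofReal (119 * Λ ^ 6) ^ n * ENNReal.ofReal (D.size b₁ b₂ η) ∧
      ∫⁻ x, ENNReal.ofReal (D.lyap b₁ b₂ x) ∂((D.gibbsKernel a₁ a₂ b₁ b₂ ^ n) η) ≤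
        (2 * ENNReal.ofReal (119 * Λ ^ 6)) ^ (n + 1) *
          (1 + ENNReal.ofReal (q / D.rBar) ^ n * ENNReal.ofReal D.total) *
          ENNReal.ofReal (D.size b₁ b₂ η) := by
  have := H.regular.isMarkovKernel
  have hΛ := H.hΛ
  have hP : 1 ≤ Λ ^ 6 := one_le_pow₀ hΛ
  have hms : Measurable fun η => ENNReal.ofReal (D.size b₁ b₂ η) :=
    (D.continuous_size b₁ b₂).measurable.ennreal_ofReal
  have hml := H.measurable_lyap
  have hle : ENNReal.ofReal (117 * Λ ^ 6) ≤ ENNReal.ofReal (119 * Λ ^ 6) := by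
    gcongr
    norm_num
  have hle2 : ENNReal.ofReal (119 * Λ ^ 5) ≤ ENNReal.ofReal (119 * Λ ^ 6) := by
    have : Λ ^ 5 ≤ Λ ^ 6 := pow_le_pow_right₀ hΛ (by norm_num)
    gcongr
  have hzero : ∀ f : D.State → ℝ≥0∞, Measurable f →
      ∫⁻ x, f x ∂((D.gibbsKernel a₁ a₂ b₁ b₂ ^ 0) η) = f η := fun f hf => by
    rw [pow_zero]
    change ∫⁻ x, f x ∂(Kernel.id η) = f η
    rw [Kernel.id_apply, lintegral_dirac' _ hf]
  have h := moment_recursion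
    (L := fun n => ∫⁻ x, ENNReal.ofReal (D.lyap b₁ b₂ x) ∂((D.gibbsKernel a₁ a₂ b₁ b₂ ^ n) η))
    (S := fun n => ∫⁻ x, ENNReal.ofReal (D.size b₁ b₂ x) ∂((D.gibbsKernel a₁ a₂ b₁ b₂ ^ n) η))
    (c := ENNReal.ofReal (119 * Λ ^ 6)) (ζ := ENNReal.ofReal (q / D.rBar))
    (N := ENNReal.ofReal D.total)
    (by rw [ENNReal.one_le_ofReal]; linarith)
    (by
      rw [ENNReal.ofReal_le_one, div_le_one H.rBar_pos]
      nlinarith [H.hr, H.hq])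
    (fun n => by
      have := isMarkovKernel_pow (D.gibbsKernel a₁ a₂ b₁ b₂) n
      rw [lintegral_pow_succ _ _ _ hml]
      calc _ ≤ ∫⁻ y, ENNReal.ofReal (119 * Λ ^ 6) * (ENNReal.ofReal (D.size b₁ b₂ y) +
            ENNReal.ofReal (q / D.rBar) * ENNReal.ofReal (D.lyap b₁ b₂ y))
              ∂((D.gibbsKernel a₁ a₂ b₁ b₂ ^ n) η) := by
            refine lintegral_mono fun y => (H.lintegral_lyap_le_size y).trans ?_
            gcongr
        _ = _ := by
            rw [lintegral_const_mul' _ _ ENNReal.ofReal_ne_top, lintegral_add_left hms,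
              lintegral_const_mul' _ _ ENNReal.ofReal_ne_top])
    (fun n => by
      rw [lintegral_pow_succ _ _ _ hms, ← lintegral_const_mul' _ _ ENNReal.ofReal_ne_top]
      refine lintegral_mono fun y => (H.lintegral_size_le y).trans ?_
      gcongr)
    (by
      rw [hzero _ hms, hzero _ hml, ← ENNReal.ofReal_mul (by positivity),
        ← ENNReal.ofReal_mul (by positivity)]
      refine ENNReal.ofReal_le_ofReal ((H.lyap_le_size η).trans ?_)
      have := H.one_le_size η
      have : Λ ^ 3 ≤ Λ ^ 6 := pow_le_pow_right₀ hΛ (by norm_num)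
      gcongr
      norm_num) n
  rwa [hzero _ hms] at h

/-- After three steps the Lyapunov function is bounded by the size of the initial state alone: three
factors `q / r̄` compensate the number of observations, because `q ^ 2 ≤ r̄`. The fourth step is there
to adjust parities when the chain is observed every second step. -/
theorem lintegral_lyap_pow_le (η : D.State) {n : ℕ} (hn : n = 3 ∨ n = 4) :
    ∫⁻ x, ENNReal.ofReal (D.lyap b₁ b₂ x) ∂((D.gibbsKernel a₁ a₂ b₁ b₂ ^ n) η) ≤
      ENNReal.ofReal (64 * (119 * Λ ^ 6) ^ 5 * D.size b₁ b₂ η) := by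
  have hΛ := H.hΛ
  have hP : 1 ≤ Λ ^ 6 := one_le_pow₀ hΛ
  have hr := H.rBar_pos
  have hq := H.qR_pos
  have hs := H.one_le_size η
  have hζ : q / D.rBar ≤ 1 := by
    rw [div_le_one hr]
    nlinarith [H.hr, H.hq]
  have h3 : (q / D.rBar) ^ 3 * D.total ≤ 1 := by
    rw [H.total_eq]
    have e : (q / D.rBar) ^ 3 * (D.rBar * q) = (q ^ 2 / D.rBar) ^ 2 := by
      field_simp
    rw [e]
    have h := (div_le_one hr).2 H.hr
    exact pow_le_one₀ (by positivity) h
  have hn' : (q / D.rBar) ^ n * D.total ≤ 1 := by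
    refine le_trans ?_ h3
    have : (q / D.rBar) ^ n ≤ (q / D.rBar) ^ 3 :=
      pow_le_pow_of_le_one (by positivity) hζ (by rcases hn with rfl | rfl <;> norm_num)
    gcongr
  refine (H.lintegral_size_lyap_pow_le η n).2.trans ?_
  have e2 : (2 : ℝ≥0∞) = ENNReal.ofReal 2 := by norm_num
  have hN := H.total_pos
  rw [e2, ← ENNReal.ofReal_mul (by norm_num), ← ENNReal.ofReal_pow (by positivity),
    ← ENNReal.ofReal_pow (by positivity), ← ENNReal.ofReal_mul (by positivity),
    ← ENNReal.ofReal_one, ← ENNReal.ofReal_add (by norm_num) (by positivity),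
    ← ENNReal.ofReal_mul (by positivity), ← ENNReal.ofReal_mul (by positivity)]
  refine ENNReal.ofReal_le_ofReal ?_
  have h5 : (2 * (119 * Λ ^ 6)) ^ (n + 1) ≤ (2 * (119 * Λ ^ 6)) ^ 5 :=
    pow_le_pow_right₀ (by linarith) (by rcases hn with rfl | rfl <;> norm_num)
  calc _ ≤ (2 * (119 * Λ ^ 6)) ^ 5 * (1 + 1) * D.size b₁ b₂ η := by gcongr
    _ = _ := by ring

/-- Invariance and the drift condition bound the Lyapunov function under the posterior. -/
theorem lintegral_lyap_posterior_le
    (hγ : 216 * Λ ^ 7 * ((q : ℝ) ^ 2 / D.rBar + 1 / q) ≤ 1 / 2) :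
    ∫⁻ x, ENNReal.ofReal (D.lyap b₁ b₂ x) ∂(D.posterior a₁ a₂ b₁ b₂) ≤ ENNReal.ofReal 10 := by
  have := H.regular.isMarkovKernel
  have := H.regular.isProbabilityMeasure_posterior
  refine (lintegral_invariant_le H.regular.invariant H.measurable_lyap
    (fun _ => ENNReal.ofReal_ne_top) (b := ENNReal.ofReal 5) fun η => ?_).trans (le_of_eq ?_)
  · have hl := H.one_le_lyap η
    have e : (2 : ℝ≥0∞)⁻¹ = ENNReal.ofReal (1 / 2) := by
      rw [one_div, ENNReal.ofReal_inv_of_pos (by norm_num)]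
      norm_num
    rw [e, ← ENNReal.ofReal_mul (by norm_num), ← ENNReal.ofReal_add (by positivity) (by norm_num)]
    refine (H.drift_lyap η).trans (ENNReal.ofReal_le_ofReal ?_)
    rw [add_comm]
    gcongr
  · have e : (2 : ℝ≥0∞) = ENNReal.ofReal 2 := by norm_num
    rw [e, ← ENNReal.ofReal_mul (by norm_num)]
    norm_num

/-- Convergence in Wasserstein distance. The two-step chain contracts at rate `ρ₂`; the condition
`1 ≤ ρ ^ 4 * √q` pays for the first few steps, which bring the Lyapunov function down. -/
theorem wassersteinDist_pow_le {R γ ρ₂ ρ : ℝ} (hR : 1 ≤ R)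
    (hγ : γ = 216 * Λ ^ 7 * ((q : ℝ) ^ 2 / D.rBar + 1 / q)) (hγ2 : γ ≤ 1 / 2)
    (hρ₂ : ρ₂ = 300 * Λ ^ 5 * R ^ 4 * (q / √D.rBar + 1 / √(q : ℝ)) * R + 10 / R + γ ^ 2 * R + γ)
    (hρ₂ρ : ρ₂ ≤ ρ ^ 2) (hρ0 : 0 ≤ ρ) (hρ1 : ρ ≤ 1) (hρq : 1 ≤ ρ ^ 4 * √(q : ℝ))
    (η : D.State) {n : ℕ} (hn : 1 ≤ n) :
    wassersteinDist ((D.gibbsKernel a₁ a₂ b₁ b₂ ^ n) η) (D.posterior a₁ a₂ b₁ b₂) ≤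
      ENNReal.ofReal (2664 * Λ ^ 3 * (119 * Λ ^ 6) ^ 5 * q * (D.driftV η + 1) * ρ ^ n) := by
  have := H.regular.isMarkovKernel
  have := H.regular.isProbabilityMeasure_posterior
  have hΛ := H.hΛ
  have hq := H.qR_pos
  have hr := H.rBar_pos
  have hs := H.one_le_size η
  have hsV := H.size_le_driftV η
  have hV := D.driftV_nonneg η
  have hγ0 : 0 ≤ γ := by
    rw [hγ]
    positivity
  have hρ20 : 0 ≤ ρ₂ := by
    rw [hρ₂]
    positivity
  set c := 119 * Λ ^ 6 with hc
  have hc1 : 1 ≤ c := by linarith [one_le_pow₀ hΛ (n := 6)]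
  have hcΛ : Λ ^ 2 ≤ c ^ 5 := by
    have h1 : Λ ^ 2 ≤ Λ ^ 6 := pow_le_pow_right₀ hΛ (by norm_num)
    have h2 : c ≤ c ^ 5 := le_self_pow₀ hc1 (by norm_num)
    have h3 : 0 ≤ Λ ^ 6 := by positivity
    linarith
  have hu2 : √(q : ℝ) ^ 2 = q := Real.sq_sqrt hq.le
  have hpost := H.lintegral_lyap_posterior_le (hγ ▸ hγ2)
  have hms : Measurable fun η => ENNReal.ofReal (√(D.size b₁ b₂ η)) :=
    (D.continuous_size b₁ b₂).sqrt.measurable.ennreal_ofReal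
  have hmw : Measurable fun η => ENNReal.ofReal (√(D.lyap b₁ b₂ η)) :=
    H.continuous_lyap.sqrt.measurable.ennreal_ofReal
  -- reduction to a bound in terms of the size of the initial state and few factors of `ρ`
  have hfin : ∀ {m : ℕ} {T : ℝ}, 0 ≤ T → m ≤ 4 →
      12 * Λ ^ 2 * √(q : ℝ) * (T * (74 * c ^ 5 * D.size b₁ b₂ η)) ≤
        2664 * Λ ^ 3 * c ^ 5 * q * (D.driftV η + 1) * (T * ρ ^ m) := by
    intro m T hT0 hm
    have h1 : 1 ≤ ρ ^ m * √(q : ℝ) := by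
      refine hρq.trans ?_
      have := pow_le_pow_of_le_one hρ0 hρ1 hm
      gcongr
    calc _ ≤ 12 * Λ ^ 2 * √(q : ℝ) * (T * (74 * c ^ 5 * (3 * Λ * (1 + D.driftV η)))) *
          (ρ ^ m * √(q : ℝ)) := by
          refine le_trans ?_ (le_mul_of_one_le_right (by positivity) h1)
          gcongr
      _ = 2664 * Λ ^ 3 * c ^ 5 * √(q : ℝ) ^ 2 * (D.driftV η + 1) * (T * ρ ^ m) := by ring
      _ = _ := by rw [hu2]
  have hsqrt : ∀ x : D.State, √(D.size b₁ b₂ x) ≤ D.size b₁ b₂ x := fun x => by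
    have := H.one_le_size x
    exact Real.sqrt_le_iff.2 ⟨by linarith, le_self_pow₀ this (by norm_num)⟩
  have hsqrt' : ∀ x : D.State, √(D.lyap b₁ b₂ x) ≤ D.lyap b₁ b₂ x := fun x => by
    have := H.one_le_lyap x
    exact Real.sqrt_le_iff.2 ⟨by linarith, le_self_pow₀ this (by norm_num)⟩
  rcases Nat.lt_or_ge n 3 with hn3 | hn3
  · have := isMarkovKernel_pow (D.gibbsKernel a₁ a₂ b₁ b₂) n
    refine (wassersteinDist_le_of_weight hms ENNReal.ofReal_ne_top H.edist_le _ _).trans ?_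
    have h1 : ∫⁻ x, ENNReal.ofReal (√(D.size b₁ b₂ x)) ∂((D.gibbsKernel a₁ a₂ b₁ b₂ ^ n) η) ≤
        ENNReal.ofReal (c ^ 5 * D.size b₁ b₂ η) := by
      refine (lintegral_mono fun x => ENNReal.ofReal_le_ofReal (hsqrt x)).trans
        ((H.lintegral_size_lyap_pow_le η n).1.trans ?_)
      rw [← ENNReal.ofReal_pow (by positivity), ← ENNReal.ofReal_mul (by positivity)]
      have : c ^ n ≤ c ^ 5 := pow_le_pow_right₀ hc1 (by omega)
      gcongr
    have h2 : ∫⁻ x, ENNReal.ofReal (√(D.size b₁ b₂ x)) ∂(D.posterior a₁ a₂ b₁ b₂) ≤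
        ENNReal.ofReal (3 * Λ ^ 2 * 10) := by
      calc _ ≤ ∫⁻ x, ENNReal.ofReal (3 * Λ ^ 2) * ENNReal.ofReal (D.lyap b₁ b₂ x)
            ∂(D.posterior a₁ a₂ b₁ b₂) := by
            refine lintegral_mono fun x => ?_
            rw [← ENNReal.ofReal_mul (by positivity)]
            exact ENNReal.ofReal_le_ofReal ((hsqrt x).trans (H.size_le_lyap x))
        _ ≤ _ := by
            rw [lintegral_const_mul' _ _ ENNReal.ofReal_ne_top,
              ENNReal.ofReal_mul (by positivity : 0 ≤ 3 * Λ ^ 2)]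
            gcongr
    calc _ ≤ ENNReal.ofReal (6 * Λ * √(q : ℝ)) *
          (ENNReal.ofReal (c ^ 5 * D.size b₁ b₂ η) + ENNReal.ofReal (3 * Λ ^ 2 * 10)) := by gcongr
      _ ≤ _ := by
          rw [← ENNReal.ofReal_add (by positivity) (by positivity),
            ← ENNReal.ofReal_mul (by positivity)]
          refine ENNReal.ofReal_le_ofReal ?_
          have h3 := hfin (m := n) (T := 1) zero_le_one (by omega)
          simp only [one_mul] at h3
          refine le_trans ?_ h3
          have h4 : c ^ 5 ≤ c ^ 5 * D.size b₁ b₂ η := le_mul_of_one_le_right (by positivity) hs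
          have h5 : Λ ≤ Λ ^ 2 := le_self_pow₀ hΛ (by norm_num)
          have h6 : 0 ≤ c ^ 5 * D.size b₁ b₂ η := by positivity
          have h7 : 6 * Λ ≤ 12 * Λ ^ 2 := by linarith
          gcongr
          linarith
  · obtain ⟨i, j, hi, hij⟩ : ∃ i j : ℕ, (i = 3 ∨ i = 4) ∧ n = 2 * j + i :=
      ⟨3 + (n - 3) % 2, (n - 3) / 2, by omega, by omega⟩
    have := isMarkovKernel_pow (D.gibbsKernel a₁ a₂ b₁ b₂) i
    have := isMarkovKernel_pow (D.gibbsKernel a₁ a₂ b₁ b₂) 2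
    have hpow : (D.gibbsKernel a₁ a₂ b₁ b₂ ^ n) η =
        ((D.gibbsKernel a₁ a₂ b₁ b₂ ^ i) η).bind ⇑((D.gibbsKernel a₁ a₂ b₁ b₂ ^ 2) ^ j) := by
      rw [hij, pow_add, pow_mul]
      exact Kernel.comp_apply _ _ _
    have hedist : ∀ x y : D.State, edist x y ≤ ENNReal.ofReal (12 * Λ ^ 2 * √(q : ℝ)) *
        (ENNReal.ofReal (√(D.lyap b₁ b₂ x)) + ENNReal.ofReal (√(D.lyap b₁ b₂ y))) := fun x y => by
      have h : ∀ x : D.State, √(D.size b₁ b₂ x) ≤ 2 * Λ * √(D.lyap b₁ b₂ x) := fun x => by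
        have h1 := H.one_le_lyap x
        have h2 := H.size_le_lyap x
        refine Real.sqrt_le_iff.2 ⟨by positivity, ?_⟩
        rw [mul_pow, mul_pow, Real.sq_sqrt (by linarith)]
        refine h2.trans ?_
        gcongr
        norm_num
      refine (H.edist_le x y).trans ?_
      rw [← ENNReal.ofReal_add (by positivity) (by positivity),
        ← ENNReal.ofReal_mul (by positivity), ← ENNReal.ofReal_add (by positivity) (by positivity),
        ← ENNReal.ofReal_mul (by positivity)]
      refine ENNReal.ofReal_le_ofReal ?_
      calc _ ≤ 6 * Λ * √(q : ℝ) * (2 * Λ * √(D.lyap b₁ b₂ x) + 2 * Λ * √(D.lyap b₁ b₂ y)) := by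
            have := h x
            have := h y
            gcongr
        _ = _ := by ring
    have hcontr := excess_twoStep_contraction volume (D.measurable_transDensity a₁ a₂ b₁ b₂)
      (D.gibbsKernel_apply a₁ a₂ b₁ b₂) H.continuous_lyap.measurable H.one_le_lyap hγ0
      (by linarith) (by linarith : 0 < R)
      (by positivity : 0 ≤ 300 * Λ ^ 5 * R ^ 4 * (q / √D.rBar + 1 / √(q : ℝ)))
      (fun x => by rw [hγ]; exact H.drift_lyap x)
      (fun x y => H.excessMass_le hR x y)
    rw [← hρ₂] at hcontr
    have hmain := _root_.wassersteinDist_pow_le volume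
      (measurable_twoStep volume (D.measurable_transDensity a₁ a₂ b₁ b₂))
      (D.gibbsKernel a₁ a₂ b₁ b₂ ^ 2)
      (pow_two_eq_withDensity volume (D.measurable_transDensity a₁ a₂ b₁ b₂)
        (D.gibbsKernel_apply a₁ a₂ b₁ b₂)) hmw ENNReal.ofReal_ne_top
      (fun x y _ => hcontr x y) hedist (invariant_pow _ H.regular.invariant 2)
      ((D.gibbsKernel a₁ a₂ b₁ b₂ ^ i) η) j
    rw [hpow]
    refine hmain.trans ?_
    have h1 : ∫⁻ x, ENNReal.ofReal (√(D.lyap b₁ b₂ x)) ∂((D.gibbsKernel a₁ a₂ b₁ b₂ ^ i) η) ≤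
        ENNReal.ofReal (64 * c ^ 5 * D.size b₁ b₂ η) :=
      (lintegral_mono fun x => ENNReal.ofReal_le_ofReal (hsqrt' x)).trans
        (H.lintegral_lyap_pow_le η hi)
    have h2 : ∫⁻ x, ENNReal.ofReal (√(D.lyap b₁ b₂ x)) ∂(D.posterior a₁ a₂ b₁ b₂) ≤
        ENNReal.ofReal 10 :=
      (lintegral_mono fun x => ENNReal.ofReal_le_ofReal (hsqrt' x)).trans hpost
    calc _ ≤ ENNReal.ofReal (12 * Λ ^ 2 * √(q : ℝ)) * (ENNReal.ofReal ρ₂ ^ j *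
          (ENNReal.ofReal (64 * c ^ 5 * D.size b₁ b₂ η) + ENNReal.ofReal 10)) := by gcongr
      _ ≤ _ := by
          rw [← ENNReal.ofReal_pow hρ20, ← ENNReal.ofReal_add (by positivity) (by norm_num),
            ← ENNReal.ofReal_mul (by positivity), ← ENNReal.ofReal_mul (by positivity)]
          refine ENNReal.ofReal_le_ofReal ?_
          have h4 : 1 ≤ c ^ 5 * D.size b₁ b₂ η :=
            one_le_mul_of_one_le_of_one_le (one_le_pow₀ hc1) hs
          have h5 : 64 * c ^ 5 * D.size b₁ b₂ η + 10 ≤ 74 * c ^ 5 * D.size b₁ b₂ η := by linarith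
          have h6 : ρ₂ ^ j * ρ ^ i ≤ ρ ^ n := by
            rw [hij, pow_add, pow_mul]
            gcongr
          calc _ ≤ 12 * Λ ^ 2 * √(q : ℝ) * (ρ₂ ^ j * (74 * c ^ 5 * D.size b₁ b₂ η)) := by gcongr
            _ ≤ 2664 * Λ ^ 3 * c ^ 5 * q * (D.driftV η + 1) * (ρ₂ ^ j * ρ ^ i) :=
                hfin (by positivity) (by omega)
            _ ≤ _ := by gcongr

end

end Bounds

end MixedModelData

end Convergence

/-! ### Consequences of the assumptions on the data -/

noncomputable section Design

theorem Matrix.IsHermitian.dotProduct_mulVec_nonneg_of_spectrum {n : Type*} [Fintype n]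
    [DecidableEq n] {A : Matrix n n ℝ} (hA : A.IsHermitian) (h : ∀ x ∈ spectrum ℝ A, 0 ≤ x)
    (v : n → ℝ) : 0 ≤ v ⬝ᵥ (A *ᵥ v) := by
  have hp : A.PosSemidef := by
    rw [hA.posSemidef_iff_eigenvalues_nonneg]
    intro i
    refine h _ ?_
    rw [hA.spectrum_real_eq_range_eigenvalues]
    exact Set.mem_range_self i
  simpa using hp.dotProduct_mulVec_nonneg v

/-- Lower Rayleigh bound. For a matrix of size zero `lambdaMin` is a junk value, but then both sides
vanish. -/
theorem le_dotProduct_mulVec_of_le_lambdaMin {n : Type*} [Fintype n] [DecidableEq n]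
    {A : Matrix n n ℝ} (hA : A.IsHermitian) {k : ℝ} (hk : k ≤ lambdaMin A) (v : n → ℝ) :
    k * (v ⬝ᵥ v) ≤ v ⬝ᵥ (A *ᵥ v) := by
  have hB : (A - algebraMap ℝ (Matrix n n ℝ) k).IsHermitian := by
    refine hA.sub ?_
    rw [Algebra.algebraMap_eq_smul_one]
    exact Matrix.isHermitian_one.smul (IsSelfAdjoint.all k)
  have h := hB.dotProduct_mulVec_nonneg_of_spectrum (fun x hx => by
    rw [← spectrum.sub_singleton_eq] at hx
    obtain ⟨y, hy, z, hz, rfl⟩ := hx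
    rw [Set.mem_singleton_iff] at hz
    have : sInf (spectrum ℝ A) ≤ y := csInf_le A.finite_real_spectrum.bddBelow hy
    unfold lambdaMin at hk
    simp only [hz]
    linarith) v
  rw [Matrix.sub_mulVec, Algebra.algebraMap_eq_smul_one, Matrix.smul_mulVec, Matrix.one_mulVec,
    dotProduct_sub, dotProduct_smul, smul_eq_mul] at h
  linarith

/-- Upper Rayleigh bound, with the same remark on matrices of size zero. -/
theorem dotProduct_mulVec_le_of_lambdaMax_le {n : Type*} [Fintype n] [DecidableEq n]
    {A : Matrix n n ℝ} (hA : A.IsHermitian) {k : ℝ} (hk : lambdaMax A ≤ k) (v : n → ℝ) :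
    v ⬝ᵥ (A *ᵥ v) ≤ k * (v ⬝ᵥ v) := by
  have hB : (algebraMap ℝ (Matrix n n ℝ) k - A).IsHermitian := by
    refine Matrix.IsHermitian.sub ?_ hA
    rw [Algebra.algebraMap_eq_smul_one]
    exact Matrix.isHermitian_one.smul (IsSelfAdjoint.all k)
  have h := hB.dotProduct_mulVec_nonneg_of_spectrum (fun x hx => by
    rw [← spectrum.singleton_sub_eq] at hx
    obtain ⟨z, hz, y, hy, rfl⟩ := hx
    rw [Set.mem_singleton_iff] at hz
    have : y ≤ sSup (spectrum ℝ A) := le_csSup A.finite_real_spectrum.bddAbove hy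
    unfold lambdaMax at hk
    simp only [hz]
    linarith) v
  rw [Matrix.sub_mulVec, Algebra.algebraMap_eq_smul_one, Matrix.smul_mulVec, Matrix.one_mulVec,
    dotProduct_sub, dotProduct_smul, smul_eq_mul] at h
  linarith

/-- Sum of squares about the mean. -/
theorem sum_add_sq_eq {n : ℕ} (hn : 0 < n) (s : Fin n → ℝ) (u : ℝ) :
    ∑ j, (s j + u) ^ 2 = ∑ j, s j ^ 2 - n * ((n : ℝ)⁻¹ * ∑ j, s j) ^ 2 +
      n * ((n : ℝ)⁻¹ * ∑ j, s j + u) ^ 2 := by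
  have hn' : (n : ℝ) ≠ 0 := by exact_mod_cast hn.ne'
  simp only [add_sq, Finset.sum_add_distrib, Finset.sum_const, Finset.card_univ, Fintype.card_fin,
    nsmul_eq_mul, ← Finset.mul_sum, ← Finset.sum_mul]
  field_simp
  ring

theorem mul_mean_sq_le {n : ℕ} (hn : 0 < n) (s : Fin n → ℝ) :
    n * ((n : ℝ)⁻¹ * ∑ j, s j) ^ 2 ≤ ∑ j, s j ^ 2 := by
  have h := sum_add_sq_eq hn s (-((n : ℝ)⁻¹ * ∑ j, s j))
  have h0 : 0 ≤ ∑ j, (s j + -((n : ℝ)⁻¹ * ∑ j, s j)) ^ 2 := Finset.sum_nonneg fun _ _ => sq_nonneg _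
  rw [add_neg_cancel] at h
  linarith

namespace MixedModelData

variable {q : ℕ} (D : MixedModelData q) {a₁ a₂ b₁ b₂ : ℝ}

theorem rBar_nonneg : 0 ≤ D.rBar := by
  unfold rBar
  positivity

theorem r_le_rMax (i : Fin q) : D.r i ≤ D.rMax := le_ciSup (Set.finite_range D.r).bddAbove i

theorem rMin_le_r (i : Fin q) : D.rMin ≤ D.r i := ciInf_le (OrderBot.bddBelow _) i

theorem rMin_pos (hq : 0 < q) : 0 < D.rMin := by
  have : Nonempty (Fin q) := ⟨⟨0, hq⟩⟩
  exact Nat.lt_of_lt_of_le Nat.zero_lt_one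
    (le_ciInf fun i => Nat.one_le_iff_ne_zero.2 (D.r_pos i).ne')

theorem rBar_mem (hq : 0 < q) : (D.rMin : ℝ) ≤ D.rBar ∧ D.rBar ≤ D.rMax := by
  have hq' : (0 : ℝ) < q := by exact_mod_cast hq
  have h : D.rBar * q = ∑ i, (D.r i : ℝ) := by
    rw [rBar]
    field_simp
  refine ⟨le_of_mul_le_mul_right ?_ hq', le_of_mul_le_mul_right ?_ hq'⟩
  · rw [h]
    calc (D.rMin : ℝ) * q = ∑ _i : Fin q, (D.rMin : ℝ) := by simp [mul_comm]
      _ ≤ _ := Finset.sum_le_sum fun i _ => by exact_mod_cast D.rMin_le_r i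
  · rw [h]
    calc _ ≤ ∑ _i : Fin q, (D.rMax : ℝ) :=
          Finset.sum_le_sum fun i _ => by exact_mod_cast D.r_le_rMax i
      _ = _ := by simp [mul_comm]

/-- The group sizes are comparable to their mean. -/
theorem r_comparable (hq : 0 < q) {m : ℝ} (hm0 : 0 < m)
    (hm : (D.rMax : ℝ) / (D.rMin : ℝ) ≤ m) (i : Fin q) :
    D.rBar ≤ m * D.r i ∧ D.r i ≤ m * D.rBar := by
  have h0 : (0 : ℝ) < D.rMin := by exact_mod_cast D.rMin_pos hq
  rw [div_le_iff₀ h0] at hm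
  obtain ⟨h1, h2⟩ := D.rBar_mem hq
  have h3 : (D.rMin : ℝ) ≤ D.r i := by exact_mod_cast D.rMin_le_r i
  have h4 : (D.r i : ℝ) ≤ D.rMax := by exact_mod_cast D.r_le_rMax i
  constructor <;> nlinarith

/-- Linear predictor of the fixed effects for an observation. -/
def fixedPred (β : Fin D.p → ℝ) (i : Fin q) (j : Fin (D.r i)) : ℝ := D.x i j ⬝ᵥ β

theorem xBar_dotProduct (β : Fin D.p → ℝ) (i : Fin q) :
    D.xBar i ⬝ᵥ β = (D.r i : ℝ)⁻¹ * ∑ j, D.fixedPred β i j := by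
  rw [xBar, smul_dotProduct, smul_eq_mul, sum_dotProduct]
  rfl

theorem dotProduct_designX (β : Fin D.p → ℝ) :
    β ⬝ᵥ ((D.designXᵀ * D.designX) *ᵥ β) = ∑ i, ∑ j, D.fixedPred β i j ^ 2 := by
  rw [← Matrix.mulVec_mulVec, Matrix.dotProduct_mulVec, Matrix.vecMul_transpose, dotProduct,
    Fintype.sum_sigma]
  refine Finset.sum_congr rfl fun i _ => Finset.sum_congr rfl fun j _ => ?_
  rw [sq]
  rfl

theorem dotProduct_designXBar (β : Fin D.p → ℝ) :
    β ⬝ᵥ ((D.designXBarᵀ * D.designXBar) *ᵥ β) =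
      ∑ i, D.r i * ((D.r i : ℝ)⁻¹ * ∑ j, D.fixedPred β i j) ^ 2 := by
  rw [← Matrix.mulVec_mulVec, Matrix.dotProduct_mulVec, Matrix.vecMul_transpose, dotProduct,
    Fintype.sum_sigma]
  refine Finset.sum_congr rfl fun i _ => ?_
  have e : ∀ j : Fin (D.r i), (D.designXBar *ᵥ β) ⟨i, j⟩ = D.xBar i ⬝ᵥ β := fun j => rfl
  simp only [e, Finset.sum_const, Finset.card_univ, Fintype.card_fin, nsmul_eq_mul,
    D.xBar_dotProduct, sq]

theorem isHermitian_gram (X : Matrix (Σ i : Fin q, Fin (D.r i)) (Fin D.p) ℝ) :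
    (Xᵀ * X).IsHermitian := by
  have := Matrix.isHermitian_conjTranspose_mul_self X
  rwa [Matrix.conjTranspose_eq_transpose_of_trivial] at this

/-- Lower eigenvalue bound for the within-group covariation. -/
theorem le_within_of_lambdaMin {k : ℝ} (hN : 0 < D.rBar * q)
    (hk : k ≤ lambdaMin ((D.rBar * q)⁻¹ •
      (D.designXᵀ * D.designX - D.designXBarᵀ * D.designXBar))) (β : Fin D.p → ℝ) :
    k * (D.rBar * q) * (β ⬝ᵥ β) ≤ ∑ i, ∑ j, D.fixedPred β i j ^ 2 -
      ∑ i, D.r i * ((D.r i : ℝ)⁻¹ * ∑ j, D.fixedPred β i j) ^ 2 := by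
  have hH := ((D.isHermitian_gram D.designX).sub (D.isHermitian_gram D.designXBar)).smul
    (IsSelfAdjoint.all (D.rBar * q)⁻¹)
  have h := le_dotProduct_mulVec_of_le_lambdaMin hH hk β
  rw [Matrix.smul_mulVec, dotProduct_smul, smul_eq_mul, Matrix.sub_mulVec, dotProduct_sub,
    dotProduct_designX, dotProduct_designXBar, ← div_eq_inv_mul, le_div_iff₀ hN] at h
  linarith

theorem fixedPred_le_of_lambdaMax {k : ℝ} (hN : 0 < D.rBar * q)
    (hk : lambdaMax ((D.rBar * q)⁻¹ • (D.designXᵀ * D.designX)) ≤ k) (β : Fin D.p → ℝ) :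
    ∑ i, ∑ j, D.fixedPred β i j ^ 2 ≤ k * (D.rBar * q) * (β ⬝ᵥ β) := by
  have hH := (D.isHermitian_gram D.designX).smul (IsSelfAdjoint.all (D.rBar * q)⁻¹)
  have h := dotProduct_mulVec_le_of_lambdaMax_le hH hk β
  rw [Matrix.smul_mulVec, dotProduct_smul, smul_eq_mul,
    dotProduct_designX, ← div_eq_inv_mul, div_le_iff₀ hN] at h
  linarith

/-- Coefficients `β` of a point in core coordinates. -/
def coreFixed (z : D.Core) : Fin D.p → ℝ := (√(q : ℝ))⁻¹ • fun k => z (Sum.inl k)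

theorem mul_dotProduct_coreFixed (hq : 0 < q) (z : D.Core) :
    D.rBar * q * (D.coreFixed z ⬝ᵥ D.coreFixed z) = D.rBar * ∑ k, z (Sum.inl k) ^ 2 := by
  have hq' : (0 : ℝ) < q := by exact_mod_cast hq
  have hs : √(q : ℝ) ^ 2 = q := Real.sq_sqrt hq'.le
  have hs0 : √(q : ℝ) ≠ 0 := (Real.sqrt_pos.2 hq').ne'
  rw [coreFixed, smul_dotProduct, dotProduct_smul, smul_eq_mul, smul_eq_mul, dotProduct]
  simp only [← sq]
  rw [← mul_assoc (√(q : ℝ))⁻¹, ← sq, inv_pow, hs]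
  field_simp

theorem norm_predMap_sq (z : D.Core) :
    ‖D.predMap z‖ ^ 2 = ∑ i, ∑ j, (D.fixedPred (D.coreFixed z) i j + z (Sum.inr i)) ^ 2 := by
  rw [EuclideanSpace.real_norm_sq_eq, Fintype.sum_sigma]
  rfl

theorem norm_predMap_sq_eq (z : D.Core) :
    ‖D.predMap z‖ ^ 2 = (∑ i, ∑ j, D.fixedPred (D.coreFixed z) i j ^ 2 -
      ∑ i, D.r i * ((D.r i : ℝ)⁻¹ * ∑ j, D.fixedPred (D.coreFixed z) i j) ^ 2) +
      ∑ i, D.r i * ((D.r i : ℝ)⁻¹ * ∑ j, D.fixedPred (D.coreFixed z) i j + z (Sum.inr i)) ^ 2 := by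
  rw [norm_predMap_sq, ← Finset.sum_sub_distrib, ← Finset.sum_add_distrib]
  exact Finset.sum_congr rfl fun i _ => sum_add_sq_eq (D.r_pos i) _ _

/-- The linear predictor determines the coefficients and the effects, quantitatively. -/
theorem rBar_mul_norm_sq_le (hq : 0 < q) (hr : 0 < D.rBar) {m k₁ k₂ : ℝ} (hm0 : 0 < m)
    (hm : (D.rMax : ℝ) / (D.rMin : ℝ) ≤ m) (hk₁0 : 0 < k₁) (hk₂0 : 0 < k₂)
    (hk₁ : k₁ ≤ lambdaMin ((D.rBar * q)⁻¹ •
      (D.designXᵀ * D.designX - D.designXBarᵀ * D.designXBar)))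
    (hk₂ : lambdaMax ((D.rBar * q)⁻¹ • (D.designXᵀ * D.designX)) ≤ k₂) (z : D.Core) :
    D.rBar * ‖z‖ ^ 2 ≤ (1 / k₁ + 2 * m + 2 * m * (k₂ / k₁)) * ‖D.predMap z‖ ^ 2 := by
  have hq' : (0 : ℝ) < q := by exact_mod_cast hq
  have hN : 0 < D.rBar * q := by positivity
  set β := D.coreFixed z with hβ
  have h1 := D.le_within_of_lambdaMin hN hk₁ β
  have h2 := D.fixedPred_le_of_lambdaMax hN hk₂ β
  have h3 := D.norm_predMap_sq_eq z
  have h4 := D.mul_dotProduct_coreFixed hq z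
  rw [← hβ] at h3 h4
  set T := ∑ i, ∑ j, D.fixedPred β i j ^ 2
  set M := ∑ i, D.r i * ((D.r i : ℝ)⁻¹ * ∑ j, D.fixedPred β i j) ^ 2 with hM
  set U := ∑ i, D.r i * ((D.r i : ℝ)⁻¹ * ∑ j, D.fixedPred β i j + z (Sum.inr i)) ^ 2 with hU
  set P := ‖D.predMap z‖ ^ 2
  have hU0 : 0 ≤ U := Finset.sum_nonneg fun i _ => by positivity
  have hMT : M ≤ T := Finset.sum_le_sum fun i _ => mul_mean_sq_le (D.r_pos i) _
  have e1 : k₁ * (D.rBar * ∑ k, z (Sum.inl k) ^ 2) ≤ P := by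
    rw [← h4]
    linarith
  have e2 : T ≤ k₂ * (D.rBar * ∑ k, z (Sum.inl k) ^ 2) := by
    rw [← h4]
    linarith
  have e3 : D.rBar * ∑ k, z (Sum.inl k) ^ 2 ≤ 1 / k₁ * P := by
    rw [one_div, ← div_eq_inv_mul, le_div_iff₀ hk₁0]
    linarith
  have e4 : T ≤ k₂ / k₁ * P := by
    calc T ≤ k₂ * (1 / k₁ * P) := e2.trans (by gcongr)
      _ = _ := by ring
  have e5 : D.rBar * ∑ i, z (Sum.inr i) ^ 2 ≤ m * (2 * U + 2 * M) := by
    rw [Finset.mul_sum, hU, hM, Finset.mul_sum, Finset.mul_sum, ← Finset.sum_add_distrib,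
      Finset.mul_sum]
    refine Finset.sum_le_sum fun i _ => ?_
    have hi := (D.r_comparable hq hm0 hm i).1
    set s := (D.r i : ℝ)⁻¹ * ∑ j, D.fixedPred β i j
    calc D.rBar * z (Sum.inr i) ^ 2 ≤ (m * D.r i) * z (Sum.inr i) ^ 2 := by gcongr
      _ ≤ (m * D.r i) * (2 * (s + z (Sum.inr i)) ^ 2 + 2 * s ^ 2) := by
          gcongr
          nlinarith [sq_nonneg (2 * s + z (Sum.inr i))]
      _ = _ := by ring
  have e6 : m * (2 * U + 2 * M) ≤ m * (2 * P + 2 * (k₂ / k₁ * P)) := by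
    gcongr
    · linarith
    · linarith
  rw [norm_core_sq, mul_add]
  calc _ ≤ 1 / k₁ * P + m * (2 * P + 2 * (k₂ / k₁ * P)) := by linarith
    _ = _ := by ring

theorem norm_predMap_sq_le (hq : 0 < q) (hr : 0 < D.rBar) {m k₂ : ℝ} (hm0 : 0 < m)
    (hm : (D.rMax : ℝ) / (D.rMin : ℝ) ≤ m) (hk₂0 : 0 < k₂)
    (hk₂ : lambdaMax ((D.rBar * q)⁻¹ • (D.designXᵀ * D.designX)) ≤ k₂) (z : D.Core) :
    ‖D.predMap z‖ ^ 2 ≤ 2 * (k₂ + m) * D.rBar * ‖z‖ ^ 2 := by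
  have hq' : (0 : ℝ) < q := by exact_mod_cast hq
  have hN : 0 < D.rBar * q := by positivity
  have h2 := D.fixedPred_le_of_lambdaMax hN hk₂ (D.coreFixed z)
  have h4 := D.mul_dotProduct_coreFixed hq z
  have e1 : ‖D.predMap z‖ ^ 2 ≤ 2 * ∑ i, ∑ j, D.fixedPred (D.coreFixed z) i j ^ 2 +
      2 * ∑ i, D.r i * z (Sum.inr i) ^ 2 := by
    rw [norm_predMap_sq, Finset.mul_sum, Finset.mul_sum, ← Finset.sum_add_distrib]
    refine Finset.sum_le_sum fun i _ => ?_
    calc _ ≤ ∑ j, (2 * D.fixedPred (D.coreFixed z) i j ^ 2 + 2 * z (Sum.inr i) ^ 2) :=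
          Finset.sum_le_sum fun j _ => by
            nlinarith [sq_nonneg (D.fixedPred (D.coreFixed z) i j - z (Sum.inr i))]
      _ = _ := by
          simp only [Finset.sum_add_distrib, ← Finset.mul_sum, Finset.sum_const, Finset.card_univ,
            Fintype.card_fin, nsmul_eq_mul]
  have e2 : ∑ i, D.r i * z (Sum.inr i) ^ 2 ≤ m * D.rBar * ∑ i, z (Sum.inr i) ^ 2 := by
    rw [Finset.mul_sum]
    refine Finset.sum_le_sum fun i _ => ?_
    have := (D.r_comparable hq hm0 hm i).2
    gcongr
  have e3 : ∑ i, ∑ j, D.fixedPred (D.coreFixed z) i j ^ 2 ≤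
      k₂ * (D.rBar * ∑ k, z (Sum.inl k) ^ 2) := by
    rw [← h4]
    linarith
  have p1 : 0 ≤ D.rBar * ∑ k, z (Sum.inl k) ^ 2 := by positivity
  have p2 : 0 ≤ D.rBar * ∑ i, z (Sum.inr i) ^ 2 := by positivity
  rw [norm_core_sq]
  nlinarith

theorem norm_obsY_sq : ‖D.obsY‖ ^ 2 = ∑ i, ∑ j, D.y i j ^ 2 := by
  rw [EuclideanSpace.real_norm_sq_eq, Fintype.sum_sigma]
  rfl

/-- Residuals of the fixed effects in the drift function. -/
theorem driftV_mul (hq : 0 < q) (hr : 0 < D.rBar) (η : D.State) :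
    D.rBar * q * D.driftV η =
      ∑ i, ∑ j, (D.yBarBar - D.x i j ⬝ᵥ ((√(q : ℝ))⁻¹ • η.fixedPart)) ^ 2 +
      D.rBar * η.meanPart ^ 2 + ∑ i, (D.r i : ℝ) * (η.effect i + D.yBarBar - D.yBar i) ^ 2 := by
  have hq' : (0 : ℝ) < q := by exact_mod_cast hq
  have e : ∀ i j, (D.x i j ⬝ᵥ η.fixedPart) / √(q : ℝ) =
      D.x i j ⬝ᵥ ((√(q : ℝ))⁻¹ • η.fixedPart) := fun i j => by
    rw [dotProduct_smul, smul_eq_mul, div_eq_inv_mul]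
  unfold driftV
  simp only [e]
  field_simp

theorem resSq_le (hq : 0 < q) (hr : 0 < D.rBar) {l : ℝ}
    (hl : (D.rBar * q)⁻¹ * ∑ i, ∑ j, D.y i j ^ 2 ≤ l) (η : D.State) :
    D.resSq η ≤ 3 * (l + D.driftV η) * (D.rBar * q) := by
  have hq' : (0 : ℝ) < q := by exact_mod_cast hq
  have hN : 0 < D.rBar * q := by positivity
  rw [← div_eq_inv_mul, div_le_iff₀ hN] at hl
  have hV := D.driftV_mul hq hr η
  have h0 : 0 ≤ D.rBar * η.meanPart ^ 2 := by positivity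
  have hy : ∑ i, ∑ j, (D.y i j + -D.yBar i) ^ 2 ≤ ∑ i, ∑ j, D.y i j ^ 2 := by
    refine Finset.sum_le_sum fun i _ => ?_
    rw [sum_add_sq_eq (D.r_pos i), ← yBar, add_neg_cancel]
    have : 0 ≤ (D.r i : ℝ) * D.yBar i ^ 2 := by positivity
    linarith
  have h : D.resSq η ≤ 3 * (∑ i, ∑ j, (D.y i j + -D.yBar i) ^ 2 +
      ∑ i, ∑ j, (D.yBarBar - D.x i j ⬝ᵥ ((√(q : ℝ))⁻¹ • η.fixedPart)) ^ 2 +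
      ∑ i, (D.r i : ℝ) * (η.effect i + D.yBarBar - D.yBar i) ^ 2) := by
    rw [resSq, ← Finset.sum_add_distrib, ← Finset.sum_add_distrib, Finset.mul_sum]
    refine Finset.sum_le_sum fun i _ => ?_
    have e : (D.r i : ℝ) * (η.effect i + D.yBarBar - D.yBar i) ^ 2 =
        ∑ _j : Fin (D.r i), (η.effect i + D.yBarBar - D.yBar i) ^ 2 := by simp
    rw [e, ← Finset.sum_add_distrib, ← Finset.sum_add_distrib, Finset.mul_sum]
    refine Finset.sum_le_sum fun j _ => ?_
    set a := D.y i j + -D.yBar i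
    set b := D.yBarBar - D.x i j ⬝ᵥ ((√(q : ℝ))⁻¹ • η.fixedPart)
    set c := η.effect i + D.yBarBar - D.yBar i
    have e : D.y i j - (D.x i j ⬝ᵥ ((√(q : ℝ))⁻¹ • η.fixedPart) + η.effect i) = a + b - c := by
      simp only [a, b, c]
      ring
    rw [e]
    nlinarith [sq_nonneg (a - b), sq_nonneg (a + c), sq_nonneg (b + c)]
  nlinarith

theorem effSq_le (hq : 0 < q) (hr : 0 < D.rBar) {m l : ℝ} (hm0 : 0 < m)
    (hm : (D.rMax : ℝ) / (D.rMin : ℝ) ≤ m)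
    (hl : (D.rBar * q)⁻¹ * ∑ i, ∑ j, D.y i j ^ 2 ≤ l) (η : D.State) :
    D.effSq η ≤ 4 * q * ((m + 1) * D.driftV η + 2 * m * l) := by
  have hq' : (0 : ℝ) < q := by exact_mod_cast hq
  have hN : 0 < D.rBar * q := by positivity
  rw [← div_eq_inv_mul, div_le_iff₀ hN] at hl
  have hV := D.driftV_mul hq hr η
  have h0 : 0 ≤ ∑ i, ∑ j, (D.yBarBar - D.x i j ⬝ᵥ ((√(q : ℝ))⁻¹ • η.fixedPart)) ^ 2 := by
    positivity
  have h1 : 0 ≤ ∑ i, (D.r i : ℝ) * (η.effect i + D.yBarBar - D.yBar i) ^ 2 := by positivity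
  have hcmp : ∀ f : Fin q → ℝ, D.rBar * ∑ i, f i ^ 2 ≤ m * ∑ i, (D.r i : ℝ) * f i ^ 2 := fun f => by
    rw [Finset.mul_sum, Finset.mul_sum]
    refine Finset.sum_le_sum fun i _ => ?_
    rw [← mul_assoc]
    have := (D.r_comparable hq hm0 hm i).1
    gcongr
  have hmean : η.meanPart ^ 2 ≤ q * D.driftV η := by
    refine le_of_mul_le_mul_left ?_ hr
    linarith
  have hw : ∑ i, (η.effect i + D.yBarBar - D.yBar i) ^ 2 ≤ m * (q * D.driftV η) := by
    refine le_of_mul_le_mul_left ((hcmp _).trans ?_) hr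
    have : 0 ≤ D.rBar * η.meanPart ^ 2 := by positivity
    nlinarith
  have hyb : ∑ i, D.yBar i ^ 2 ≤ m * (l * q) := by
    refine le_of_mul_le_mul_left ((hcmp _).trans ?_) hr
    have : ∑ i, (D.r i : ℝ) * D.yBar i ^ 2 ≤ ∑ i, ∑ j, D.y i j ^ 2 :=
      Finset.sum_le_sum fun i _ => mul_mean_sq_le (D.r_pos i) _
    nlinarith
  have hyy : q * D.yBarBar ^ 2 ≤ ∑ i, D.yBar i ^ 2 := mul_mean_sq_le hq _
  have h : D.effSq η ≤ 4 * (∑ i, (η.effect i + D.yBarBar - D.yBar i) ^ 2 + q * D.yBarBar ^ 2 +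
      ∑ i, D.yBar i ^ 2 + η.meanPart ^ 2) := by
    have e : q * D.yBarBar ^ 2 = ∑ _i : Fin q, D.yBarBar ^ 2 := by simp
    have e' : η.meanPart ^ 2 = ∑ _i : Fin q, (η.meanPart / √(q : ℝ)) ^ 2 := by
      rw [Finset.sum_const, Finset.card_univ, Fintype.card_fin, nsmul_eq_mul, div_pow,
        Real.sq_sqrt hq'.le]
      field_simp
    rw [e, e', effSq, ← Finset.sum_add_distrib, ← Finset.sum_add_distrib,
      ← Finset.sum_add_distrib, Finset.mul_sum]
    refine Finset.sum_le_sum fun i _ => ?_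
    set w := η.effect i + D.yBarBar - D.yBar i
    have e : η.effect i - η.meanPart / √(q : ℝ) =
        w - D.yBarBar + D.yBar i - η.meanPart / √(q : ℝ) := by
      simp only [w]
      ring
    rw [e]
    set a := D.yBarBar
    set b := D.yBar i
    set c := η.meanPart / √(q : ℝ)
    nlinarith [sq_nonneg (w + a), sq_nonneg (w - b), sq_nonneg (w + c), sq_nonneg (a + b),
      sq_nonneg (a - c), sq_nonneg (b + c)]
  nlinarith

/-- The bounds used in the convergence analysis, with an explicit constant. -/
theorem bounds_of_assumptions (ha₁ : 0 < a₁) (ha₂ : 0 < a₂) (hb₁ : 0 < b₁) (hb₂ : 0 < b₂)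
    (hq : (4 : ℝ) ≤ q) (hr : (q : ℝ) ^ 2 ≤ D.rBar) {m k₁ k₂ l c : ℝ} (hm0 : 0 < m)
    (hm : (D.rMax : ℝ) / (D.rMin : ℝ) ≤ m) (hk₁0 : 0 < k₁) (hk₂0 : 0 < k₂)
    (hk₁ : k₁ ≤ lambdaMin ((D.rBar * q)⁻¹ •
      (D.designXᵀ * D.designX - D.designXBarᵀ * D.designXBar)))
    (hk₂ : lambdaMax ((D.rBar * q)⁻¹ • (D.designXᵀ * D.designX)) ≤ k₂)
    (hl0 : 0 < l) (hl : (D.rBar * q)⁻¹ * ∑ i, ∑ j, D.y i j ^ 2 ≤ l)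
    (hc0 : 0 ≤ c) (hc : (D.p : ℝ) ≤ c * q) (hcr : c + 1 ≤ D.rBar) :
    D.Bounds a₁ a₂ b₁ b₂ (2 + a₁ + a₂ + 2 * b₁ + 2 * b₂ + 1 / b₁ + 1 / b₂ +
      (1 / k₁ + 2 * m + 2 * m * (k₂ / k₁)) + 2 * (k₂ + m) + 3 * l + c + 2 +
      2 * (m + 1) + 4 * m * l) := by
  have hq0' : (0 : ℝ) < q := by linarith
  have hq0 : 0 < q := by exact_mod_cast hq0'
  have hr0 : 0 < D.rBar := by nlinarith
  have hN := D.total_eq hq0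
  have hN1 : (1 : ℝ) ≤ D.total := by
    rw [hN]
    nlinarith
  have hl' : ∑ i, ∑ j, D.y i j ^ 2 ≤ l * D.total := by
    rw [hN]
    rwa [← div_eq_inv_mul, div_le_iff₀ (by positivity)] at hl
  have p1 : 0 < 1 / b₁ := by positivity
  have p2 : 0 < 1 / b₂ := by positivity
  have p3 : 0 < 1 / k₁ + 2 * m + 2 * m * (k₂ / k₁) := by positivity
  have p4 : 0 < 4 * m * l := by positivity
  set Λ := 2 + a₁ + a₂ + 2 * b₁ + 2 * b₂ + 1 / b₁ + 1 / b₂ +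
      (1 / k₁ + 2 * m + 2 * m * (k₂ / k₁)) + 2 * (k₂ + m) + 3 * l + c + 2 +
      2 * (m + 1) + 4 * m * l with hΛ
  exact
    { hΛ := by linarith
      hq := hq
      hr := hr
      ha₁ := ha₁
      ha₂ := ha₂
      hb₁ := hb₁
      hb₂ := hb₂
      one_le_b₁ := by
        rw [← div_le_iff₀ hb₁]
        linarith
      one_le_b₂ := by
        rw [← div_le_iff₀ hb₂]
        linarith
      b₁_le := by linarith
      b₂_le := by linarith
      norm_le_predMap := fun z => by
        refine (D.rBar_mul_norm_sq_le hq0 hr0 hm0 hm hk₁0 hk₂0 hk₁ hk₂ z).trans ?_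
        gcongr
        linarith
      predMap_le := fun z => by
        refine (D.norm_predMap_sq_le hq0 hr0 hm0 hm hk₂0 hk₂ z).trans ?_
        gcongr
        linarith
      obsY_le := by
        rw [norm_obsY_sq]
        refine hl'.trans ?_
        gcongr
        linarith
      dim_le := by
        have : (c + 2) * q ≤ Λ * q := by
          gcongr
          linarith
        linarith
      dim_le_total := by
        have h : ((D.p + q : ℕ) : ℝ) ≤ (D.total : ℝ) := by
          rw [hN]
          push_cast
          nlinarith
        exact_mod_cast h
      shapeLam_le := by
        have : (a₁ + 1) * q ≤ Λ * q := by
          gcongr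
          linarith
        have h : a₁ ≤ a₁ * q := le_mul_of_one_le_right ha₁.le (by linarith)
        unfold shapeLam
        linarith
      shapeTau_le := by
        have : (a₂ + 1) * D.total ≤ Λ * D.total := by
          gcongr
          linarith
        have h : a₂ ≤ a₂ * D.total := le_mul_of_one_le_right ha₂.le hN1
        unfold shapeTau
        linarith
      rateLam_le := fun η => by
        have hV := D.driftV_nonneg η
        have h := D.effSq_le hq0 hr0 hm0 hm hl η
        have : (b₁ + 2 * (m + 1) + 4 * m * l) * q * (1 + D.driftV η) ≤
            Λ * q * (1 + D.driftV η) := by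
          gcongr
          linarith
        refine le_trans ?_ this
        unfold rateLam
        have e1 : b₁ ≤ b₁ * (q * (1 + D.driftV η)) := by
          refine le_mul_of_one_le_right hb₁.le ?_
          exact one_le_mul_of_one_le_of_one_le (by linarith) (by linarith)
        have e2 : 0 ≤ 4 * m * l * (q * D.driftV η) := by positivity
        have e3 : 0 ≤ (m + 1) * q := by positivity
        clear_value Λ
        clear hl hc hcr hm hk₁ hk₂ hΛ
        linarith
      rateTau_le := fun η => by
        have hV := D.driftV_nonneg η
        have h := D.resSq_le hq0 hr0 hl η
        rw [← hN] at h
        have : (b₂ + 3 / 2 * (l + 1)) * D.total * (1 + D.driftV η) ≤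
            Λ * D.total * (1 + D.driftV η) := by
          gcongr
          linarith
        refine le_trans ?_ this
        unfold rateTau
        have e1 : b₂ ≤ b₂ * (D.total * (1 + D.driftV η)) := by
          refine le_mul_of_one_le_right hb₂.le ?_
          exact one_le_mul_of_one_le_of_one_le hN1 (by linarith)
        have e2 : 0 ≤ l * (D.total * D.driftV η) := by positivity
        linarith }

end MixedModelData

end Design

/-! ### Asymptotics in the number of groups -/

noncomputable section Asymptotics

theorem geometricRate_nonneg {α : Type*} [MeasurableSpace α] (K : Kernel α α) (π : Measure α) :
    0 ≤ geometricRate K π :=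
  Real.sInf_nonneg fun _ h => h.1

/-- A geometric bound from the second step on bounds the rate; the first step is absorbed by the
prefactor. -/
theorem geometricRate_le {α : Type*} [MeasurableSpace α] {K : Kernel α α} [IsMarkovKernel K]
    {π : Measure α} {ρ : ℝ} (h0 : 0 < ρ) (h1 : ρ ≤ 1) {B : α → ℝ} (hB : ∀ x, 0 ≤ B x)
    (h : ∀ x, ∀ n : ℕ, 2 ≤ n → tvDist ((K ^ n) x) π ≤ ENNReal.ofReal (B x * ρ ^ (n - 1))) :
    geometricRate K π ≤ ρ := by
  refine csInf_le ⟨0, fun _ h => h.1⟩ ⟨h0.le, h1, fun x => (B x + 1) / ρ, fun x => ?_, ?_⟩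
  · have := hB x
    positivity
  intro x n hn
  have hx := hB x
  have e : (B x + 1) / ρ * ρ ^ n = (B x + 1) * ρ ^ (n - 1) := by
    obtain ⟨m, rfl⟩ : ∃ m, n = m + 1 := ⟨n - 1, by omega⟩
    rw [Nat.add_sub_cancel, pow_succ]
    field_simp
  rw [e]
  rcases Nat.lt_or_ge n 2 with h2 | h2
  · obtain rfl : n = 1 := by omega
    have := isMarkovKernel_pow K 1
    refine iSup₂_le fun S _ => tsub_le_self.trans (prob_le_one.trans ?_)
    rw [ENNReal.one_le_ofReal]
    simp
    linarith
  · refine (h x n h2).trans (ENNReal.ofReal_le_ofReal ?_)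
    gcongr
    linarith

/-- The assumptions of the theorem give, for all large `q`, the bounds of the convergence analysis
with one constant. -/
theorem exists_eventually_bounds {a₁ a₂ b₁ b₂ : ℝ} (ha₁ : 0 < a₁) (ha₂ : 0 < a₂) (hb₁ : 0 < b₁)
    (hb₂ : 0 < b₂) (D : (q : ℕ) → MixedModelData q)
    (hB1 : ∃ m : ℝ, 0 < m ∧ ∀ q : ℕ, 1 ≤ q → ((D q).rMax : ℝ) / ((D q).rMin : ℝ) ≤ m)
    (hB2 : ∃ k₁ k₂ : ℝ, 0 < k₁ ∧ 0 < k₂ ∧ ∀ᶠ q : ℕ in atTop,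
      k₁ ≤ lambdaMin (((D q).rBar * q)⁻¹ •
        ((D q).designXᵀ * (D q).designX - (D q).designXBarᵀ * (D q).designXBar)) ∧
      lambdaMax (((D q).rBar * q)⁻¹ • ((D q).designXᵀ * (D q).designX)) ≤ k₂)
    (hB3 : ∃ l : ℝ, 0 < l ∧ ∀ q : ℕ, 1 ≤ q →
      ((D q).rBar * q)⁻¹ * ∑ i, ∑ j, (D q).y i j ^ 2 ≤ l)
    (hB4 : (fun q : ℕ => ((D q).p : ℝ)) =O[atTop] (fun q : ℕ => (q : ℝ)))
    (hr : ∀ᶠ q : ℕ in atTop, (q : ℝ) ^ 2 ≤ (D q).rBar) :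
    ∃ Λ : ℝ, ∀ᶠ q : ℕ in atTop, (D q).Bounds a₁ a₂ b₁ b₂ Λ := by
  obtain ⟨m, hm0, hm⟩ := hB1
  obtain ⟨k₁, k₂, hk₁0, hk₂0, hk⟩ := hB2
  obtain ⟨l, hl0, hl⟩ := hB3
  obtain ⟨c, hc0, hc⟩ := hB4.exists_pos
  have hc' := hc.bound
  refine ⟨2 + a₁ + a₂ + 2 * b₁ + 2 * b₂ + 1 / b₁ + 1 / b₂ +
      (1 / k₁ + 2 * m + 2 * m * (k₂ / k₁)) + 2 * (k₂ + m) + 3 * l + c + 2 +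
      2 * (m + 1) + 4 * m * l, ?_⟩
  filter_upwards [hr, hk, hc', eventually_ge_atTop 4,
    tendsto_natCast_atTop_atTop.eventually_ge_atTop (c + 1)] with q h1 h2 h3 h4 h5
  have hq4 : (4 : ℝ) ≤ q := by exact_mod_cast h4
  rw [Real.norm_of_nonneg (by positivity), Real.norm_of_nonneg (by positivity)] at h3
  exact (D q).bounds_of_assumptions ha₁ ha₂ hb₁ hb₂ hq4 h1 hm0 (hm q (by omega)) hk₁0 hk₂0 h2.1
    h2.2 hl0 (hl q (by omega)) hc0.le h3 (by nlinarith)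

theorem tendsto_sqrt_zero {f : ℕ → ℝ} (h : Tendsto f atTop (𝓝 0)) :
    Tendsto (fun q => √(f q)) atTop (𝓝 0) := by
  have := (Real.continuous_sqrt.tendsto 0).comp h
  rwa [Real.sqrt_zero] at this

end Asymptotics

theorem proposition1 (a₁ a₂ b₁ b₂ : ℝ) (ha₁ : 0 < a₁) (ha₂ : 0 < a₂) (hb₁ : 0 < b₁) (hb₂ : 0 < b₂)
    (D : (q : ℕ) → MixedModelData q)
    (hB1 : ∃ m : ℝ, 0 < m ∧ ∀ q : ℕ, 1 ≤ q → ((D q).rMax : ℝ) / ((D q).rMin : ℝ) ≤ m)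
    (hB2 : ∃ k₁ k₂ : ℝ, 0 < k₁ ∧ 0 < k₂ ∧ ∀ᶠ q : ℕ in atTop,
      k₁ ≤ lambdaMin (((D q).rBar * q)⁻¹ •
        ((D q).designXᵀ * (D q).designX - (D q).designXBarᵀ * (D q).designXBar)) ∧
      lambdaMax (((D q).rBar * q)⁻¹ • ((D q).designXᵀ * (D q).designX)) ≤ k₂)
    (hB3 : ∃ l : ℝ, 0 < l ∧ ∀ q : ℕ, 1 ≤ q →
      ((D q).rBar * q)⁻¹ * ∑ i, ∑ j, (D q).y i j ^ 2 ≤ l)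
    (hB4 : (fun q : ℕ => ((D q).p : ℝ)) =O[atTop] (fun q : ℕ => (q : ℝ)))
    (hB5 : ∃ δ : ℝ, 0 < δ ∧
      Tendsto (fun q : ℕ => (D q).rBar / (q : ℝ) ^ (2 + δ)) atTop atTop) :
    (∃ (C C' L₀ : ℝ) (ρ : ℕ → ℝ) (q₀ : ℕ),
      0 < C ∧ 0 < C' ∧ 0 < L₀ ∧ 0 < q₀ ∧ (∀ q, 0 ≤ ρ q ∧ ρ q < 1) ∧ Tendsto ρ atTop (𝓝 0) ∧
      ∀ q : ℕ, q₀ ≤ q →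
        IsMarkovKernel ((D q).gibbsKernel a₁ a₂ b₁ b₂) ∧
        IsProbabilityMeasure ((D q).posterior a₁ a₂ b₁ b₂) ∧
        ((D q).gibbsKernel a₁ a₂ b₁ b₂).Invariant ((D q).posterior a₁ a₂ b₁ b₂) ∧
        ∀ (η : (D q).State) (n : ℕ), 2 ≤ n →
          tvDist (((D q).gibbsKernel a₁ a₂ b₁ b₂ ^ n) η) ((D q).posterior a₁ a₂ b₁ b₂) ≤
            ENNReal.ofReal (C * q * (D q).rBar ^ (3 / 2 : ℝ)) *
              wassersteinDist (((D q).gibbsKernel a₁ a₂ b₁ b₂ ^ (n - 1)) η)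
                ((D q).posterior a₁ a₂ b₁ b₂) ∧
          ENNReal.ofReal (C * q * (D q).rBar ^ (3 / 2 : ℝ)) *
              wassersteinDist (((D q).gibbsKernel a₁ a₂ b₁ b₂ ^ (n - 1)) η)
                ((D q).posterior a₁ a₂ b₁ b₂) ≤
            ENNReal.ofReal (C' * (q : ℝ) ^ 2 * (D q).rBar ^ (3 / 2 : ℝ) *
              ((D q).driftV η + L₀) * ρ q ^ (n - 1))) ∧
    Tendsto (fun q : ℕ => geometricRate ((D q).gibbsKernel a₁ a₂ b₁ b₂)
      ((D q).posterior a₁ a₂ b₁ b₂)) atTop (𝓝 0) := by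
  obtain ⟨δ, hδ, hB5⟩ := hB5
  have hlarge : ∀ᶠ q : ℕ in atTop, (q : ℝ) ^ 2 * (q : ℝ) ^ δ ≤ (D q).rBar := by
    filter_upwards [hB5.eventually_ge_atTop 1, eventually_ge_atTop 1] with q h1 h2
    have hq : (0 : ℝ) < q := by exact_mod_cast h2
    rw [le_div_iff₀ (by positivity), one_mul, Real.rpow_add hq] at h1
    exact_mod_cast h1
  have hqinv : Tendsto (fun q : ℕ => 1 / (q : ℝ)) atTop (𝓝 0) := tendsto_one_div_atTop_nhds_zero_nat
  have hratio : Tendsto (fun q : ℕ => (q : ℝ) ^ 2 / (D q).rBar) atTop (𝓝 0) := by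
    have h : Tendsto (fun q : ℕ => (q : ℝ) ^ (-δ)) atTop (𝓝 0) :=
      (tendsto_rpow_neg_atTop hδ).comp tendsto_natCast_atTop_atTop
    refine squeeze_zero' (Eventually.of_forall fun q => ?_) ?_ h
    · have := (D q).rBar_nonneg
      positivity
    · filter_upwards [hlarge, eventually_ge_atTop 1] with q h1 h2
      have hq : (0 : ℝ) < q := by exact_mod_cast h2
      have hp := Real.rpow_pos_of_pos hq δ
      have h3 : (0 : ℝ) < (q : ℝ) ^ 2 * (q : ℝ) ^ δ := by positivity
      rw [div_le_iff₀ (h3.trans_le h1), Real.rpow_neg hq.le, ← div_eq_inv_mul, le_div_iff₀ hp]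
      exact h1
  have hr : ∀ᶠ q : ℕ in atTop, (q : ℝ) ^ 2 ≤ (D q).rBar := by
    filter_upwards [hlarge, eventually_ge_atTop 1] with q h1 h2
    have hq : (1 : ℝ) ≤ q := by exact_mod_cast h2
    exact (le_mul_of_one_le_right (by positivity) (Real.one_le_rpow hq hδ.le)).trans h1
  obtain ⟨Λ, hΛ⟩ := exists_eventually_bounds ha₁ ha₂ hb₁ hb₂ D hB1 hB2 hB3 hB4 hr
  obtain ⟨q₁, hq₁⟩ := hΛ.exists
  have hΛ1 : 1 ≤ Λ := hq₁.hΛ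
  clear hq₁
  -- `s ^ 8` is the size of the overlap error, and the coupling uses the sublevel set with
  -- `R = 1 / s`, so that `R ^ 5 * s ^ 8` and `1 / R` both vanish; the summand `q ^ (-1 / 8)` of `ρ'`
  -- ensures `1 ≤ ρ ^ 4 * √q`
  set ε : ℕ → ℝ := fun q => q / √(D q).rBar + 1 / √(q : ℝ) with hε
  set s : ℕ → ℝ := fun q => √√√(ε q) with hs
  set A : ℝ := 300 * Λ ^ 5 + 10 + (216 * Λ ^ 7) ^ 2 + 216 * Λ ^ 7 with hA
  set ρ' : ℕ → ℝ := fun q => √(A * s q) + √√√(1 / (q : ℝ)) with hρ'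
  set ρ : ℕ → ℝ := fun q => min (ρ' q) (1 / 2) with hρ
  have hεt : Tendsto ε atTop (𝓝 0) := by
    have h1 : Tendsto (fun q : ℕ => (q : ℝ) / √(D q).rBar) atTop (𝓝 0) := by
      refine (tendsto_sqrt_zero hratio).congr fun q => ?_
      rw [Real.sqrt_div (by positivity), Real.sqrt_sq (by positivity)]
    have h2 : Tendsto (fun q : ℕ => 1 / √(q : ℝ)) atTop (𝓝 0) := by
      refine (tendsto_sqrt_zero hqinv).congr fun q => ?_
      rw [Real.sqrt_div zero_le_one, Real.sqrt_one]
    have h := h1.add h2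
    rwa [add_zero] at h
  have hst : Tendsto s atTop (𝓝 0) := tendsto_sqrt_zero (tendsto_sqrt_zero (tendsto_sqrt_zero hεt))
  have hρ't : Tendsto ρ' atTop (𝓝 0) := by
    have h1 : Tendsto (fun q => A * s q) atTop (𝓝 0) := by simpa using hst.const_mul A
    have h2 := tendsto_sqrt_zero (tendsto_sqrt_zero (tendsto_sqrt_zero hqinv))
    have h := (tendsto_sqrt_zero h1).add h2
    rwa [add_zero] at h
  have hρ'0 : ∀ q, 0 ≤ ρ' q := fun q => by positivity
  have hρ0 : ∀ q, 0 ≤ ρ q := fun q => le_min (hρ'0 q) (by norm_num)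
  have hρ1 : ∀ q, ρ q < 1 := fun q => lt_of_le_of_lt (min_le_right _ _) (by norm_num)
  have hρt : Tendsto ρ atTop (𝓝 0) :=
    squeeze_zero hρ0 (fun q => min_le_left _ _) hρ't
  set W : ℝ := 2664 * Λ ^ 3 * (119 * Λ ^ 6) ^ 5 with hW
  have hγt : Tendsto (fun q : ℕ => 216 * Λ ^ 7 * ((q : ℝ) ^ 2 / (D q).rBar + 1 / q)) atTop
      (𝓝 0) := by
    simpa using (hratio.add hqinv).const_mul (216 * Λ ^ 7)
  have hmain : ∀ᶠ q : ℕ in atTop, (D q).Bounds a₁ a₂ b₁ b₂ Λ ∧ 0 < ρ q ∧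
      ∀ (η : (D q).State) (n : ℕ), 1 ≤ n →
        wassersteinDist (((D q).gibbsKernel a₁ a₂ b₁ b₂ ^ n) η) ((D q).posterior a₁ a₂ b₁ b₂) ≤
          ENNReal.ofReal (W * q * ((D q).driftV η + 1) * ρ q ^ n) := by
    filter_upwards [hΛ, hρ't.eventually (eventually_le_nhds (by norm_num : (0 : ℝ) < 1 / 2)),
      hst.eventually (eventually_le_nhds (by norm_num : (0 : ℝ) < 1)),
      hγt.eventually (eventually_le_nhds (by norm_num : (0 : ℝ) < 1 / 2))] with q H hρq hsq hγq
    have hq := H.qR_pos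
    have hrp := H.rBar_pos
    have hρe : ρ q = ρ' q := min_eq_left hρq
    have hu : 0 < √(q : ℝ) := Real.sqrt_pos.2 hq
    have hv : 0 < √(D q).rBar := Real.sqrt_pos.2 hrp
    have hε0 : 0 < ε q := by
      simp only [hε]
      positivity
    have hs0 : 0 < s q := Real.sqrt_pos.2 (Real.sqrt_pos.2 (Real.sqrt_pos.2 hε0))
    have hs8 : s q ^ 8 = ε q := by
      have e1 : s q ^ 2 = √√(ε q) := Real.sq_sqrt (Real.sqrt_nonneg _)
      have e2 : √√(ε q) ^ 2 = √(ε q) := Real.sq_sqrt (Real.sqrt_nonneg _)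
      have e3 : √(ε q) ^ 2 = ε q := Real.sq_sqrt hε0.le
      calc s q ^ 8 = ((s q ^ 2) ^ 2) ^ 2 := by ring
        _ = _ := by rw [e1, e2, e3]
    have ht0 : 0 < √√√(1 / (q : ℝ)) :=
      Real.sqrt_pos.2 (Real.sqrt_pos.2 (Real.sqrt_pos.2 (by positivity)))
    have ht4 : √√√(1 / (q : ℝ)) ^ 4 = √(1 / (q : ℝ)) := by
      have e1 : √√√(1 / (q : ℝ)) ^ 2 = √√(1 / (q : ℝ)) := Real.sq_sqrt (Real.sqrt_nonneg _)
      have e2 : √√(1 / (q : ℝ)) ^ 2 = √(1 / (q : ℝ)) := Real.sq_sqrt (Real.sqrt_nonneg _)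
      calc _ = (√√√(1 / (q : ℝ)) ^ 2) ^ 2 := by ring
        _ = _ := by rw [e1, e2]
    have hρpos : 0 < ρ' q := by
      simp only [hρ']
      positivity
    refine ⟨H, hρe ▸ hρpos, fun η n hn => ?_⟩
    set γ : ℝ := 216 * Λ ^ 7 * ((q : ℝ) ^ 2 / (D q).rBar + 1 / q) with hγ
    have hγ0 : 0 ≤ γ := by positivity
    have hγs : γ ≤ 216 * Λ ^ 7 * s q := by
      have e : (q : ℝ) ^ 2 / (D q).rBar + 1 / q ≤ ε q ^ 2 := by
        have e1 : (q : ℝ) ^ 2 / (D q).rBar = (q / √(D q).rBar) ^ 2 := by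
          rw [div_pow, Real.sq_sqrt hrp.le]
        have e2 : 1 / (q : ℝ) = (1 / √(q : ℝ)) ^ 2 := by
          rw [div_pow, Real.sq_sqrt hq.le, one_pow]
        have e3 : 0 ≤ q / √(D q).rBar * (1 / √(q : ℝ)) := by positivity
        rw [e1, e2]
        simp only [hε]
        linarith [add_sq (q / √(D q).rBar) (1 / √(q : ℝ))]
      have e2 : ε q ^ 2 ≤ s q := by
        rw [← hs8, ← pow_mul]
        exact pow_le_of_le_one hs0.le hsq (by norm_num)
      exact mul_le_mul_of_nonneg_left (e.trans e2) (by positivity)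
    refine H.wassersteinDist_pow_le (R := 1 / s q) (γ := γ) (one_le_one_div hs0 hsq) rfl hγq rfl ?_
      (hρ0 q) (hρ1 q).le ?_ η hn
    · have e1 : A * s q ≤ ρ q ^ 2 := by
        have h0 : 0 ≤ A * s q := by positivity
        rw [hρe, ← Real.sq_sqrt h0]
        refine pow_le_pow_left₀ (Real.sqrt_nonneg _) ?_ 2
        simp only [hρ']
        linarith
      refine le_trans ?_ e1
      have e2 : 300 * Λ ^ 5 * (1 / s q) ^ 4 * ε q * (1 / s q) = 300 * Λ ^ 5 * s q ^ 3 := by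
        rw [← hs8]
        field_simp
      have e3 : s q ^ 3 ≤ s q := pow_le_of_le_one hs0.le hsq (by norm_num)
      have e4 : γ ^ 2 * (1 / s q) ≤ (216 * Λ ^ 7) ^ 2 * s q := by
        calc _ ≤ (216 * Λ ^ 7 * s q) ^ 2 * (1 / s q) := by gcongr
          _ = _ := by field_simp
      have e5 : 300 * Λ ^ 5 * s q ^ 3 ≤ 300 * Λ ^ 5 * s q := by gcongr
      have e6 : 10 / (1 / s q) = 10 * s q := by field_simp
      change 300 * Λ ^ 5 * (1 / s q) ^ 4 * ε q * (1 / s q) + _ + _ + _ ≤ _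
      rw [e2, e6, hA]
      linarith
    · have e1 : √(1 / (q : ℝ)) ≤ ρ q ^ 4 := by
        rw [hρe, ← ht4]
        refine pow_le_pow_left₀ ht0.le ?_ 4
        simp only [hρ']
        linarith [Real.sqrt_nonneg (A * s q)]
      have e2 : √(1 / (q : ℝ)) * √(q : ℝ) = 1 := by
        rw [Real.sqrt_div zero_le_one, Real.sqrt_one]
        field_simp
      rw [← e2]
      gcongr
  have htv : ∀ {q : ℕ}, (D q).Bounds a₁ a₂ b₁ b₂ Λ →
      (∀ (η : (D q).State) (n : ℕ), 1 ≤ n →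
        wassersteinDist (((D q).gibbsKernel a₁ a₂ b₁ b₂ ^ n) η) ((D q).posterior a₁ a₂ b₁ b₂) ≤
          ENNReal.ofReal (W * q * ((D q).driftV η + 1) * ρ q ^ n)) →
      ∀ (η : (D q).State) (n : ℕ), 2 ≤ n →
          tvDist (((D q).gibbsKernel a₁ a₂ b₁ b₂ ^ n) η) ((D q).posterior a₁ a₂ b₁ b₂) ≤
            ENNReal.ofReal (9 * Λ ^ 3 * q * (D q).rBar ^ (3 / 2 : ℝ)) *
              wassersteinDist (((D q).gibbsKernel a₁ a₂ b₁ b₂ ^ (n - 1)) η)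
                ((D q).posterior a₁ a₂ b₁ b₂) ∧
          ENNReal.ofReal (9 * Λ ^ 3 * q * (D q).rBar ^ (3 / 2 : ℝ)) *
              wassersteinDist (((D q).gibbsKernel a₁ a₂ b₁ b₂ ^ (n - 1)) η)
                ((D q).posterior a₁ a₂ b₁ b₂) ≤
            ENNReal.ofReal (9 * Λ ^ 3 * W * (q : ℝ) ^ 2 * (D q).rBar ^ (3 / 2 : ℝ) *
              ((D q).driftV η + 1) * ρ q ^ (n - 1)) := by
    intro q H hw η n hn
    have hrp := Real.rpow_pos_of_pos H.rBar_pos (3 / 2)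
    obtain ⟨k, rfl⟩ : ∃ k, n = k + 1 := ⟨n - 1, by omega⟩
    rw [Nat.add_sub_cancel]
    refine ⟨H.tvDist_pow_succ_le η k, ?_⟩
    calc _ ≤ ENNReal.ofReal (9 * Λ ^ 3 * q * (D q).rBar ^ (3 / 2 : ℝ)) *
          ENNReal.ofReal (W * q * ((D q).driftV η + 1) * ρ q ^ k) := by
          have := hw η k (by omega)
          gcongr
      _ = _ := by
          rw [← ENNReal.ofReal_mul (by positivity)]
          congr 1
          ring
  obtain ⟨q₀, hq₀⟩ := eventually_atTop.1 hmain
  refine ⟨⟨9 * Λ ^ 3, 9 * Λ ^ 3 * W, 1, ρ, q₀ + 1, by positivity, by positivity, one_pos,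
    Nat.succ_pos _, fun q => ⟨hρ0 q, hρ1 q⟩, hρt, fun q hq => ?_⟩, ?_⟩
  · obtain ⟨H, -, hw⟩ := hq₀ q (by omega)
    exact ⟨H.regular.isMarkovKernel, H.regular.isProbabilityMeasure_posterior,
      H.regular.invariant, htv H hw⟩
  · refine squeeze_zero' (Eventually.of_forall fun q => geometricRate_nonneg _ _) ?_ hρt
    filter_upwards [hmain] with q hq
    obtain ⟨H, hρq, hw⟩ := hq
    have := H.regular.isMarkovKernel
    have hrp := Real.rpow_pos_of_pos H.rBar_pos (3 / 2)
    refine geometricRate_le hρq (hρ1 q).le (B := fun η => 9 * Λ ^ 3 * W * (q : ℝ) ^ 2 *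
      (D q).rBar ^ (3 / 2 : ℝ) * ((D q).driftV η + 1)) (fun η => ?_)
      (fun η n hn => (htv H hw η n hn).1.trans (htv H hw η n hn).2)
    have := (D q).driftV_nonneg η
    positivity
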